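/- Let $M,N$ be natural numbers, $\Lambda\in\mathbb{R}^{M\times N}$ and $t\in\mathbb{R}^N$ with $t\neq 0$. On the Hilbert space $\mathcal{H}=L^2(\mathbb{R}^M,\mathbb{C}^{2^N})$ let $\sigma_a^n$ ($a\in\{x,z\}$, $n=1,\dots,N$) be the Pauli matrix $\sigma_a$ acting on the $n$-th factor of $\mathbb{C}^{2^N}=\bigotimes^N\mathbb{C}^2$, and consider $$H_0=-\Delta+|x|^2+\sum_{m=1}^M\sum_{n=1}^N x_m\Lambda_{mn}\sigma_z^n-\sum_{n=1}^N t_n\sigma_x^n ,$$ in the sense of quadratic forms on the form domain $Q_0=\{\psi\in\mathcal{H}:\nabla\psi\in L^2,\ |x|\psi\in L^2\}$ (weak gradient). Let $\mathcal{D}(Q_0)$ be the set of all density matrices $\Gamma=\sum_{j}c_j|\psi_j\rangle\langle\psi_j|$ on $\mathcal{H}$, where the sum is finite or countably infinite, $c_j\ge 0$, $\sum_j c_j=1$, the $\psi_j\in Q_0$ are $L^2$-orthonormal, and $\sum_j c_j(\|\nabla\psi_j\|^2+\|x\psi_j\|^2)<\infty$. For such $\Gamma$ and for an observable $A$ whose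 quadratic form is defined and bounded on $Q_0$ put $\operatorname{Tr}(A\Gamma)=\sum_j c_j\langle\psi_j,A\psi_j\rangle$ (in the form sense; in particular $\operatorname{Tr}(-\Delta\,\Gamma)=\sum_j c_j\|\nabla\psi_j\|^2$), which does not depend on the chosen decomposition, and let $$\sigma_\Gamma=(\operatorname{Tr}\sigma_z^n\Gamma)_{n=1}^N,\qquad \xi_\Gamma=(\operatorname{Tr}x_m\Gamma)_{m=1}^M .$$ The Lieb functional is $$F_{\mathrm L}(\sigma,\xi)=\inf\{\operatorname{Tr}(H_0\Gamma):\Gamma\in\mathcal{D}(Q_0),\ \sigma_\Gamma=\sigma,\ \xi_\Gamma=\xi\}\in[-\infty,+\infty],\qquad (\sigma,\xi)\in\mathbb{R}^N\times\mathbb{R}^M,$$ with $\inf\emptyset=+\infty$. An optimizer of $F_{\mathrm L}(\sigma,\xi)$ is a $\Gamma\in\mathcal{D}(Q_0)$ with $\sigma_\Gamma=\sigma$, $\xi_\Gamma=\xi$ and $\operatorname{Tr}(H_0\Gamma)=F_{\mathrm L}(\sigma,\xi)$. **Theorem 3.14 (Properties of $F_{\mathrm L}$).** For every $(\sigma,\xi)\in[-1,1]^N\times\mathbb{R}^M$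 the following hold. (i) (Displacement rule) For every $\zeta\in\mathbb{R}^M$, $$F_{\mathrm L}(\sigma,\xi+\zeta)=F_{\mathrm L}(\sigma,\xi)+2\zeta\cdot\xi+\zeta\cdot\Lambda\sigma+|\zeta|^2 .$$ In particular, $F_{\mathrm L}(\sigma,\xi)=F_{\mathrm L}(\sigma,0)+\xi\cdot\Lambda\sigma+|\xi|^2$. (ii) There is an optimizer $\Gamma$ of $F_{\mathrm L}(\sigma,\xi)$ that is real-valued in the sense of kernels: $\Gamma$ is given by a square-integrable integral kernel $\Gamma(x,x')\in\mathbb{C}^{2^N\times 2^N}$ with $\overline{\Gamma(x,x')}=\Gamma(x,x')$ (entrywise). (iii) (Virial relation) Every optimizer $\Gamma$ of $F_{\mathrm L}(\sigma,0)$ satisfies $$\operatorname{Tr}\big((-\Delta-|x|^2)\Gamma\big)=\tfrac12\operatorname{Tr}\big((x\cdot\Lambda\sigma_z)\Gamma\big),\qquad x\cdot\Lambda\sigma_z=\sum_{m,n}x_m\Lambda_{mn}\sigma_z^n .$$ (iv) (Zero momentum) Every optimizer $\Gamma$ of $F_{\mathrm L}(\sigma,\xi)$ satisfies $\langle -i\nabla\rangle_\Gamma=0$,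 i.e. $\operatorname{Tr}(-i\partial_{x_m}\Gamma)=0$ for $m=1,\dots,M$. -/

import Mathlib

open MeasureTheory
open scoped ENNReal InnerProductSpace ContDiff Matrix ComplexConjugate

noncomputable section

namespace MultiModeDicke

/-! ### The Hilbert space -/

/-- The configuration space `ℝ^M` of the `M` photon modes. -/
abbrev Modes (M : ℕ) : Type := EuclideanSpace ℝ (Fin M)

/-- Spin multi-indices `α ∈ {+, -}^N`; the value `0` stands for `+` and `1` for `-`. -/
abbrev Spins (N : ℕ) : Type := Fin N → Fin 2

/-- The spinor space `ℂ^(2^N)`, with coordinates indexed by `{+, -}^N`. -/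
abbrev Spinor (N : ℕ) : Type := EuclideanSpace ℂ (Spins N)

/-- The Hilbert space `L²(ℝ^M, ℂ^(2^N))`. -/
abbrev Hilb (M N : ℕ) : Type := Lp (Spinor N) 2 (volume : Measure (Modes M))

/-! ### Lifted Pauli matrices -/

/-- The Pauli matrix `σ_x`. -/
def pauliX : Matrix (Fin 2) (Fin 2) ℂ := !![0, 1; 1, 0]

/-- The Pauli matrix `σ_z`. -/
def pauliZ : Matrix (Fin 2) (Fin 2) ℂ := !![1, 0; 0, -1]

/-- `1 ⊗ ⋯ ⊗ A ⊗ ⋯ ⊗ 1`, with `A` in the `n`-th tensor factor, as a `2^N × 2^N` matrix. -/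
def liftMatrix {N : ℕ} (A : Matrix (Fin 2) (Fin 2) ℂ) (n : Fin N) :
    Matrix (Spins N) (Spins N) ℂ :=
  Matrix.of fun α β => A (α n) (β n) * ∏ k ∈ Finset.univ.erase n, if α k = β k then 1 else 0

/-- The action of a spin matrix on the Hilbert space: `(B ψ)(x) = B (ψ(x))`. -/
def spinOp (M : ℕ) {N : ℕ} (B : Matrix (Spins N) (Spins N) ℂ) : Hilb M N →L[ℂ] Hilb M N :=
  (Matrix.toEuclideanCLM (n := Spins N) (𝕜 := ℂ) B).compLpL 2 volume

/-- The lifted Pauli matrix `σ_x^n` acting on the Hilbert space. -/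
def sigmaX (M : ℕ) {N : ℕ} (n : Fin N) : Hilb M N →L[ℂ] Hilb M N :=
  spinOp M (liftMatrix pauliX n)

/-- The lifted Pauli matrix `σ_z^n` acting on the Hilbert space. -/
def sigmaZ (M : ℕ) {N : ℕ} (n : Fin N) : Hilb M N →L[ℂ] Hilb M N :=
  spinOp M (liftMatrix pauliZ n)

/-! ### Weak derivatives, multiplication by coordinates, and the form domain -/

/-- `g` is the weak partial derivative `∂ψ/∂x_m`. -/
def HasWeakPartial {M N : ℕ} (m : Fin M) (ψ g : Hilb M N) : Prop :=
  ∀ f : Modes M → ℂ, ContDiff ℝ ∞ f → HasCompactSupport f →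
    ∫ x, fderiv ℝ f x (EuclideanSpace.single m 1) • ψ x = - ∫ x, f x • g x

/-- `g` is the function `x ↦ x_m ψ(x)`. -/
def HasPosition {M N : ℕ} (m : Fin M) (ψ g : Hilb M N) : Prop :=
  ∀ᵐ x, g x = ((x m : ℝ) : ℂ) • ψ x

theorem integrable_test_smul {M N : ℕ} {f : Modes M → ℂ} (hf : Continuous f)
    (hs : HasCompactSupport f) (ψ : Hilb M N) : Integrable (fun x => f x • ψ x) :=
  ((Lp.memLp ψ).locallyIntegrable (by norm_num)).integrable_smul_left_of_hasCompactSupport hf hs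

theorem continuous_test_deriv {M : ℕ} {f : Modes M → ℂ} (hf : ContDiff ℝ ∞ f) (v : Modes M) :
    Continuous fun x => fderiv ℝ f x v :=
  (hf.continuous_fderiv (by simp)).clm_apply continuous_const

theorem HasWeakPartial.unique {M N : ℕ} {m : Fin M} {ψ g g' : Hilb M N}
    (h : HasWeakPartial m ψ g) (h' : HasWeakPartial m ψ g') : g = g' := by
  apply Lp.ext
  apply ae_eq_of_integral_contDiff_smul_eq ((Lp.memLp g).locallyIntegrable (by norm_num))
    ((Lp.memLp g').locallyIntegrable (by norm_num))
  intro f hf hs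
  have hc : ContDiff ℝ ∞ (fun x => (f x : ℂ)) := Complex.ofRealCLM.contDiff.comp hf
  have hs' : HasCompactSupport (fun x => (f x : ℂ)) := hs.comp_left Complex.ofReal_zero
  have := (h _ hc hs').symm.trans (h' _ hc hs')
  simpa using this

theorem HasWeakPartial.add {M N : ℕ} {m : Fin M} {ψ φ g k : Hilb M N}
    (h : HasWeakPartial m ψ g) (h' : HasWeakPartial m φ k) :
    HasWeakPartial m (ψ + φ) (g + k) := by
  intro f hf hs
  have hd := continuous_test_deriv hf (EuclideanSpace.single m (1 : ℝ))
  have hds : HasCompactSupport fun x => fderiv ℝ f x (EuclideanSpace.single m (1 : ℝ)) :=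
    hs.fderiv_apply ℝ _
  have e1 : ∫ x, fderiv ℝ f x (EuclideanSpace.single m 1) • (ψ + φ : Hilb M N) x
      = ∫ x, (fderiv ℝ f x (EuclideanSpace.single m 1) • ψ x
        + fderiv ℝ f x (EuclideanSpace.single m 1) • φ x) := by
    apply integral_congr_ae
    filter_upwards [Lp.coeFn_add ψ φ] with x hx
    rw [hx, Pi.add_apply, smul_add]
  have e2 : ∫ x, f x • (g + k : Hilb M N) x = ∫ x, (f x • g x + f x • k x) := by
    apply integral_congr_ae
    filter_upwards [Lp.coeFn_add g k] with x hx
    rw [hx, Pi.add_apply, smul_add]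
  rw [e1, e2, integral_add (integrable_test_smul hd hds ψ) (integrable_test_smul hd hds φ),
    integral_add (integrable_test_smul hf.continuous hs g)
      (integrable_test_smul hf.continuous hs k), h f hf hs, h' f hf hs]
  abel

theorem HasWeakPartial.smul {M N : ℕ} {m : Fin M} {ψ g : Hilb M N} (a : ℂ)
    (h : HasWeakPartial m ψ g) : HasWeakPartial m (a • ψ) (a • g) := by
  intro f hf hs
  have e1 : ∫ x, fderiv ℝ f x (EuclideanSpace.single m 1) • (a • ψ : Hilb M N) x
      = ∫ x, a • (fderiv ℝ f x (EuclideanSpace.single m 1) • ψ x) := by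
    apply integral_congr_ae
    filter_upwards [Lp.coeFn_smul a ψ] with x hx
    rw [hx, Pi.smul_apply, smul_comm]
  have e2 : ∫ x, f x • (a • g : Hilb M N) x = ∫ x, a • (f x • g x) := by
    apply integral_congr_ae
    filter_upwards [Lp.coeFn_smul a g] with x hx
    rw [hx, Pi.smul_apply, smul_comm]
  rw [e1, e2, integral_smul, integral_smul, h f hf hs, smul_neg]

theorem HasPosition.unique {M N : ℕ} {m : Fin M} {ψ g g' : Hilb M N}
    (h : HasPosition m ψ g) (h' : HasPosition m ψ g') : g = g' := by
  apply Lp.ext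
  filter_upwards [h, h'] with x hx hx'
  rw [hx, hx']

theorem HasPosition.add {M N : ℕ} {m : Fin M} {ψ φ g k : Hilb M N}
    (h : HasPosition m ψ g) (h' : HasPosition m φ k) : HasPosition m (ψ + φ) (g + k) := by
  filter_upwards [h, h', Lp.coeFn_add ψ φ, Lp.coeFn_add g k] with x hx hx' h1 h2
  rw [h1, h2, Pi.add_apply, Pi.add_apply, hx, hx', smul_add]

theorem HasPosition.smul {M N : ℕ} {m : Fin M} {ψ g : Hilb M N} (a : ℂ)
    (h : HasPosition m ψ g) : HasPosition m (a • ψ) (a • g) := by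
  filter_upwards [h, Lp.coeFn_smul a ψ, Lp.coeFn_smul a g] with x hx h1 h2
  rw [h1, h2, Pi.smul_apply, Pi.smul_apply, hx, smul_comm]

/-- The form domain `Q₀` of the Hamiltonian: all `ψ ∈ L²` with weak gradient in `L²` and
`|x| ψ ∈ L²`. -/
def formDomain (M N : ℕ) : Submodule ℂ (Hilb M N) where
  carrier := {ψ | ∀ m : Fin M, (∃ g, HasWeakPartial m ψ g) ∧ ∃ g, HasPosition m ψ g}
  add_mem' := by
    intro ψ φ hψ hφ m
    obtain ⟨⟨g, hg⟩, k, hk⟩ := hψ m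
    obtain ⟨⟨g', hg'⟩, k', hk'⟩ := hφ m
    exact ⟨⟨_, hg.add hg'⟩, _, hk.add hk'⟩
  zero_mem' := by
    intro m
    refine ⟨⟨0, fun f _ _ => ?_⟩, 0, ?_⟩
    · have e (u : Modes M → ℂ) : ∫ x, u x • (0 : Hilb M N) x = 0 := by
        rw [← integral_zero (Modes M) (Spinor N)]
        apply integral_congr_ae
        filter_upwards [Lp.coeFn_zero (Spinor N) 2 (volume : Measure (Modes M))] with x hx
        rw [hx, Pi.zero_apply, smul_zero]
      rw [e, e, neg_zero]
    · filter_upwards [Lp.coeFn_zero (Spinor N) 2 (volume : Measure (Modes M))] with x hx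
      rw [hx, Pi.zero_apply, smul_zero]
  smul_mem' := by
    intro a ψ hψ m
    obtain ⟨⟨g, hg⟩, k, hk⟩ := hψ m
    exact ⟨⟨_, hg.smul a⟩, _, hk.smul a⟩

/-- The weak partial derivative `∂_m : Q₀ → L²`. -/
def partialD (M N : ℕ) (m : Fin M) : formDomain M N →ₗ[ℂ] Hilb M N where
  toFun ψ := (ψ.2 m).1.choose
  map_add' ψ φ := HasWeakPartial.unique ((ψ + φ).2 m).1.choose_spec
    ((ψ.2 m).1.choose_spec.add (φ.2 m).1.choose_spec)
  map_smul' a ψ := HasWeakPartial.unique ((a • ψ).2 m).1.choose_spec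
    ((ψ.2 m).1.choose_spec.smul a)

/-- The position operator `x_m : Q₀ → L²`. -/
def position (M N : ℕ) (m : Fin M) : formDomain M N →ₗ[ℂ] Hilb M N where
  toFun ψ := (ψ.2 m).2.choose
  map_add' ψ φ := HasPosition.unique ((ψ + φ).2 m).2.choose_spec
    ((ψ.2 m).2.choose_spec.add (φ.2 m).2.choose_spec)
  map_smul' a ψ := HasPosition.unique ((a • ψ).2 m).2.choose_spec
    ((ψ.2 m).2.choose_spec.smul a)

theorem partialD_spec {M N : ℕ} (m : Fin M) (ψ : formDomain M N) :
    HasWeakPartial m (ψ : Hilb M N) (partialD M N m ψ) := (ψ.2 m).1.choose_spec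

theorem position_spec {M N : ℕ} (m : Fin M) (ψ : formDomain M N) :
    HasPosition m (ψ : Hilb M N) (position M N m ψ) := (ψ.2 m).2.choose_spec

/-! ### Sesquilinear forms of the observables -/

/-- Sesquilinear forms on `Q₀`, conjugate-linear in the first argument. -/
abbrev Form (M N : ℕ) : Type := formDomain M N →ₗ⋆[ℂ] formDomain M N →ₗ[ℂ] ℂ

/-- The form `(φ, ψ) ↦ ⟨A φ, B ψ⟩`. -/
def pairing {M N : ℕ} (A B : formDomain M N →ₗ[ℂ] Hilb M N) : Form M N :=
  LinearMap.mk₂'ₛₗ (starRingEnd ℂ) (RingHom.id ℂ) (fun φ ψ => ⟪A φ, B ψ⟫_ℂ)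
    (fun φ φ' ψ => by rw [map_add, inner_add_left])
    (fun a φ ψ => by rw [map_smul, inner_smul_left, smul_eq_mul])
    (fun φ ψ ψ' => by rw [map_add, inner_add_right])
    (fun a φ ψ => by rw [map_smul, inner_smul_right, smul_eq_mul, RingHom.id_apply])

/-- The form of a bounded operator: `(φ, ψ) ↦ ⟨φ, B ψ⟩`. -/
def boundedForm {M N : ℕ} (B : Hilb M N →L[ℂ] Hilb M N) : Form M N :=
  pairing (formDomain M N).subtype (B.toLinearMap ∘ₗ (formDomain M N).subtype)

/-- The form of `-Δ`, i.e. `(φ, ψ) ↦ ⟨∇φ, ∇ψ⟩`. -/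
def kineticForm (M N : ℕ) : Form M N := ∑ m, pairing (partialD M N m) (partialD M N m)

/-- The form of `|x|²`, i.e. `(φ, ψ) ↦ ⟨x φ, x ψ⟩`. -/
def squareForm (M N : ℕ) : Form M N := ∑ m, pairing (position M N m) (position M N m)

/-- The form of `x_m`. -/
def positionForm (M N : ℕ) (m : Fin M) : Form M N :=
  pairing (formDomain M N).subtype (position M N m)

/-- The form of the momentum operator `-i ∂_m`. -/
def momentumForm (M N : ℕ) (m : Fin M) : Form M N :=
  pairing (formDomain M N).subtype ((-Complex.I) • partialD M N m)

/-- The form of the coupling `x · Λ σ_z = ∑_{m,n} x_m Λ_{mn} σ_z^n`. -/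
def couplingForm {M N : ℕ} (Λ : Matrix (Fin M) (Fin N) ℝ) : Form M N :=
  ∑ m, ∑ n, (Λ m n : ℂ) •
    pairing (formDomain M N).subtype ((sigmaZ M n).toLinearMap ∘ₗ position M N m)

/-- The form of the internal Hamiltonian `H₀ = -Δ + |x|² + x · Λ σ_z - t · σ_x`. -/
def hamiltonianForm {M N : ℕ} (Λ : Matrix (Fin M) (Fin N) ℝ) (t : Fin N → ℝ) : Form M N :=
  kineticForm M N + squareForm M N + couplingForm Λ - ∑ n, (t n : ℂ) • boundedForm (sigmaX M n)

/-! ### Density matrices with finite energy, and traces -/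

/-- `‖∇ψ‖² + ‖x ψ‖²`. -/
def gradPosSq {M N : ℕ} (ψ : formDomain M N) : ℝ :=
  ∑ m, (‖partialD M N m ψ‖ ^ 2 + ‖position M N m ψ‖ ^ 2)

/-- `Γ = ∑_j c_j |ψ_j⟩⟨ψ_j|` with `c_j ≥ 0`, `∑_j c_j = 1`, the `ψ_j ∈ Q₀` orthonormal in `L²`, and
`∑_j c_j (‖∇ψ_j‖² + ‖x ψ_j‖²) < ∞`. Vectors with `c_j = 0` do not contribute and need not be
normalized, so that finite sums are covered. -/
structure IsDecomposition {M N : ℕ} (Γ : Hilb M N →L[ℂ] Hilb M N) (c : ℕ → ℝ)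
    (ψ : ℕ → formDomain M N) : Prop where
  nonneg : ∀ j, 0 ≤ c j
  hasSum_one : HasSum c 1
  orthonormal : Orthonormal ℂ fun j : {j // c j ≠ 0} => (ψ j : Hilb M N)
  summable : Summable fun j => c j * gradPosSq (ψ j)
  hasSum_apply : ∀ φ : Hilb M N,
    HasSum (fun j => (c j : ℂ) • ⟪(ψ j : Hilb M N), φ⟫_ℂ • (ψ j : Hilb M N)) (Γ φ)

/-- The set `𝒟(Q₀)` of density matrices with finite kinetic and potential energy. -/
def densityMatrices (M N : ℕ) : Set (Hilb M N →L[ℂ] Hilb M N) :=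
  {Γ | ∃ p : (ℕ → ℝ) × (ℕ → formDomain M N), IsDecomposition Γ p.1 p.2}

open Classical in
/-- The trace `Tr(A Γ) = ∑_j c_j ⟨ψ_j, A ψ_j⟩` for `Γ = ∑_j c_j |ψ_j⟩⟨ψ_j| ∈ 𝒟(Q₀)`, where `A` is
given by its form `a`. By `IsDecomposition.hasSum_trace`, the series converges and does not depend on
the decomposition when `a` is bounded on `Q₀`, which all forms used here are. -/
def trace {M N : ℕ} (a : Form M N) (Γ : Hilb M N →L[ℂ] Hilb M N) : ℂ :=
  if h : ∃ p : (ℕ → ℝ) × (ℕ → formDomain M N), IsDecomposition Γ p.1 p.2 then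
    ∑' j, (h.choose.1 j : ℂ) * a (h.choose.2 j) (h.choose.2 j)
  else 0

/-- Boundedness of (the diagonal of) a form with respect to the norm of `Q₀`. -/
def Form.IsBounded {M N : ℕ} (a : Form M N) : Prop :=
  ∃ C : ℝ, ∀ ψ, ‖a ψ ψ‖ ≤ C * (‖(ψ : Hilb M N)‖ ^ 2 + gradPosSq ψ)

theorem IsDecomposition.summable_form {M N : ℕ} {Γ : Hilb M N →L[ℂ] Hilb M N} {c : ℕ → ℝ}
    {ψ : ℕ → formDomain M N} (h : IsDecomposition Γ c ψ) {a : Form M N} (ha : a.IsBounded) :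
    Summable fun j => (c j : ℂ) * a (ψ j) (ψ j) := by
  obtain ⟨C, hC⟩ := ha
  refine Summable.of_norm_bounded (g := fun j => C * (c j + c j * gradPosSq (ψ j)))
    ((h.hasSum_one.summable.add h.summable).mul_left C) fun j => ?_
  rw [norm_mul, Complex.norm_real, Real.norm_of_nonneg (h.nonneg j)]
  rcases eq_or_ne (c j) 0 with h0 | h0
  · simp [h0]
  · have h1 : ‖(ψ j : Hilb M N)‖ = 1 := h.orthonormal.1 ⟨j, h0⟩
    have h2 := mul_le_mul_of_nonneg_left (hC (ψ j)) (h.nonneg j)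
    rw [h1] at h2
    linarith

theorem IsDecomposition.finite_fiber {M N : ℕ} {Γ : Hilb M N →L[ℂ] Hilb M N} {c : ℕ → ℝ}
    {ψ : ℕ → formDomain M N} (h : IsDecomposition Γ c ψ) {l : ℝ} (hl : l ≠ 0) :
    (c ⁻¹' {l}).Finite := by
  have h1 := h.hasSum_one.summable.tendsto_cofinite_zero
  have h2 : ∀ᶠ j in Filter.cofinite, c j ≠ l := h1.eventually_ne hl.symm
  rw [Filter.eventually_cofinite] at h2
  exact h2.subset fun j hj => not_not.2 hj

theorem IsDecomposition.apply_state {M N : ℕ} {Γ : Hilb M N →L[ℂ] Hilb M N} {c : ℕ → ℝ}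
    {ψ : ℕ → formDomain M N} (h : IsDecomposition Γ c ψ) (j : ℕ) (hj : c j ≠ 0) :
    Γ (ψ j) = (c j : ℂ) • (ψ j : Hilb M N) := by
  refine (h.hasSum_apply (ψ j)).unique ?_
  have e : (c j : ℂ) • (ψ j : Hilb M N)
      = (c j : ℂ) • ⟪(ψ j : Hilb M N), ψ j⟫_ℂ • (ψ j : Hilb M N) := by
    have := h.orthonormal.1 ⟨j, hj⟩
    rw [inner_self_eq_norm_sq_to_K, this]
    simp
  rw [e]
  refine hasSum_single j fun k hk => ?_
  rcases eq_or_ne (c k) 0 with h0 | h0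
  · simp [h0]
  · have : ⟪(ψ k : Hilb M N), ψ j⟫_ℂ = 0 :=
      h.orthonormal.2 (i := ⟨k, h0⟩) (j := ⟨j, hj⟩) (by simpa using hk)
    rw [this, zero_smul, smul_zero]

theorem IsDecomposition.inner_apply {M N : ℕ} {Γ : Hilb M N →L[ℂ] Hilb M N} {c : ℕ → ℝ}
    {ψ : ℕ → formDomain M N} (h : IsDecomposition Γ c ψ) (j : ℕ) (hj : c j ≠ 0) (φ : Hilb M N) :
    ⟪(ψ j : Hilb M N), Γ φ⟫_ℂ = (c j : ℂ) * ⟪(ψ j : Hilb M N), φ⟫_ℂ := by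
  have h1 := (h.hasSum_apply φ).mapL (innerSL ℂ (ψ j : Hilb M N))
  refine h1.unique ?_
  have e : (c j : ℂ) * ⟪(ψ j : Hilb M N), φ⟫_ℂ = innerSL ℂ (ψ j : Hilb M N)
      ((c j : ℂ) • ⟪(ψ j : Hilb M N), φ⟫_ℂ • (ψ j : Hilb M N)) := by
    have := h.orthonormal.1 ⟨j, hj⟩
    rw [innerSL_apply_apply, inner_smul_right, inner_smul_right, inner_self_eq_norm_sq_to_K, this]
    simp
  rw [e]
  refine hasSum_single j fun k hk => ?_
  rcases eq_or_ne (c k) 0 with h0 | h0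
  · simp [h0]
  · have : ⟪(ψ j : Hilb M N), ψ k⟫_ℂ = 0 :=
      h.orthonormal.2 (i := ⟨j, hj⟩) (j := ⟨k, h0⟩) (by simpa using hk.symm)
    rw [innerSL_apply_apply, inner_smul_right, inner_smul_right, this, mul_zero, mul_zero]

/-- An eigenvector of one decomposition expands in the eigenvectors of another one that belong to
the same eigenvalue. -/
theorem IsDecomposition.expand {M N : ℕ} {Γ : Hilb M N →L[ℂ] Hilb M N} {c d : ℕ → ℝ}
    {ψ φ : ℕ → formDomain M N} (h : IsDecomposition Γ c ψ) (h' : IsDecomposition Γ d φ)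
    {l : ℝ} (hl : l ≠ 0) (j : ℕ) (hj : c j = l) (K : Finset ℕ) (hK : ∀ k, k ∈ K ↔ d k = l) :
    ψ j = ∑ k ∈ K, ⟪(φ k : Hilb M N), ψ j⟫_ℂ • φ k := by
  have hl' : (l : ℂ) ≠ 0 := by exact_mod_cast hl
  have hcj : c j ≠ 0 := hj ▸ hl
  have h1 : Γ (ψ j) = (l : ℂ) • (ψ j : Hilb M N) := by rw [h.apply_state j hcj, hj]
  have h2 := h'.hasSum_apply (ψ j)
  have h3 := h2.unique (hasSum_sum_of_ne_finset_zero (s := K) fun k hk => by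
    rcases eq_or_ne (d k) 0 with h0 | h0
    · simp [h0]
    · have h4 := h'.inner_apply k h0 (ψ j)
      rw [h1, inner_smul_right] at h4
      have h5 : ((l : ℂ) - d k) * ⟪(φ k : Hilb M N), ψ j⟫_ℂ = 0 := by rw [sub_mul, h4, sub_self]
      have h6 : (l : ℂ) - d k ≠ 0 := by
        rw [sub_ne_zero]
        intro h7
        exact hk ((hK k).2 (by exact_mod_cast h7.symm))
      rw [(mul_eq_zero.1 h5).resolve_left h6, zero_smul, smul_zero])
  apply Subtype.ext
  apply smul_right_injective _ hl'
  simp only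
  rw [← h1, h3, Submodule.coe_sum, Finset.smul_sum]
  refine Finset.sum_congr rfl fun k hk => ?_
  rw [(hK k).1 hk]
  rfl

theorem IsDecomposition.sum_fiber {M N : ℕ} {Γ : Hilb M N →L[ℂ] Hilb M N} {c d : ℕ → ℝ}
    {ψ φ : ℕ → formDomain M N} (h : IsDecomposition Γ c ψ) (h' : IsDecomposition Γ d φ)
    (a : Form M N) {l : ℝ} (hl : l ≠ 0) (J K : Finset ℕ) (hJ : ∀ j, j ∈ J ↔ c j = l)
    (hK : ∀ k, k ∈ K ↔ d k = l) : ∑ j ∈ J, a (ψ j) (ψ j) = ∑ k ∈ K, a (φ k) (φ k) := by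
  have e1 : ∀ j ∈ J, a (ψ j) (ψ j)
      = ∑ k ∈ K, a (⟪(φ k : Hilb M N), ψ j⟫_ℂ • φ k) (ψ j) := by
    intro j hj
    rw [← LinearMap.sum_apply, ← map_sum, ← h.expand h' hl j ((hJ j).1 hj) K hK]
  rw [Finset.sum_congr rfl e1, Finset.sum_comm]
  refine Finset.sum_congr rfl fun k hk => ?_
  have e2 : a (φ k) (φ k) = a (φ k) (∑ j ∈ J, ⟪(ψ j : Hilb M N), φ k⟫_ℂ • ψ j) :=
    congrArg _ (h'.expand h hl k ((hK k).1 hk) J hJ)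
  rw [e2, map_sum]
  refine Finset.sum_congr rfl fun j _ => ?_
  rw [map_smulₛₗ, LinearMap.smul_apply, map_smul, inner_conj_symm]

/-- The trace is given by every decomposition of `Γ`. -/
theorem IsDecomposition.hasSum_trace {M N : ℕ} {Γ : Hilb M N →L[ℂ] Hilb M N} {c : ℕ → ℝ}
    {ψ : ℕ → formDomain M N} (h : IsDecomposition Γ c ψ) {a : Form M N} (ha : a.IsBounded) :
    HasSum (fun j => (c j : ℂ) * a (ψ j) (ψ j)) (trace a Γ) := by
  have hex : ∃ p : (ℕ → ℝ) × (ℕ → formDomain M N), IsDecomposition Γ p.1 p.2 := ⟨(c, ψ), h⟩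
  have h' := hex.choose_spec
  set d := hex.choose.1
  set φ := hex.choose.2
  have key : ∑' j, (c j : ℂ) * a (ψ j) (ψ j) = trace a Γ := by
    rw [trace, dif_pos hex]
    change _ = ∑' j, (d j : ℂ) * a (φ j) (φ j)
    have u1 := ((Equiv.sigmaFiberEquiv c).summable_iff.2 (h.summable_form ha)).tsum_sigma
    have u2 := ((Equiv.sigmaFiberEquiv d).summable_iff.2 (h'.summable_form ha)).tsum_sigma
    rw [← (Equiv.sigmaFiberEquiv c).tsum_eq, ← (Equiv.sigmaFiberEquiv d).tsum_eq]
    refine u1.trans (Eq.trans ?_ u2.symm)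
    refine tsum_congr fun l => ?_
    rcases eq_or_ne l 0 with hl | hl
    · have e1 (x : {j // c j = l}) : c x = 0 := x.2.trans hl
      have e2 (x : {j // d j = l}) : d x = 0 := x.2.trans hl
      simp [Equiv.sigmaFiberEquiv, e1, e2]
    · have fc := h.finite_fiber hl
      have fd := h'.finite_fiber hl
      have s1 := h.sum_fiber h' a hl fc.toFinset fd.toFinset (by simp) (by simp)
      have t1 : ∑' x : {j // c j = l}, (c x : ℂ) * a (ψ x) (ψ x)
          = l * ∑ j ∈ fc.toFinset, a (ψ j) (ψ j) := by
        have : ∀ x : {j // c j = l}, (c x : ℂ) * a (ψ x) (ψ x) = l * a (ψ x) (ψ x) :=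
          fun x => by rw [x.2]
        rw [tsum_congr this, tsum_mul_left]
        congr 1
        have := Finset.tsum_subtype' fc.toFinset (fun j => a (ψ j) (ψ j))
        rw [← this, Set.Finite.coe_toFinset]
        rfl
      have t2 : ∑' x : {j // d j = l}, (d x : ℂ) * a (φ x) (φ x)
          = l * ∑ j ∈ fd.toFinset, a (φ j) (φ j) := by
        have : ∀ x : {j // d j = l}, (d x : ℂ) * a (φ x) (φ x) = l * a (φ x) (φ x) :=
          fun x => by rw [x.2]
        rw [tsum_congr this, tsum_mul_left]
        congr 1
        have := Finset.tsum_subtype' fd.toFinset (fun j => a (φ j) (φ j))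
        rw [← this, Set.Finite.coe_toFinset]
        rfl
      exact t1.trans ((congrArg _ s1).trans t2.symm)
  rw [← key]
  exact (h.summable_form ha).hasSum

/-! ### Boundedness of the forms -/

theorem gradPosSq_nonneg {M N : ℕ} (ψ : formDomain M N) : 0 ≤ gradPosSq ψ :=
  Finset.sum_nonneg fun _ _ => by positivity

theorem sq_le_gradPosSq {M N : ℕ} (m : Fin M) (ψ : formDomain M N) :
    ‖partialD M N m ψ‖ ^ 2 + ‖position M N m ψ‖ ^ 2 ≤ gradPosSq ψ :=
  Finset.single_le_sum (f := fun m => ‖partialD M N m ψ‖ ^ 2 + ‖position M N m ψ‖ ^ 2)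
    (fun _ _ => by positivity) (Finset.mem_univ m)

theorem isBounded_pairing {M N : ℕ} {A B : formDomain M N →ₗ[ℂ] Hilb M N} {C D : ℝ}
    (hA : ∀ ψ, ‖A ψ‖ ^ 2 ≤ C * (‖(ψ : Hilb M N)‖ ^ 2 + gradPosSq ψ))
    (hB : ∀ ψ, ‖B ψ‖ ^ 2 ≤ D * (‖(ψ : Hilb M N)‖ ^ 2 + gradPosSq ψ)) :
    (pairing A B).IsBounded := by
  refine ⟨C + D, fun ψ => ?_⟩
  have h1 : ‖pairing A B ψ ψ‖ ≤ ‖A ψ‖ * ‖B ψ‖ := norm_inner_le_norm (𝕜 := ℂ) (A ψ) (B ψ)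
  nlinarith [hA ψ, hB ψ, sq_nonneg (‖A ψ‖ - ‖B ψ‖), sq_nonneg ‖A ψ‖, sq_nonneg ‖B ψ‖]

theorem Form.IsBounded.add {M N : ℕ} {a b : Form M N} (ha : a.IsBounded) (hb : b.IsBounded) :
    Form.IsBounded (a + b) := by
  obtain ⟨C, hC⟩ := ha
  obtain ⟨D, hD⟩ := hb
  refine ⟨C + D, fun ψ => ?_⟩
  rw [add_mul]
  exact (norm_add_le _ _).trans (add_le_add (hC ψ) (hD ψ))

theorem Form.IsBounded.smul {M N : ℕ} {a : Form M N} (z : ℂ) (ha : a.IsBounded) :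
    Form.IsBounded (z • a) := by
  obtain ⟨C, hC⟩ := ha
  refine ⟨‖z‖ * C, fun ψ => ?_⟩
  rw [LinearMap.smul_apply, LinearMap.smul_apply, norm_smul, mul_assoc]
  exact mul_le_mul_of_nonneg_left (hC ψ) (norm_nonneg z)

theorem Form.IsBounded.sub {M N : ℕ} {a b : Form M N} (ha : a.IsBounded) (hb : b.IsBounded) :
    Form.IsBounded (a - b) := by
  have := ha.add (hb.smul (-1))
  rwa [show a + (-1 : ℂ) • b = a - b by module] at this

theorem isBounded_sum {M N : ℕ} {ι : Type*} (s : Finset ι) {a : ι → Form M N}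
    (ha : ∀ i ∈ s, (a i).IsBounded) : Form.IsBounded (∑ i ∈ s, a i) := by
  classical
  induction s using Finset.induction_on with
  | empty => exact ⟨0, fun ψ => by simp⟩
  | insert i s hi ih =>
    rw [Finset.sum_insert hi]
    exact (ha i (Finset.mem_insert_self i s)).add
      (ih fun k hk => ha k (Finset.mem_insert_of_mem hk))

theorem bound_subtype {M N : ℕ} (ψ : formDomain M N) :
    ‖(formDomain M N).subtype ψ‖ ^ 2 ≤ 1 * (‖(ψ : Hilb M N)‖ ^ 2 + gradPosSq ψ) := by
  have := gradPosSq_nonneg ψ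
  rw [Submodule.subtype_apply]
  linarith

theorem bound_partialD {M N : ℕ} (m : Fin M) (ψ : formDomain M N) :
    ‖partialD M N m ψ‖ ^ 2 ≤ 1 * (‖(ψ : Hilb M N)‖ ^ 2 + gradPosSq ψ) := by
  have := sq_le_gradPosSq m ψ
  nlinarith [sq_nonneg ‖position M N m ψ‖, sq_nonneg ‖(ψ : Hilb M N)‖]

theorem bound_position {M N : ℕ} (m : Fin M) (ψ : formDomain M N) :
    ‖position M N m ψ‖ ^ 2 ≤ 1 * (‖(ψ : Hilb M N)‖ ^ 2 + gradPosSq ψ) := by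
  have := sq_le_gradPosSq m ψ
  nlinarith [sq_nonneg ‖partialD M N m ψ‖, sq_nonneg ‖(ψ : Hilb M N)‖]

theorem bound_comp {M N : ℕ} (T : Hilb M N →L[ℂ] Hilb M N) {A : formDomain M N →ₗ[ℂ] Hilb M N}
    {C : ℝ} (hA : ∀ ψ, ‖A ψ‖ ^ 2 ≤ C * (‖(ψ : Hilb M N)‖ ^ 2 + gradPosSq ψ))
    (ψ : formDomain M N) :
    ‖(T.toLinearMap ∘ₗ A) ψ‖ ^ 2 ≤ (‖T‖ ^ 2 * C) * (‖(ψ : Hilb M N)‖ ^ 2 + gradPosSq ψ) := by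
  have h1 : ‖T (A ψ)‖ ^ 2 ≤ (‖T‖ * ‖A ψ‖) ^ 2 := by gcongr; exact T.le_opNorm _
  calc ‖(T.toLinearMap ∘ₗ A) ψ‖ ^ 2 = ‖T (A ψ)‖ ^ 2 := rfl
    _ ≤ ‖T‖ ^ 2 * ‖A ψ‖ ^ 2 := by rw [← mul_pow]; exact h1
    _ ≤ ‖T‖ ^ 2 * (C * (‖(ψ : Hilb M N)‖ ^ 2 + gradPosSq ψ)) := by gcongr; exact hA ψ
    _ = _ := by ring

theorem isBounded_kineticForm (M N : ℕ) : (kineticForm M N).IsBounded :=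
  isBounded_sum _ fun m _ => isBounded_pairing (bound_partialD m) (bound_partialD m)

theorem isBounded_squareForm (M N : ℕ) : (squareForm M N).IsBounded :=
  isBounded_sum _ fun m _ => isBounded_pairing (bound_position m) (bound_position m)

theorem isBounded_positionForm (M N : ℕ) (m : Fin M) : (positionForm M N m).IsBounded :=
  isBounded_pairing bound_subtype (bound_position m)

theorem isBounded_momentumForm (M N : ℕ) (m : Fin M) : (momentumForm M N m).IsBounded := by
  refine isBounded_pairing bound_subtype (D := 1) fun ψ => ?_
  rw [LinearMap.smul_apply, norm_smul, norm_neg, Complex.norm_I, one_mul]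
  exact bound_partialD m ψ

theorem isBounded_boundedForm {M N : ℕ} (B : Hilb M N →L[ℂ] Hilb M N) :
    (boundedForm B).IsBounded :=
  isBounded_pairing bound_subtype (bound_comp B bound_subtype)

theorem isBounded_couplingForm {M N : ℕ} (Λ : Matrix (Fin M) (Fin N) ℝ) :
    (couplingForm Λ).IsBounded :=
  isBounded_sum _ fun m _ => isBounded_sum _ fun n _ =>
    (isBounded_pairing bound_subtype (bound_comp (sigmaZ M n) (bound_position m))).smul _

theorem isBounded_hamiltonianForm {M N : ℕ} (Λ : Matrix (Fin M) (Fin N) ℝ) (t : Fin N → ℝ) :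
    (hamiltonianForm Λ t).IsBounded :=
  (((isBounded_kineticForm M N).add (isBounded_squareForm M N)).add
    (isBounded_couplingForm Λ)).sub
    (isBounded_sum _ fun n _ => (isBounded_boundedForm (sigmaX M n)).smul _)

/-! ### The Lieb functional -/

/-- The internal energy `Tr(H₀ Γ)` (a real number, since `H₀` is symmetric). -/
def energy {M N : ℕ} (Λ : Matrix (Fin M) (Fin N) ℝ) (t : Fin N → ℝ)
    (Γ : Hilb M N →L[ℂ] Hilb M N) : ℝ :=
  (trace (hamiltonianForm Λ t) Γ).re

/-- The density matrices `Γ ∈ 𝒟(Q₀)` with magnetization `σ_Γ = Tr(σ_z Γ) = σ` and displacement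
`ξ_Γ = Tr(x Γ) = ξ`. -/
def constraintSet {M N : ℕ} (σ : Fin N → ℝ) (ξ : Fin M → ℝ) : Set (Hilb M N →L[ℂ] Hilb M N) :=
  {Γ | Γ ∈ densityMatrices M N ∧ (∀ n, trace (boundedForm (sigmaZ M n)) Γ = σ n) ∧
    ∀ m, trace (positionForm M N m) Γ = ξ m}

/-- The Lieb functional `F_L(σ, ξ) = inf {Tr(H₀ Γ) : Γ ∈ 𝒟(Q₀), σ_Γ = σ, ξ_Γ = ξ}`, with value `+∞`
when there is no such `Γ` (in particular for `σ ∉ [-1,1]^N`). -/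
def liebFunctional {M N : ℕ} (Λ : Matrix (Fin M) (Fin N) ℝ) (t : Fin N → ℝ)
    (σ : Fin N → ℝ) (ξ : Fin M → ℝ) : EReal :=
  ⨅ Γ ∈ constraintSet σ ξ, (energy Λ t Γ : EReal)

/-- `Γ` is an optimizer of `F_L(σ, ξ)`: it is admissible and attains the infimum. -/
def IsOptimizer {M N : ℕ} (Λ : Matrix (Fin M) (Fin N) ℝ) (t : Fin N → ℝ)
    (σ : Fin N → ℝ) (ξ : Fin M → ℝ) (Γ : Hilb M N →L[ℂ] Hilb M N) : Prop :=
  Γ ∈ constraintSet σ ξ ∧ liebFunctional Λ t σ ξ = (energy Λ t Γ : EReal)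

/-- `K` is the (square-integrable, matrix-valued) integral kernel of `Γ`:
`(Γ φ)(x) = ∫ K(x, x') φ(x') dx'`. -/
def IsIntegralKernel {M N : ℕ} (Γ : Hilb M N →L[ℂ] Hilb M N)
    (K : Modes M → Modes M → Matrix (Spins N) (Spins N) ℂ) : Prop :=
  (∀ α β, MemLp (fun p : Modes M × Modes M => K p.1 p.2 α β) 2 volume) ∧
    ∀ φ : Hilb M N, ∀ᵐ x, ∀ α, Γ φ x α = ∫ x', ∑ β, K x x' α β * φ x' β

end MultiModeDicke
end

noncomputable section

namespace MultiModeDicke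

/-! ### Weak derivatives as generators of translations -/

section

/-! ### Test vectors -/

variable {M N : ℕ}

/-! Each part of the theorem compares a state with transformed states. Translations, dilations and
plane-wave phases act affinely on momenta and positions and commute with all spin matrices.
`IsCanonical` records this, and `IsCanonical.trace_hamiltonianForm` expresses the energy of `U Γ
U⁻¹` through traces of `Γ`.

Displacement rule: a translation maps the admissible states for `ξ` to those for `ξ + ζ` and changes
the energy by a constant depending only on `σ, ξ, ζ`. This gives one inequality for the infima; the
translation back gives the other (`liebFunctional_shift`).

Virial relation: dilations preserve `σ` and the value `ξ = 0` and turn kinetic, potential and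
coupling energies `T, V, C` into `s² T, s⁻² V, s⁻¹ C`. The minimum at `s = 1` forces `2T - 2V - C =
0` (`IsOptimizer.virial`).

Zero momentum: the phase `exp(i p x_m)` preserves all constraints and adds `2 p P + p²` to the
energy, where `P` is the momentum. This is nonnegative for all real `p` only if `P = 0`
(`IsOptimizer.trace_momentumForm`).

Existence is the direct method, made finite dimensional in the number of vectors. Only `N + M + 1`
real expectation values matter, so by Carathéodory's theorem every admissible state is approximated
by an unnormalized ensemble of `N + M + 2` vectors (`exists_ensemble_approx`). The coupling is
dominated by `-Δ + |x|²` (`exists_gradPosSq_le`), so a minimizing sequence of such ensembles is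
bounded in the form norm. Weak compactness and Rellich's theorem (`exists_formTendsto_subseq`) give
a limit that is strong in `L²`. Normalization and constraints are continuous along it and the energy
is lower semicontinuous, so the limit is a minimizer (`exists_finite_minimizer`). Diagonalizing its
Gram matrix makes it a genuine density matrix (`ensemble_mem_and_trace`). Replacing each vector by
its real and imaginary parts changes no expectation value, because all forms involved are real, and
yields a real kernel (`exists_real_optimizer`). Admissible states exist because a bump function
times a product spinor has the right magnetization and a translation adjusts its position. -/

theorem memLp_test {f : Modes M → ℂ} (hf : Continuous f) (hs : HasCompactSupport f)
    (α : Spins N) :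
    MemLp (fun x => conj (f x) • (EuclideanSpace.single α (1 : ℂ) : Spinor N)) 2 volume := by
  refine Continuous.memLp_of_hasCompactSupport (by fun_prop) ?_
  exact hs.mono fun x hx => by
    contrapose! hx
    simp only [Function.mem_support, not_not] at hx ⊢
    simp [hx]

/-- The vector `conj f ⊗ e_α`, against which the `α`-component of `∫ f ψ` is an inner product. -/
def testVec (f : Modes M → ℂ) (hf : Continuous f) (hs : HasCompactSupport f) (α : Spins N) :
    Hilb M N := (memLp_test hf hs α).toLp

theorem inner_testVec {f : Modes M → ℂ} (hf : Continuous f) (hs : HasCompactSupport f)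
    (α : Spins N) (ψ : Hilb M N) : ⟪testVec f hf hs α, ψ⟫_ℂ = (∫ x, f x • ψ x) α := by
  have h1 : (∫ x, f x • ψ x) α = ∫ x, (f x • ψ x) α :=
    ((EuclideanSpace.proj (𝕜 := ℂ) α).integral_comp_comm (integrable_test_smul hf hs ψ)).symm
  rw [h1, L2.inner_def]
  apply integral_congr_ae
  filter_upwards [(memLp_test hf hs α).coeFn_toLp] with x hx
  rw [testVec, hx, inner_smul_left, EuclideanSpace.inner_single_left]
  simp

theorem Hilb.ext_testVec {ψ φ : Hilb M N}
    (h : ∀ (f : Modes M → ℂ) (hf : ContDiff ℝ ∞ f) (hs : HasCompactSupport f) (α : Spins N),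
      ⟪testVec f hf.continuous hs α, ψ⟫_ℂ = ⟪testVec f hf.continuous hs α, φ⟫_ℂ) : ψ = φ := by
  apply Lp.ext
  apply ae_eq_of_integral_contDiff_smul_eq ((Lp.memLp ψ).locallyIntegrable (by norm_num))
    ((Lp.memLp φ).locallyIntegrable (by norm_num))
  intro f hf hs
  have hc : ContDiff ℝ ∞ (fun x => (f x : ℂ)) := Complex.ofRealCLM.contDiff.comp hf
  have hs' : HasCompactSupport (fun x => (f x : ℂ)) := hs.comp_left Complex.ofReal_zero
  have : ∫ x, (f x : ℂ) • ψ x = ∫ x, (f x : ℂ) • φ x := by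
    ext α
    rw [← inner_testVec hc.continuous hs', ← inner_testVec hc.continuous hs', h _ hc hs']
  simpa using this

/-- `g` is the weak derivative of `ψ` in the direction `v`. -/
def HasWeakDirDeriv (v : Modes M) (ψ g : Hilb M N) : Prop :=
  ∀ f : Modes M → ℂ, ContDiff ℝ ∞ f → HasCompactSupport f →
    ∫ x, fderiv ℝ f x v • ψ x = - ∫ x, f x • g x

theorem HasWeakPartial.hasWeakDirDeriv {m : Fin M} {ψ g : Hilb M N} (h : HasWeakPartial m ψ g) :
    HasWeakDirDeriv (EuclideanSpace.single m 1) ψ g := h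

theorem HasWeakDirDeriv.smul_dir {v : Modes M} {ψ g : Hilb M N} (h : HasWeakDirDeriv v ψ g)
    (r : ℝ) : HasWeakDirDeriv (r • v) ψ ((r : ℂ) • g) := by
  intro f hf hs
  have e1 : ∫ x, fderiv ℝ f x (r • v) • ψ x = (r : ℂ) • ∫ x, fderiv ℝ f x v • ψ x := by
    rw [← integral_smul]
    refine integral_congr_ae (.of_forall fun x => ?_)
    simp only [map_smul]
    rw [← smul_assoc]
    simp
  have e2 : ∫ x, f x • ((r : ℂ) • g : Hilb M N) x = (r : ℂ) • ∫ x, f x • g x := by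
    rw [← integral_smul]
    apply integral_congr_ae
    filter_upwards [Lp.coeFn_smul (r : ℂ) g] with x hx
    rw [hx, Pi.smul_apply, smul_comm]
  rw [e1, e2, h f hf hs, smul_neg]

/-- Weak convergence controls exactly inner products with fixed vectors, so in this form the
relation passes to weak limits. -/
theorem hasWeakPartial_iff_inner {m : Fin M} {ψ g : Hilb M N} :
    HasWeakPartial m ψ g ↔ ∀ (f : Modes M → ℂ) (hf : ContDiff ℝ ∞ f) (hs : HasCompactSupport f)
      (α : Spins N), ⟪testVec (fun x => fderiv ℝ f x (EuclideanSpace.single m 1))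
        (continuous_test_deriv hf _) (hs.fderiv_apply ℝ _) α, ψ⟫_ℂ
        = - ⟪testVec f hf.continuous hs α, g⟫_ℂ := by
  constructor
  · intro h f hf hs α
    rw [inner_testVec, inner_testVec, h f hf hs]
    simp
  · intro h f hf hs
    ext α
    have := h f hf hs α
    rw [inner_testVec, inner_testVec] at this
    simpa using this

theorem contDiff_coord (m : Fin M) : ContDiff ℝ ∞ fun x : Modes M => ((x m : ℝ) : ℂ) :=
  Complex.ofRealCLM.contDiff.comp (EuclideanSpace.proj (𝕜 := ℝ) m).contDiff

theorem hasPosition_iff_inner {m : Fin M} {ψ g : Hilb M N} :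
    HasPosition m ψ g ↔ ∀ (f : Modes M → ℂ) (hf : ContDiff ℝ ∞ f) (hs : HasCompactSupport f)
      (α : Spins N), ⟪testVec (fun x => f x * ((x m : ℝ) : ℂ))
        (hf.continuous.mul (contDiff_coord m).continuous) hs.mul_right α, ψ⟫_ℂ
        = ⟪testVec f hf.continuous hs α, g⟫_ℂ := by
  constructor
  · intro h f hf hs α
    rw [inner_testVec, inner_testVec]
    refine congrArg (fun v : Spinor N => v α) (integral_congr_ae ?_)
    filter_upwards [h] with x hx
    rw [hx, smul_smul]
  · intro h
    -- It is not yet known that `x_m ψ` lies in `L²`; local integrability suffices for the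
    -- fundamental lemma of the calculus of variations.
    have hl : LocallyIntegrable (fun x => ((x m : ℝ) : ℂ) • ψ x) volume := by
      have h0 : LocallyIntegrable ψ volume := (Lp.memLp ψ).locallyIntegrable (by norm_num)
      exact (locallyIntegrableOn_univ.1 <|
        (h0.locallyIntegrableOn Set.univ).continuousOn_smul isOpen_univ.isLocallyClosed
          (contDiff_coord m).continuous.continuousOn)
    refine ae_eq_of_integral_contDiff_smul_eq
      ((Lp.memLp g).locallyIntegrable (by norm_num)) hl ?_
    intro f hf hs
    have hc : ContDiff ℝ ∞ (fun x => (f x : ℂ)) := Complex.ofRealCLM.contDiff.comp hf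
    have hs' : HasCompactSupport (fun x => (f x : ℂ)) := hs.comp_left Complex.ofReal_zero
    have : ∫ x, (f x : ℂ) • g x = ∫ x, ((f x : ℂ) * ((x m : ℝ) : ℂ)) • ψ x := by
      ext α
      rw [← inner_testVec hc.continuous hs', ← h _ hc hs', inner_testVec]
    simpa [mul_smul] using this

/-! ### Translations -/

theorem measurePreserving_shift (v : Modes M) :
    MeasurePreserving (fun x : Modes M => x + v) volume volume :=
  measurePreserving_add_right volume v

/-- The translation `(shift v ψ)(x) = ψ(x + v)`. -/
def shift (v : Modes M) : Hilb M N →ₗᵢ[ℂ] Hilb M N :=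
  Lp.compMeasurePreservingₗᵢ ℂ (fun x => x + v) (measurePreserving_shift v)

theorem coeFn_shift (v : Modes M) (ψ : Hilb M N) : shift v ψ =ᵐ[volume] fun x => ψ (x + v) :=
  Lp.coeFn_compMeasurePreserving ψ (measurePreserving_shift v)

theorem shift_add (v w : Modes M) (ψ : Hilb M N) : shift v (shift w ψ) = shift (v + w) ψ := by
  apply Lp.ext
  filter_upwards [coeFn_shift v (shift w ψ), coeFn_shift (v + w) ψ,
    (measurePreserving_shift v).quasiMeasurePreserving.ae (coeFn_shift w ψ)] with x h1 h2 h3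
  rw [h1, h2, h3, add_assoc]

theorem shift_zero (ψ : Hilb M N) : shift 0 ψ = ψ := by
  apply Lp.ext
  filter_upwards [coeFn_shift 0 ψ] with x h1
  rw [h1, add_zero]

/-- Strong continuity of the translation group. Composition with measure preserving maps is jointly
continuous for the compact-open topology, in which `v ↦ (x ↦ x + v)` is continuous. -/
theorem continuous_shift (ψ : Hilb M N) : Continuous fun v : Modes M => shift v ψ := by
  let F : Modes M → Hilb M N × {f : C(Modes M, Modes M) // MeasurePreserving f volume volume} :=
    fun v => (ψ, ⟨⟨fun x => x + v, by fun_prop⟩, measurePreserving_shift v⟩)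
  have hF : Continuous F := by
    refine continuous_const.prodMk (Continuous.subtype_mk ?_ _)
    exact ContinuousMap.continuous_of_continuous_uncurry _ (by
      change Continuous fun p : Modes M × Modes M => p.2 + p.1
      fun_prop)
  exact (Lp.compMeasurePreserving_continuous volume volume (Spinor N) (p := 2)
    (by norm_num)).comp hF

theorem integral_smul_shift (f : Modes M → ℂ) (v : Modes M) (ψ : Hilb M N) :
    ∫ x, f x • shift v ψ x = ∫ x, f (x - v) • ψ x := by
  have h1 : ∫ x, f x • shift v ψ x = ∫ x, f (x + v - v) • ψ (x + v) := by
    apply integral_congr_ae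
    filter_upwards [coeFn_shift v ψ] with x hx
    rw [hx, add_sub_cancel_right]
  rw [h1]
  exact integral_add_right_eq_self (fun x => f (x - v) • ψ x) v

theorem inner_testVec_shift {f : Modes M → ℂ} (hf : Continuous f) (hs : HasCompactSupport f)
    (α : Spins N) (v : Modes M) (ψ : Hilb M N) :
    ⟪testVec f hf hs α, shift v ψ⟫_ℂ = (∫ x, f (x - v) • ψ x) α := by
  rw [inner_testVec, integral_smul_shift]

theorem hasCompactSupport_shift {f : Modes M → ℂ} (hs : HasCompactSupport f) (v : Modes M) :
    HasCompactSupport fun x => f (x - v) :=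
  hs.comp_homeomorph (Homeomorph.subRight v)

/-- As a function of the displacement, the pairing is a component of the convolution of `ψ` with the
reflected test function `F`, hence differentiable. The derivative falls on `F`, and the definition
of the weak derivative, tested with the translate of `f`, moves it to `ψ`. -/
theorem hasDerivAt_inner_shift {v : Modes M} {ψ g : Hilb M N} (h : HasWeakDirDeriv v ψ g)
    {f : Modes M → ℂ} (hf : ContDiff ℝ ∞ f) (hs : HasCompactSupport f) (α : Spins N) (s : ℝ) :
    HasDerivAt (fun s : ℝ => ⟪testVec f hf.continuous hs α, shift (s • v) ψ⟫_ℂ)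
      ⟪testVec f hf.continuous hs α, shift (s • v) g⟫_ℂ s := by
  set F : Modes M → ℂ := fun z => f (-z) with hF
  have hFc : ContDiff ℝ ∞ F := hf.comp contDiff_neg
  have hFs : HasCompactSupport F := hs.comp_homeomorph (Homeomorph.neg _)
  let L : Spinor N →L[ℝ] ℂ →L[ℝ] Spinor N := (ContinuousLinearMap.lsmul ℝ ℂ).flip
  have h1 := hFs.hasFDerivAt_convolution_right L (μ := volume)
    ((Lp.memLp ψ).locallyIntegrable (by norm_num)) (hFc.of_le (by simp)) (s • v)
  have h2 : HasDerivAt (fun s : ℝ => s • v) v s := by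
    simpa using (hasDerivAt_id s).smul_const v
  have h3 := h1.comp_hasDerivAt s h2
  have h4 := ((EuclideanSpace.proj (𝕜 := ℂ) α).restrictScalars ℝ).hasFDerivAt.comp_hasDerivAt s h3
  have conv (w : Modes M) : (convolution ψ F L volume) w = ∫ x, f (x - w) • ψ x := by
    rw [convolution]
    refine integral_congr_ae (.of_forall fun x => ?_)
    simp [L, hF]
  have e1 : (fun s : ℝ => ⟪testVec f hf.continuous hs α, shift (s • v) ψ⟫_ℂ)
      = fun s : ℝ => (convolution ψ F L volume) (s • v) α := by
    funext s
    rw [inner_testVec_shift, conv]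
  rw [e1]
  refine h4.congr_deriv ?_
  rw [inner_testVec_shift]
  have hsh : ContDiff ℝ ∞ fun x => f (x - s • v) := hf.comp (contDiff_id.sub contDiff_const)
  have h5 := h _ hsh (hasCompactSupport_shift hs (s • v))
  rw [← neg_eq_iff_eq_neg] at h5
  rw [← h5]
  change (convolution ψ (fderiv ℝ F) (ContinuousLinearMap.precompR (Modes M) L) volume
    (s • v) v) α = _
  refine congrArg (fun w : Spinor N => w α) ?_
  have hce : ConvolutionExistsAt ψ (fderiv ℝ F) (s • v)
      (ContinuousLinearMap.precompR (Modes M) L) volume :=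
    (hFs.fderiv ℝ).convolutionExists_right _ ((Lp.memLp ψ).locallyIntegrable (by norm_num))
      (hFc.continuous_fderiv (by simp)) _
  rw [convolution, ContinuousLinearMap.integral_apply hce, ← integral_neg]
  refine integral_congr_ae (.of_forall fun x => ?_)
  have e2 : fderiv ℝ F (s • v - x) v = - fderiv ℝ f (x - s • v) v := by
    have hd : HasFDerivAt f (fderiv ℝ f (x - s • v)) (-(s • v - x)) := by
      rw [neg_sub]
      exact (hf.differentiable (by simp) _).hasFDerivAt
    have hd' : HasFDerivAt F ((fderiv ℝ f (x - s • v)).comp (-ContinuousLinearMap.id ℝ (Modes M)))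
        (s • v - x) := hd.comp (s • v - x) (hasFDerivAt_id (𝕜 := ℝ) (s • v - x)).neg
    rw [hd'.fderiv]
    simp
  have e3 : fderiv ℝ (fun x => f (x - s • v)) x = fderiv ℝ f (x - s • v) :=
    fderiv_comp_sub _
  change fderiv ℝ F (s • v - x) v • ψ x = -(fderiv ℝ (fun x => f (x - s • v)) x v • ψ x)
  rw [e2, e3, neg_smul]

/-- The fundamental theorem of calculus holds after pairing with each test vector; since `s ↦ shift
(s • v) g` is norm continuous, the scalar identities assemble into one Bochner integral. -/
theorem shift_sub_eq_integral {v : Modes M} {ψ g : Hilb M N} (h : HasWeakDirDeriv v ψ g) :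
    shift v ψ - ψ = ∫ s in (0 : ℝ)..1, shift (s • v) g := by
  have hc : Continuous fun s : ℝ => shift (s • v) g := (continuous_shift g).comp (by fun_prop)
  apply Hilb.ext_testVec
  intro f hf hs α
  have h1 := intervalIntegral.integral_eq_sub_of_hasDerivAt (a := (0 : ℝ)) (b := 1)
    (fun s _ => hasDerivAt_inner_shift h hf hs α s)
    ((continuous_const.inner hc).intervalIntegrable 0 1)
  have h2 := (innerSL ℂ (testVec f hf.continuous hs α)).intervalIntegral_comp_comm
    (hc.intervalIntegrable (μ := volume) 0 1)
  simp only [innerSL_apply_apply] at h2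
  rw [← h2, h1, one_smul, zero_smul, shift_zero, inner_sub_right]

theorem norm_shift_sub_le {v : Modes M} {ψ g : Hilb M N} (h : HasWeakDirDeriv v ψ g) :
    ‖shift v ψ - ψ‖ ≤ ‖g‖ := by
  rw [shift_sub_eq_integral h]
  have := intervalIntegral.norm_integral_le_of_norm_le_const (a := (0 : ℝ)) (b := 1) (C := ‖g‖)
    (f := fun s => shift (s • v) g) fun s _ => (LinearIsometry.norm_map _ _).le
  simpa using this

theorem hasDerivAt_shift {v : Modes M} {ψ g : Hilb M N} (h : HasWeakDirDeriv v ψ g) :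
    HasDerivAt (fun r : ℝ => shift (r • v) ψ) g 0 := by
  have hc : Continuous fun r : ℝ => shift (r • v) g := (continuous_shift g).comp (by fun_prop)
  -- Applying the integral formula in the direction `r • v`, whose weak derivative is `r • g`, and
  -- substituting turns the unit interval into `[0, r]`.
  have e : (fun r : ℝ => shift (r • v) ψ) = fun r => ψ + ∫ s in (0 : ℝ)..r, shift (s • v) g := by
    funext r
    rw [← sub_eq_iff_eq_add', shift_sub_eq_integral (h.smul_dir r)]
    rcases eq_or_ne r 0 with rfl | hr
    · simp
    · have := intervalIntegral.smul_integral_comp_mul_right (a := 0) (b := 1)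
        (fun s => shift (s • v) g) r
      simp only [zero_mul, one_mul] at this
      rw [← this, ← intervalIntegral.integral_smul]
      congr 1
      funext s
      rw [map_smul, smul_smul]
      rfl
  rw [e]
  have := (intervalIntegral.integral_hasDerivAt_right (hc.intervalIntegrable (μ := volume) 0 0)
    (hc.stronglyMeasurableAtFilter _ _) hc.continuousAt).const_add ψ
  simpa [shift_zero] using this

/-- Integration by parts: a weak derivative is anti-symmetric. -/
theorem HasWeakDirDeriv.re_inner {v : Modes M} {ψ g : Hilb M N} (h : HasWeakDirDeriv v ψ g) :
    (⟪ψ, g⟫_ℂ).re = 0 := by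
  have h1 := (hasDerivAt_shift h).inner ℂ (hasDerivAt_shift h)
  -- Translations are isometric, so the squared norm is constant along the orbit, while its
  -- derivative at `0` is `2 Re ⟪ψ, g⟫`. No decay at infinity has to be discussed.
  have h2 : (fun r : ℝ => ⟪shift (r • v) ψ, shift (r • v) ψ⟫_ℂ) = fun _ => ⟪ψ, ψ⟫_ℂ := by
    funext r
    rw [LinearIsometry.inner_map_map]
  rw [h2] at h1
  have h3 := h1.unique (hasDerivAt_const 0 _)
  simp only [zero_smul, shift_zero] at h3
  have h4 := congrArg Complex.re h3
  rw [← inner_conj_symm g ψ] at h4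
  simp only [Complex.add_re, Complex.conj_re, Complex.zero_re] at h4
  linarith

end

/-! ### Compactness of the form domain in L² -/

section

open Filter Topology Metric

variable {M N : ℕ}

/-! ### Rellich's theorem on the form domain -/

theorem enorm_sq_eq_lintegral (ψ : Hilb M N) : ‖ψ‖ₑ ^ 2 = ∫⁻ x, ‖ψ x‖ₑ ^ 2 := by
  have := eLpNorm_nnreal_pow_eq_lintegral (f := ψ) (μ := (volume : Measure (Modes M)))
    (p := 2) (by norm_num)
  rw [Lp.enorm_def]
  simpa using this

/-- Moving along one coordinate axis at a time uses only the partial derivatives; earlier moves are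
undisturbed because translations are isometric. -/
theorem norm_shift_sum_sub_le {ψ : Hilb M N} {g : Fin M → Hilb M N}
    (h : ∀ m, HasWeakPartial m ψ (g m)) (y : Modes M) (s : Finset (Fin M)) :
    ‖shift (∑ m ∈ s, y m • EuclideanSpace.single m (1 : ℝ)) ψ - ψ‖ ≤ ∑ m ∈ s, |y m| * ‖g m‖ := by
  classical
  induction s using Finset.induction_on with
  | empty => simp [shift_zero]
  | insert m s hm ih =>
    rw [Finset.sum_insert hm, Finset.sum_insert hm, ← shift_add]
    set w : Modes M := ∑ m ∈ s, y m • EuclideanSpace.single m (1 : ℝ)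
    set v : Modes M := y m • EuclideanSpace.single m (1 : ℝ) with hv
    have e : shift v (shift w ψ) - ψ = (shift v ψ - ψ) + shift v (shift w ψ - ψ) := by
      rw [map_sub]; abel
    rw [e]
    refine (norm_add_le _ _).trans (add_le_add ?_ ?_)
    · have := norm_shift_sub_le ((h m).hasWeakDirDeriv.smul_dir (y m))
      rwa [norm_smul, Complex.norm_real, Real.norm_eq_abs] at this
    · rwa [LinearIsometry.norm_map]

theorem norm_shift_sub_le_sum {ψ : Hilb M N} {g : Fin M → Hilb M N}
    (h : ∀ m, HasWeakPartial m ψ (g m)) (y : Modes M) :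
    ‖shift y ψ - ψ‖ ≤ ‖y‖ * ∑ m, ‖g m‖ := by
  have e : ∑ m, y m • EuclideanSpace.single m (1 : ℝ) = y := by
    simpa using (EuclideanSpace.basisFun (Fin M) ℝ).sum_repr y
  have := norm_shift_sum_sub_le h y Finset.univ
  rw [e] at this
  refine this.trans ?_
  rw [Finset.mul_sum]
  gcongr with m
  exact PiLp.norm_apply_le y m

/-- Chebyshev's inequality: `∑ |x_m ψ|² = |x|² |ψ|²`, and `|x| ≥ R` off the ball. This prevents mass
from escaping to infinity. -/
theorem lintegral_tail_le {ψ : Hilb M N} {g : Fin M → Hilb M N}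
    (h : ∀ m, HasPosition m ψ (g m)) {R : ℝ} (hR : 0 ≤ R) :
    ENNReal.ofReal (R ^ 2) * ∫⁻ x in (ball (0 : Modes M) R)ᶜ, ‖ψ x‖ₑ ^ 2 ≤ ∑ m, ‖g m‖ₑ ^ 2 := by
  have hm : Measurable fun x => ‖ψ x‖ₑ ^ 2 := (Lp.stronglyMeasurable ψ).measurable.enorm.pow_const 2
  have hg (m : Fin M) : Measurable fun x => ‖g m x‖ₑ ^ 2 :=
    (Lp.stronglyMeasurable (g m)).measurable.enorm.pow_const 2
  rw [← lintegral_const_mul _ hm]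
  calc ∫⁻ x in (ball (0 : Modes M) R)ᶜ, ENNReal.ofReal (R ^ 2) * ‖ψ x‖ₑ ^ 2
      ≤ ∫⁻ x in (ball (0 : Modes M) R)ᶜ, ∑ m, ‖g m x‖ₑ ^ 2 := by
        refine lintegral_mono_ae ?_
        filter_upwards [ae_restrict_of_ae (ae_all_iff.2 h),
          ae_restrict_mem measurableSet_ball.compl] with x hx hxR
        have e : ∑ m, ‖g m x‖ₑ ^ 2 = ENNReal.ofReal (‖x‖ ^ 2) * ‖ψ x‖ₑ ^ 2 := by
          rw [EuclideanSpace.norm_sq_eq, ENNReal.ofReal_sum_of_nonneg (fun _ _ => by positivity),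
            Finset.sum_mul]
          refine Finset.sum_congr rfl fun m _ => ?_
          rw [hx m, enorm_smul, mul_pow, ENNReal.ofReal_pow (norm_nonneg _), ofReal_norm,
            ← ofReal_norm, Complex.norm_real, ofReal_norm]
        rw [e]
        gcongr
        simpa using hxR
    _ ≤ ∫⁻ x, ∑ m, ‖g m x‖ₑ ^ 2 := setLIntegral_le_lintegral _ _
    _ = ∑ m, ‖g m‖ₑ ^ 2 := by
        rw [lintegral_finsetSum _ fun m _ => hg m]
        simp_rw [enorm_sq_eq_lintegral]

/-- Jensen's inequality, from monotonicity of `L^p` norms on a probability space. -/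
theorem enorm_integral_sq_le {X E : Type*} [MeasurableSpace X] [NormedAddCommGroup E]
    [NormedSpace ℝ E] {μ : Measure X} [IsProbabilityMeasure μ] {f : X → E}
    (hf : AEStronglyMeasurable f μ) : ‖∫ y, f y ∂μ‖ₑ ^ 2 ≤ ∫⁻ y, ‖f y‖ₑ ^ 2 ∂μ := by
  have h1 := eLpNorm_le_eLpNorm_of_exponent_le (p := 1) (q := 2) (by norm_num) hf
  rw [eLpNorm_one_eq_lintegral_enorm] at h1
  have h2 := eLpNorm_nnreal_pow_eq_lintegral (f := f) (μ := μ) (p := 2) (by norm_num)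
  have h3 : eLpNorm f 2 μ ^ 2 = ∫⁻ y, ‖f y‖ₑ ^ 2 ∂μ := by simpa using h2
  rw [← h3]
  gcongr
  exact (enorm_integral_le_lintegral_enorm f).trans h1

/-- The uniform probability measure on the ball of radius `ε` about the origin. -/
def ballMeasure (M : ℕ) (ε : ℝ) : Measure (Modes M) :=
  (volume (ball (0 : Modes M) ε))⁻¹ • volume.restrict (ball (0 : Modes M) ε)

theorem isProbabilityMeasure_ballMeasure {ε : ℝ} (hε : 0 < ε) :
    IsProbabilityMeasure (ballMeasure M ε) :=
  ⟨by
    rw [ballMeasure, Measure.smul_apply, Measure.restrict_apply_univ, smul_eq_mul,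
      ENNReal.inv_mul_cancel (measure_ball_pos _ _ hε).ne' measure_ball_lt_top.ne]⟩

/-- The average of `ψ` over the ball of radius `ε` about `x`. -/
def ballAverage (ε : ℝ) (ψ : Hilb M N) (x : Modes M) : Spinor N :=
  ∫ y, ψ (x + y) ∂ballMeasure M ε

theorem stronglyMeasurable_add (ψ : Hilb M N) :
    StronglyMeasurable fun p : Modes M × Modes M => ψ (p.1 + p.2) :=
  (Lp.stronglyMeasurable ψ).comp_measurable (measurable_fst.add measurable_snd)

theorem stronglyMeasurable_add_left (ψ : Hilb M N) (x : Modes M) :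
    StronglyMeasurable fun y : Modes M => ψ (x + y) :=
  (Lp.stronglyMeasurable ψ).comp_measurable (measurable_const.add measurable_id)

theorem stronglyMeasurable_ballAverage {ε : ℝ} (hε : 0 < ε) (ψ : Hilb M N) :
    StronglyMeasurable (ballAverage ε ψ) := by
  have := isProbabilityMeasure_ballMeasure (M := M) hε
  exact (stronglyMeasurable_add ψ).integral_prod_right

theorem integral_ball_eq (ε : ℝ) (ψ : Hilb M N) (x : Modes M) :
    ∫ y in ball (0 : Modes M) ε, ψ (x + y) = ∫ y in ball x ε, ψ y := by
  have h := (measurePreserving_add_left (volume : Measure (Modes M)) x).setIntegral_preimage_emb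
    (Homeomorph.addLeft x).measurableEmbedding (fun y => ψ y) (ball x ε)
  rw [← h]
  congr 2
  ext y
  simp

theorem integrable_ballMeasure {ε : ℝ} (hε : 0 < ε) (ψ : Hilb M N) (x : Modes M) :
    Integrable (fun y => ψ (x + y)) (ballMeasure M ε) := by
  refine Integrable.smul_measure ?_ (ENNReal.inv_ne_top.2 (measure_ball_pos _ _ hε).ne')
  have h0 : MemLp (fun y => ψ (x + y)) 2 volume :=
    (Lp.memLp ψ).comp_measurePreserving (measurePreserving_add_left _ x)
  exact (h0.locallyIntegrable (by norm_num)).integrableOn_isCompact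
    (isCompact_closedBall 0 ε) |>.mono_set ball_subset_closedBall

/-- The bound is uniform in `x` and depends on `ψ` only through its norm, so it can serve as the
dominating constant on bounded balls. -/
theorem enorm_ballAverage_sq_le {ε : ℝ} (hε : 0 < ε) (ψ : Hilb M N) (x : Modes M) :
    ‖ballAverage ε ψ x‖ₑ ^ 2 ≤ (volume (ball (0 : Modes M) ε))⁻¹ * ‖ψ‖ₑ ^ 2 := by
  have := isProbabilityMeasure_ballMeasure (M := M) hε
  refine (enorm_integral_sq_le (stronglyMeasurable_add_left ψ x).aestronglyMeasurable).trans ?_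
  rw [ballMeasure, lintegral_smul_measure, smul_eq_mul, enorm_sq_eq_lintegral]
  refine mul_le_mul' le_rfl ?_
  exact (setLIntegral_le_lintegral _ _).trans_eq
    (lintegral_add_left_eq_self (μ := volume) (fun y => ‖ψ y‖ₑ ^ 2) x)

/-- By Jensen and Tonelli the squared distance of `ψ` to its average is at most the average of
`‖shift y ψ - ψ‖²` over small `y`. -/
theorem lintegral_sub_ballAverage_le {ε : ℝ} (hε : 0 < ε) (ψ : Hilb M N) {δ : ℝ≥0∞}
    (hδ : ∀ y ∈ ball (0 : Modes M) ε, ‖shift y ψ - ψ‖ₑ ≤ δ) :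
    ∫⁻ x, ‖ψ x - ballAverage ε ψ x‖ₑ ^ 2 ≤ δ ^ 2 := by
  have hprob := isProbabilityMeasure_ballMeasure (M := M) hε
  have hmeas : Measurable fun p : Modes M × Modes M => ‖ψ p.1 - ψ (p.1 + p.2)‖ₑ ^ 2 :=
    (((Lp.stronglyMeasurable ψ).comp_measurable measurable_fst).sub
      (stronglyMeasurable_add ψ)).measurable.enorm.pow_const 2
  calc ∫⁻ x, ‖ψ x - ballAverage ε ψ x‖ₑ ^ 2
      ≤ ∫⁻ x, ∫⁻ y, ‖ψ x - ψ (x + y)‖ₑ ^ 2 ∂ballMeasure M ε := by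
        refine lintegral_mono fun x => ?_
        have e : ψ x - ballAverage ε ψ x = ∫ y, (ψ x - ψ (x + y)) ∂ballMeasure M ε := by
          rw [integral_sub (integrable_const _) (integrable_ballMeasure hε ψ x)]
          simp [ballAverage]
        rw [e]
        exact enorm_integral_sq_le
          (stronglyMeasurable_const.sub (stronglyMeasurable_add_left ψ x)).aestronglyMeasurable
    _ = ∫⁻ y, ∫⁻ x, ‖ψ x - ψ (x + y)‖ₑ ^ 2 ∂volume ∂ballMeasure M ε :=
        lintegral_lintegral_swap hmeas.aemeasurable
    _ ≤ ∫⁻ _, δ ^ 2 ∂ballMeasure M ε := by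
        refine lintegral_mono_ae ?_
        have hmem : ∀ᵐ y ∂ballMeasure M ε, y ∈ ball (0 : Modes M) ε :=
          Measure.ae_smul_measure (ae_restrict_mem measurableSet_ball) _
        filter_upwards [hmem] with y hy
        have e : ∫⁻ x, ‖ψ x - ψ (x + y)‖ₑ ^ 2 = ‖shift y ψ - ψ‖ₑ ^ 2 := by
          rw [enorm_sq_eq_lintegral]
          apply lintegral_congr_ae
          filter_upwards [Lp.coeFn_sub (shift y ψ) ψ, coeFn_shift y ψ] with x h1 h2
          rw [h1, Pi.sub_apply, h2, ← enorm_neg, neg_sub]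
        rw [e]
        gcongr
        exact hδ y hy
    _ = δ ^ 2 := by simp

/-- Weak convergence of a sequence in a Hilbert space. -/
def WeakTendsto {E : Type*} [NormedAddCommGroup E] [InnerProductSpace ℂ E] (u : ℕ → E) (a : E) :
    Prop :=
  ∀ φ : E, Tendsto (fun n => ⟪φ, u n⟫_ℂ) atTop (𝓝 ⟪φ, a⟫_ℂ)

/-- At a fixed point each component of the average is a multiple of the inner product with the
indicator of a ball times a basis spinor, so weak convergence gives pointwise convergence. -/
theorem tendsto_ballAverage {ε : ℝ} {d : ℕ → Hilb M N} (hd : WeakTendsto d 0)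
    (x : Modes M) : Tendsto (fun n => ballAverage ε (d n) x) atTop (𝓝 0) := by
  have key : Tendsto (fun n => ∫ y in ball x ε, d n y) atTop (𝓝 0) := by
    have h1 : Tendsto (fun n => WithLp.ofLp (∫ y in ball x ε, d n y)) atTop (𝓝 0) := by
      rw [tendsto_pi_nhds]
      intro α
      have := hd (indicatorConstLp 2 (measurableSet_ball (x := x) (ε := ε))
        measure_ball_lt_top.ne (EuclideanSpace.single α 1))
      simpa [L2.inner_indicatorConstLp_eq_inner_setIntegral, EuclideanSpace.inner_single_left]
        using this
    have h2 := ((PiLp.continuous_toLp 2 fun _ : Spins N => ℂ).tendsto 0).comp h1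
    simpa [Function.comp_def] using h2
  have e (n : ℕ) : ballAverage ε (d n) x
      = (volume (ball (0 : Modes M) ε))⁻¹.toReal • ∫ y in ball x ε, d n y := by
    rw [ballAverage, ballMeasure, integral_smul_measure, integral_ball_eq]
  simp_rw [e]
  simpa using key.const_smul (volume (ball (0 : Modes M) ε))⁻¹.toReal

theorem tendsto_lintegral_ballAverage {ε R C : ℝ} (hε : 0 < ε) {d : ℕ → Hilb M N}
    (hd : WeakTendsto d 0) (hC : ∀ n, ‖d n‖ ≤ C) :
    Tendsto (fun n => ∫⁻ x in ball (0 : Modes M) R, ‖ballAverage ε (d n) x‖ₑ ^ 2) atTop (𝓝 0) := by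
  have h := tendsto_lintegral_of_dominated_convergence
    (μ := volume.restrict (ball (0 : Modes M) R))
    (F := fun n x => ‖ballAverage ε (d n) x‖ₑ ^ 2) (f := fun _ => 0)
    (fun _ => (volume (ball (0 : Modes M) ε))⁻¹ * ENNReal.ofReal C ^ 2)
    (fun n => (stronglyMeasurable_ballAverage hε (d n)).measurable.enorm.pow_const 2)
    (fun n => .of_forall fun x => (enorm_ballAverage_sq_le hε (d n) x).trans (by
      refine mul_le_mul' le_rfl (pow_le_pow_left' ?_ 2)
      rw [← ofReal_norm]
      exact ENNReal.ofReal_le_ofReal (hC n)))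
    (by
      rw [lintegral_const, Measure.restrict_apply_univ]
      exact ENNReal.mul_ne_top (ENNReal.mul_ne_top
        (ENNReal.inv_ne_top.2 (measure_ball_pos _ _ hε).ne') (by simp)) measure_ball_lt_top.ne)
    (.of_forall fun x => by
      have h0 := ENNReal.Tendsto.pow (n := 2) (tendsto_ballAverage (ε := ε) hd x).enorm
      simpa using h0)
  simpa using h

/-- On the ball, `|ψ|² ≤ 2 |average|² + 2 |ψ - average|²`, and the gradient bound controls the
second term; outside, the position bound controls the tail. Only the averaged term still depends on
more than the bound `C`. -/
theorem enorm_sq_le_of_ballAverage {ε R : ℝ} (hε : 0 < ε) (hR : 0 < R) {ψ : Hilb M N}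
    {g k : Fin M → Hilb M N} {C : ℝ} (hg : ∀ m, HasWeakPartial m ψ (g m))
    (hk : ∀ m, HasPosition m ψ (k m)) (hgC : ∀ m, ‖g m‖ ≤ C) (hkC : ∀ m, ‖k m‖ ≤ C) :
    ‖ψ‖ₑ ^ 2 ≤ 2 * (∫⁻ x in ball (0 : Modes M) R, ‖ballAverage ε ψ x‖ₑ ^ 2)
      + ENNReal.ofReal (2 * (ε * (M * C)) ^ 2 + M * C ^ 2 / R ^ 2) := by
  have h1 : ∫⁻ x, ‖ψ x - ballAverage ε ψ x‖ₑ ^ 2 ≤ ENNReal.ofReal (ε * (M * C)) ^ 2 := by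
    refine lintegral_sub_ballAverage_le hε ψ fun y hy => ?_
    rw [← ofReal_norm]
    refine ENNReal.ofReal_le_ofReal ((norm_shift_sub_le_sum hg y).trans ?_)
    have h2 : ∑ m, ‖g m‖ ≤ M * C := by
      simpa using Finset.sum_le_sum fun m (_ : m ∈ Finset.univ) => hgC m
    have h3 : ‖y‖ ≤ ε := by simpa using (mem_ball_zero_iff.1 hy).le
    exact mul_le_mul h3 h2 (Finset.sum_nonneg fun _ _ => norm_nonneg _) hε.le
  have h2 : ∫⁻ x in (ball (0 : Modes M) R)ᶜ, ‖ψ x‖ₑ ^ 2 ≤ ENNReal.ofReal (M * C ^ 2 / R ^ 2) := by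
    have h3 := lintegral_tail_le hk hR.le
    have h4 : ∑ m, ‖k m‖ₑ ^ 2 ≤ ENNReal.ofReal (M * C ^ 2) := by
      have : ∀ m ∈ Finset.univ, ‖k m‖ₑ ^ 2 ≤ ENNReal.ofReal (C ^ 2) := fun m _ => by
        rw [← ofReal_norm, ← ENNReal.ofReal_pow (norm_nonneg _)]
        have := hkC m
        gcongr
      refine (Finset.sum_le_sum this).trans_eq ?_
      rw [Finset.sum_const, Finset.card_univ, Fintype.card_fin, nsmul_eq_mul,
        ENNReal.ofReal_mul (by positivity), ENNReal.ofReal_natCast]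
    rw [ENNReal.ofReal_div_of_pos (by positivity), ENNReal.le_div_iff_mul_le (by simp [hR.ne'])
      (by simp), mul_comm]
    exact h3.trans h4
  have hm : Measurable fun x => ‖ballAverage ε ψ x‖ₑ ^ 2 :=
    (stronglyMeasurable_ballAverage hε ψ).measurable.enorm.pow_const 2
  have h5 : ∫⁻ x in ball (0 : Modes M) R, ‖ψ x‖ₑ ^ 2
      ≤ 2 * (∫⁻ x in ball (0 : Modes M) R, ‖ballAverage ε ψ x‖ₑ ^ 2)
        + 2 * ∫⁻ x, ‖ψ x - ballAverage ε ψ x‖ₑ ^ 2 := by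
    calc ∫⁻ x in ball (0 : Modes M) R, ‖ψ x‖ₑ ^ 2
        ≤ ∫⁻ x in ball (0 : Modes M) R, (2 * ‖ballAverage ε ψ x‖ₑ ^ 2
          + 2 * ‖ψ x - ballAverage ε ψ x‖ₑ ^ 2) := by
          refine lintegral_mono fun x => ?_
          have h6 : ‖ψ x‖ ^ 2 ≤ 2 * ‖ballAverage ε ψ x‖ ^ 2
              + 2 * ‖ψ x - ballAverage ε ψ x‖ ^ 2 := by
            have h7 : ‖ψ x‖ ≤ ‖ballAverage ε ψ x‖ + ‖ψ x - ballAverage ε ψ x‖ :=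
              norm_le_norm_add_norm_sub' _ _
            nlinarith [sq_nonneg (‖ballAverage ε ψ x‖ - ‖ψ x - ballAverage ε ψ x‖),
              norm_nonneg (ψ x)]
          have h8 := ENNReal.ofReal_le_ofReal h6
          rw [ENNReal.ofReal_add (by positivity) (by positivity),
            ENNReal.ofReal_mul (by norm_num), ENNReal.ofReal_mul (by norm_num),
            ENNReal.ofReal_pow (norm_nonneg _), ENNReal.ofReal_pow (norm_nonneg _),
            ENNReal.ofReal_pow (norm_nonneg _), ofReal_norm, ofReal_norm, ofReal_norm] at h8
          simpa using h8
      _ = 2 * (∫⁻ x in ball (0 : Modes M) R, ‖ballAverage ε ψ x‖ₑ ^ 2)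
          + 2 * ∫⁻ x in ball (0 : Modes M) R, ‖ψ x - ballAverage ε ψ x‖ₑ ^ 2 := by
          rw [lintegral_add_left (hm.const_mul 2), lintegral_const_mul _ hm,
            lintegral_const_mul' _ _ (by simp)]
      _ ≤ _ := by
          gcongr
          exact Measure.restrict_le_self
  rw [enorm_sq_eq_lintegral, ← lintegral_add_compl _ (measurableSet_ball (x := 0) (ε := R)),
    ENNReal.ofReal_add (by positivity) (by
      have : 0 ≤ C ∨ M = 0 := by
        rcases Nat.eq_zero_or_pos M with h | h
        · exact .inr h
        · exact .inl ((norm_nonneg _).trans (hgC ⟨0, h⟩))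
      positivity), ← add_assoc]
  refine add_le_add (h5.trans ?_) h2
  gcongr
  rw [ENNReal.ofReal_mul (by norm_num)]
  have h9 : ENNReal.ofReal (ε * (M * C)) ^ 2 ≤ ENNReal.ofReal ((ε * (M * C)) ^ 2) := by
    rcases le_total 0 (ε * (M * C)) with h | h
    · rw [ENNReal.ofReal_pow h]
    · simp [ENNReal.ofReal_of_nonpos h]
  have h10 := h1.trans h9
  simpa using mul_le_mul_right h10 2

/-- Rellich's theorem: weak null sequences that are bounded in the form domain converge
strongly. -/
theorem tendsto_zero_of_weakTendsto {d : ℕ → Hilb M N} {g k : ℕ → Fin M → Hilb M N} {C : ℝ}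
    (hd : WeakTendsto d 0) (hdC : ∀ n, ‖d n‖ ≤ C) (hg : ∀ n m, HasWeakPartial m (d n) (g n m))
    (hk : ∀ n m, HasPosition m (d n) (k n m)) (hgC : ∀ n m, ‖g n m‖ ≤ C)
    (hkC : ∀ n m, ‖k n m‖ ≤ C) : Tendsto d atTop (𝓝 0) := by
  have key : Tendsto (fun n => ‖d n‖ₑ ^ 2) atTop (𝓝 0) := by
    rw [ENNReal.tendsto_nhds_zero]
    intro η hη
    obtain ⟨r, hr0, hr⟩ := ENNReal.lt_iff_exists_nnreal_btwn.1 hη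
    have hr0' : (0 : ℝ) < r := by exact_mod_cast hr0
    -- The budget `r` is split into `r/4` for the smoothing error, `r/4` for the tail and `2 ·
    -- (r/4)` for the averages, so `ε` and `R` are fixed before `n` is taken large.
    have hsmall : ∃ ε : ℝ, 0 < ε ∧ 2 * (ε * (M * C)) ^ 2 ≤ r / 4 := by
      have hc : Tendsto (fun ε : ℝ => 2 * (ε * (M * C)) ^ 2) (𝓝[>] 0) (𝓝 0) := by
        have : ContinuousAt (fun ε : ℝ => 2 * (ε * (M * C)) ^ 2) 0 := by fun_prop
        have h1 := this.tendsto.mono_left (nhdsWithin_le_nhds (s := Set.Ioi 0))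
        simpa using h1
      obtain ⟨ε, h1, h2⟩ := ((hc.eventually_le_const (by positivity : (0 : ℝ) < r / 4)).and
        self_mem_nhdsWithin).exists
      exact ⟨ε, h2, h1⟩
    have hlarge : ∃ R : ℝ, 0 < R ∧ M * C ^ 2 / R ^ 2 ≤ r / 4 := by
      have hc : Tendsto (fun R : ℝ => M * C ^ 2 / R ^ 2) atTop (𝓝 0) :=
        tendsto_const_nhds.div_atTop (tendsto_pow_atTop (by norm_num))
      obtain ⟨R, h1, h2⟩ := ((hc.eventually_le_const (by positivity : (0 : ℝ) < r / 4)).and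
        (eventually_gt_atTop 0)).exists
      exact ⟨R, h2, h1⟩
    obtain ⟨ε, hε, hε'⟩ := hsmall
    obtain ⟨R, hR, hR'⟩ := hlarge
    have h1 := (tendsto_lintegral_ballAverage (R := R) hε hd hdC).eventually_le_const
      (show (0 : ℝ≥0∞) < ENNReal.ofReal (r / 4) by simpa using hr0')
    filter_upwards [h1] with n hn
    refine (enorm_sq_le_of_ballAverage hε hR (hg n) (hk n) (hgC n) (hkC n)).trans (le_trans ?_ hr.le)
    calc _ ≤ 2 * ENNReal.ofReal (r / 4) + ENNReal.ofReal (r / 4 + r / 4) := by gcongr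
      _ = ENNReal.ofReal (2 * (r / 4) + (r / 4 + r / 4)) := by
        rw [ENNReal.ofReal_add (by positivity) (by positivity),
          ENNReal.ofReal_add (by positivity) (by positivity),
          ENNReal.ofReal_add (by positivity) (by positivity), ENNReal.ofReal_mul (by norm_num)]
        simp
      _ = r := by
        rw [show 2 * ((r : ℝ) / 4) + (r / 4 + r / 4) = r by ring, ENNReal.ofReal_coe_nnreal]
  have h2 := (ENNReal.tendsto_toReal (by simp : (0 : ℝ≥0∞) ≠ ⊤)).comp key
  have h3 : Tendsto (fun n => ‖d n‖ ^ 2) atTop (𝓝 0) := by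
    simpa [Function.comp_def] using h2
  have h4 := h3.sqrt
  rw [tendsto_zero_iff_norm_tendsto_zero]
  simpa [Real.sqrt_sq] using h4

/-! ### Weak compactness -/

theorem WeakTendsto.comp {E : Type*} [NormedAddCommGroup E] [InnerProductSpace ℂ E] {u : ℕ → E}
    {a : E} (h : WeakTendsto u a) {θ : ℕ → ℕ} (hθ : StrictMono θ) : WeakTendsto (u ∘ θ) a :=
  fun φ => (h φ).comp hθ.tendsto_atTop

/-- Sequential Banach–Alaoglu in the dual of a separable space, transported by the Riesz
isomorphism. The functional of `u` is `⟪u, ·⟫`, hence the conjugations. -/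
theorem exists_weakTendsto_subseq {E : Type*} [NormedAddCommGroup E] [InnerProductSpace ℂ E]
    [CompleteSpace E] [TopologicalSpace.SeparableSpace E] {u : ℕ → E} {C : ℝ}
    (hu : ∀ n, ‖u n‖ ≤ C) : ∃ (a : E) (θ : ℕ → ℕ), StrictMono θ ∧ WeakTendsto (u ∘ θ) a := by
  have h := WeakDual.isSeqCompact_closedBall ℂ E 0 C
  let v : ℕ → WeakDual ℂ E := fun n =>
    WeakDual.toStrongDual.symm (InnerProductSpace.toDual ℂ E (u n))
  obtain ⟨a, -, θ, hθ, hlim⟩ := h (x := v) fun n => by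
    simpa [v] using hu n
  refine ⟨(InnerProductSpace.toDual ℂ E).symm (WeakDual.toStrongDual a), θ, hθ, fun φ => ?_⟩
  have h1 : Tendsto (fun n => v (θ n) φ) atTop (𝓝 (a φ)) :=
    ((WeakDual.eval_continuous φ).tendsto a).comp hlim
  have h2 := (Complex.continuous_conj.tendsto _).comp h1
  have e1 (n : ℕ) : conj (v (θ n) φ) = ⟪φ, u (θ n)⟫_ℂ := by
    rw [← inner_conj_symm φ (u (θ n))]
    rfl
  have e2 : conj (a φ) = ⟪φ, (InnerProductSpace.toDual ℂ E).symm (WeakDual.toStrongDual a)⟫_ℂ := by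
    rw [← inner_conj_symm φ, InnerProductSpace.toDual_symm_apply]
    rfl
  rw [← e2]
  exact h2.congr e1

theorem exists_weakTendsto_subseq_family {E ι : Type*} [NormedAddCommGroup E]
    [InnerProductSpace ℂ E] [CompleteSpace E] [TopologicalSpace.SeparableSpace E] [Finite ι]
    {u : ι → ℕ → E} {C : ℝ} (hu : ∀ i n, ‖u i n‖ ≤ C) :
    ∃ (a : ι → E) (θ : ℕ → ℕ), StrictMono θ ∧ ∀ i, WeakTendsto (u i ∘ θ) (a i) := by
  classical
  cases nonempty_fintype ι
  have key (s : Finset ι) : ∃ (a : ι → E) (θ : ℕ → ℕ), StrictMono θ ∧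
      ∀ i ∈ s, WeakTendsto (u i ∘ θ) (a i) := by
    induction s using Finset.induction_on with
    | empty => exact ⟨0, id, strictMono_id, by simp⟩
    | insert j s hj ih =>
      obtain ⟨a, θ, hθ, h⟩ := ih
      obtain ⟨b, η, hη, hb⟩ := exists_weakTendsto_subseq (u := u j ∘ θ) fun n => hu j _
      refine ⟨Function.update a j b, θ ∘ η, hθ.comp hη, fun i hi => ?_⟩
      rcases Finset.mem_insert.1 hi with rfl | hi'
      · rw [Function.update_self]
        exact hb
      · rw [Function.update_of_ne (fun h0 : i = j => hj (h0 ▸ hi'))]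
        exact (h i hi').comp hη
  obtain ⟨a, θ, hθ, h⟩ := key Finset.univ
  exact ⟨a, θ, hθ, fun i => h i (Finset.mem_univ i)⟩

/-- The graph of the weak derivative is weakly closed: it is cut out by equations between inner
products with fixed vectors. -/
theorem HasWeakPartial.of_weakTendsto {m : Fin M} {u g : ℕ → Hilb M N} {a b : Hilb M N}
    (hu : WeakTendsto u a) (hg : WeakTendsto g b) (h : ∀ n, HasWeakPartial m (u n) (g n)) :
    HasWeakPartial m a b := by
  rw [hasWeakPartial_iff_inner]
  intro f hf hs α
  refine tendsto_nhds_unique (hu _) ?_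
  exact ((hg (testVec f hf.continuous hs α)).neg).congr fun n =>
    (hasWeakPartial_iff_inner.1 (h n) f hf hs α).symm

theorem HasPosition.of_weakTendsto {m : Fin M} {u g : ℕ → Hilb M N} {a b : Hilb M N}
    (hu : WeakTendsto u a) (hg : WeakTendsto g b) (h : ∀ n, HasPosition m (u n) (g n)) :
    HasPosition m a b := by
  rw [hasPosition_iff_inner]
  intro f hf hs α
  refine tendsto_nhds_unique (hu _) ?_
  exact (hg (testVec f hf.continuous hs α)).congr fun n =>
    (hasPosition_iff_inner.1 (h n) f hf hs α).symm

instance : TopologicalSpace.SeparableSpace (Hilb M N) := by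
  have : Fact ((2 : ℝ≥0∞) ≠ ⊤) := ⟨by norm_num⟩
  infer_instance

/-- Convergence in `L²` together with weak convergence of the gradients and of the positions. -/
structure FormTendsto (u : ℕ → formDomain M N) (a : formDomain M N) : Prop where
  strong : Tendsto (fun n => (u n : Hilb M N)) atTop (𝓝 a)
  partialD : ∀ m, WeakTendsto (fun n => partialD M N m (u n)) (partialD M N m a)
  position : ∀ m, WeakTendsto (fun n => position M N m (u n)) (position M N m a)

/-- The functions, their derivatives and their products with coordinates have weak limits along one
common subsequence, and weak closedness shows that these belong to a single element of the form
domain. Rellich's theorem, applied to the difference from the limit, upgrades the convergence of the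
functions to strong convergence. -/
theorem exists_formTendsto_subseq {ι : Type*} [Finite ι] {u : ι → ℕ → formDomain M N} {C : ℝ}
    (hC : ∀ i n, ‖(u i n : Hilb M N)‖ ^ 2 + gradPosSq (u i n) ≤ C) :
    ∃ (a : ι → formDomain M N) (θ : ℕ → ℕ), StrictMono θ ∧
      ∀ i, FormTendsto (u i ∘ θ) (a i) := by
  let v : ι × (Unit ⊕ Fin M ⊕ Fin M) → ℕ → Hilb M N := fun p n =>
    p.2.elim (fun _ => (u p.1 n : Hilb M N))
      (Sum.elim (fun m => partialD M N m (u p.1 n)) fun m => position M N m (u p.1 n))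
  have hle {x : ℝ} (hx : 0 ≤ x) (h : x ^ 2 ≤ C) : x ≤ √C := Real.le_sqrt_of_sq_le h
  have h0 (i : ι) (n : ℕ) : ‖(u i n : Hilb M N)‖ ≤ √C := hle (norm_nonneg _)
    (by linarith [hC i n, gradPosSq_nonneg (u i n)])
  have h1 (i : ι) (n : ℕ) (m : Fin M) : ‖partialD M N m (u i n)‖ ≤ √C := hle (norm_nonneg _)
    (by linarith [hC i n, bound_partialD m (u i n)])
  have h2 (i : ι) (n : ℕ) (m : Fin M) : ‖position M N m (u i n)‖ ≤ √C := hle (norm_nonneg _)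
    (by linarith [hC i n, bound_position m (u i n)])
  obtain ⟨b, θ, hθ, hb⟩ := exists_weakTendsto_subseq_family (u := v) (C := √C) (by
    rintro ⟨i, _ | m | m⟩ n
    exacts [h0 i n, h1 i n m, h2 i n m])
  have hb0 (i : ι) : WeakTendsto (fun n => (u i (θ n) : Hilb M N)) (b (i, .inl ())) :=
    hb (i, .inl ())
  have hb1 (i : ι) (m : Fin M) : WeakTendsto (fun n => partialD M N m (u i (θ n)))
      (b (i, .inr (.inl m))) := hb (i, .inr (.inl m))
  have hb2 (i : ι) (m : Fin M) : WeakTendsto (fun n => position M N m (u i (θ n)))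
      (b (i, .inr (.inr m))) := hb (i, .inr (.inr m))
  have hD (i : ι) (m : Fin M) : HasWeakPartial m (b (i, .inl ())) (b (i, .inr (.inl m))) :=
    .of_weakTendsto (hb0 i) (hb1 i m) fun n => partialD_spec m (u i (θ n))
  have hP (i : ι) (m : Fin M) : HasPosition m (b (i, .inl ())) (b (i, .inr (.inr m))) :=
    .of_weakTendsto (hb0 i) (hb2 i m) fun n => position_spec m (u i (θ n))
  let a : ι → formDomain M N := fun i => ⟨b (i, .inl ()), fun m => ⟨⟨_, hD i m⟩, _, hP i m⟩⟩
  have ea1 (i : ι) (m : Fin M) : partialD M N m (a i) = b (i, .inr (.inl m)) :=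
    (partialD_spec m (a i)).unique (hD i m)
  have ea2 (i : ι) (m : Fin M) : position M N m (a i) = b (i, .inr (.inr m)) :=
    (position_spec m (a i)).unique (hP i m)
  refine ⟨a, θ, hθ, fun i => ⟨?_, fun m => ?_, fun m => ?_⟩⟩
  · have hw : WeakTendsto (fun n => ((u i (θ n) - a i : formDomain M N) : Hilb M N)) 0 := by
      intro φ
      have := (hb0 i φ).sub_const ⟪φ, b (i, .inl ())⟫_ℂ
      simpa [inner_sub_right, a] using this
    -- `K` bounds every norm of the limit, so `√C + K` is a common bound for the differences.
    set K := ∑ m, (‖partialD M N m (a i)‖ + ‖position M N m (a i)‖) + ‖(a i : Hilb M N)‖ with hK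
    have hK1 (m : Fin M) : ‖partialD M N m (a i)‖ + ‖position M N m (a i)‖ ≤ K := by
      have := Finset.single_le_sum (f := fun m => ‖partialD M N m (a i)‖ + ‖position M N m (a i)‖)
        (fun _ _ => by positivity) (Finset.mem_univ m)
      have h3 := norm_nonneg (a i : Hilb M N)
      linarith
    have hK2 : ‖(a i : Hilb M N)‖ ≤ K := by
      have : 0 ≤ ∑ m, (‖partialD M N m (a i)‖ + ‖position M N m (a i)‖) :=
        Finset.sum_nonneg fun _ _ => by positivity
      linarith
    have h := tendsto_zero_of_weakTendsto (C := √C + K) hw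
      (fun n => (norm_sub_le _ _).trans (add_le_add (h0 i _) hK2))
      (fun n m => partialD_spec m (u i (θ n) - a i))
      (fun n m => position_spec m (u i (θ n) - a i))
      (fun n m => by
        rw [map_sub]
        exact (norm_sub_le _ _).trans (add_le_add (h1 i _ m)
          ((le_add_of_nonneg_right (norm_nonneg _)).trans (hK1 m))))
      (fun n m => by
        rw [map_sub]
        exact (norm_sub_le _ _).trans (add_le_add (h2 i _ m)
          ((le_add_of_nonneg_left (norm_nonneg _)).trans (hK1 m))))
    have h3 := h.add_const (a i : Hilb M N)
    simpa using h3
  · rw [ea1]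
    exact hb1 i m
  · rw [ea2]
    exact hb2 i m

end

/-! ### Trace calculus and finite-rank states -/

section

variable {M N : ℕ}

/-! ### Linearity of the trace -/

/-- A single decomposition of `Γ` computes the traces of all bounded forms, so linearity can be read
off term by term. -/
theorem trace_add {a b : Form M N} (ha : a.IsBounded) (hb : b.IsBounded)
    {Γ : Hilb M N →L[ℂ] Hilb M N} (hΓ : Γ ∈ densityMatrices M N) :
    trace (a + b) Γ = trace a Γ + trace b Γ := by
  obtain ⟨p, hp⟩ := hΓ
  refine (hp.hasSum_trace (ha.add hb)).unique ?_
  simpa [mul_add] using (hp.hasSum_trace ha).add (hp.hasSum_trace hb)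

theorem trace_smul {a : Form M N} (z : ℂ) (ha : a.IsBounded)
    {Γ : Hilb M N →L[ℂ] Hilb M N} (hΓ : Γ ∈ densityMatrices M N) :
    trace (z • a) Γ = z * trace a Γ := by
  obtain ⟨p, hp⟩ := hΓ
  refine (hp.hasSum_trace (ha.smul z)).unique ?_
  simpa [mul_left_comm] using (hp.hasSum_trace ha).mul_left z

theorem trace_sub {a b : Form M N} (ha : a.IsBounded) (hb : b.IsBounded)
    {Γ : Hilb M N →L[ℂ] Hilb M N} (hΓ : Γ ∈ densityMatrices M N) :
    trace (a - b) Γ = trace a Γ - trace b Γ := by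
  obtain ⟨p, hp⟩ := hΓ
  refine (hp.hasSum_trace (ha.sub hb)).unique ?_
  simpa [mul_sub] using (hp.hasSum_trace ha).sub (hp.hasSum_trace hb)

theorem trace_sum {ι : Type*} (s : Finset ι) {a : ι → Form M N} (ha : ∀ i ∈ s, (a i).IsBounded)
    {Γ : Hilb M N →L[ℂ] Hilb M N} (hΓ : Γ ∈ densityMatrices M N) :
    trace (∑ i ∈ s, a i) Γ = ∑ i ∈ s, trace (a i) Γ := by
  obtain ⟨p, hp⟩ := hΓ
  refine (hp.hasSum_trace (isBounded_sum s ha)).unique ?_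
  simpa [Finset.mul_sum, LinearMap.sum_apply] using
    hasSum_sum fun i hi => hp.hasSum_trace (ha i hi)

theorem trace_im {a : Form M N} (ha : a.IsBounded) {Γ : Hilb M N →L[ℂ] Hilb M N}
    (hΓ : Γ ∈ densityMatrices M N) (h : ∀ ψ, (a ψ ψ).im = 0) : (trace a Γ).im = 0 := by
  obtain ⟨p, hp⟩ := hΓ
  refine (Complex.hasSum_im (hp.hasSum_trace ha)).unique ?_
  simp [h]

theorem inner_self_eq_ofReal (ψ : Hilb M N) : ⟪ψ, ψ⟫_ℂ = ((‖ψ‖ ^ 2 : ℝ) : ℂ) := by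
  rw [inner_self_eq_norm_sq_to_K]
  norm_cast

theorem boundedForm_one_apply (ψ : formDomain M N) :
    boundedForm (1 : Hilb M N →L[ℂ] Hilb M N) ψ ψ = ((‖(ψ : Hilb M N)‖ ^ 2 : ℝ) : ℂ) :=
  inner_self_eq_ofReal (ψ : Hilb M N)

theorem trace_one {Γ : Hilb M N →L[ℂ] Hilb M N} (hΓ : Γ ∈ densityMatrices M N) :
    trace (boundedForm 1) Γ = 1 := by
  obtain ⟨p, hp⟩ := hΓ
  refine (hp.hasSum_trace (isBounded_boundedForm _)).unique ?_
  have h1 : HasSum (fun j => (p.1 j : ℂ)) ((1 : ℝ) : ℂ) := Complex.hasSum_ofReal.2 hp.hasSum_one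
  rw [Complex.ofReal_one] at h1
  refine h1.congr_fun fun j => ?_
  rcases eq_or_ne (p.1 j) 0 with h0 | h0
  · simp [h0]
  · have h2 : ‖(p.2 j : Hilb M N)‖ = 1 := hp.orthonormal.1 ⟨j, h0⟩
    rw [boundedForm_one_apply, h2]
    simp

/-! ### Unitary conjugation -/

/-- `V` is `U` on the form domain. Weights and orthonormality survive because `U` is isometric; `hC`
is what keeps the energy finite. -/
theorem IsDecomposition.conj {Γ : Hilb M N →L[ℂ] Hilb M N} {c : ℕ → ℝ}
    {ψ : ℕ → formDomain M N} (h : IsDecomposition Γ c ψ) (U : Hilb M N ≃ₗᵢ[ℂ] Hilb M N)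
    {V : formDomain M N → formDomain M N} (hV : ∀ φ, (V φ : Hilb M N) = U φ) {C : ℝ}
    (hC : ∀ φ, gradPosSq (V φ) ≤ C * (‖(φ : Hilb M N)‖ ^ 2 + gradPosSq φ)) :
    IsDecomposition ((U : Hilb M N →L[ℂ] Hilb M N) ∘L Γ ∘L (U.symm : Hilb M N →L[ℂ] Hilb M N)) c
      (V ∘ ψ) where
  nonneg := h.nonneg
  hasSum_one := h.hasSum_one
  orthonormal := by
    have := h.orthonormal.comp_linearIsometry U.toLinearIsometry
    convert this using 2 with j
    exact hV _
  summable := by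
    refine Summable.of_nonneg_of_le (fun j => mul_nonneg (h.nonneg j) (gradPosSq_nonneg _))
      (fun j => ?_) ((h.hasSum_one.summable.add h.summable).mul_left C)
    rcases eq_or_ne (c j) 0 with h0 | h0
    · simp [h0]
    · have h1 : ‖(ψ j : Hilb M N)‖ = 1 := h.orthonormal.1 ⟨j, h0⟩
      have h2 := mul_le_mul_of_nonneg_left (hC (ψ j)) (h.nonneg j)
      rw [h1] at h2
      simp only [Function.comp_apply]
      linarith
  hasSum_apply := fun φ => by
    have h1 := (h.hasSum_apply (U.symm φ)).mapL (U : Hilb M N →L[ℂ] Hilb M N)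
    refine h1.congr_fun fun j => ?_
    simp only [Function.comp_apply, hV, map_smul]
    rw [← U.inner_map_eq_flip]
    rfl

/-- Conjugation of a density matrix by a unitary that preserves the form domain. -/
theorem trace_conj {Γ : Hilb M N →L[ℂ] Hilb M N} (hΓ : Γ ∈ densityMatrices M N)
    (U : Hilb M N ≃ₗᵢ[ℂ] Hilb M N)
    {V : formDomain M N → formDomain M N} (hV : ∀ φ, (V φ : Hilb M N) = U φ) {C : ℝ}
    (hC : ∀ φ, gradPosSq (V φ) ≤ C * (‖(φ : Hilb M N)‖ ^ 2 + gradPosSq φ)) :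
    ((U : Hilb M N →L[ℂ] Hilb M N) ∘L Γ ∘L (U.symm : Hilb M N →L[ℂ] Hilb M N))
      ∈ densityMatrices M N ∧ ∀ a b : Form M N, a.IsBounded → b.IsBounded →
      (∀ ψ, a (V ψ) (V ψ) = b ψ ψ) →
      trace a ((U : Hilb M N →L[ℂ] Hilb M N) ∘L Γ ∘L (U.symm : Hilb M N →L[ℂ] Hilb M N))
        = trace b Γ := by
  obtain ⟨p, hp⟩ := hΓ
  refine ⟨⟨(p.1, V ∘ p.2), hp.conj U hV hC⟩, fun a b ha hb hab => ?_⟩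
  refine ((hp.conj U hV hC).hasSum_trace ha).unique ?_
  simpa [hab] using hp.hasSum_trace hb

/-! ### Finite ensembles -/

/-- The operator `∑ i, |u i⟩⟨u i|` of a finite family in the form domain. -/
def ensemble {ι : Type*} [Fintype ι] (u : ι → formDomain M N) : Hilb M N →L[ℂ] Hilb M N :=
  ∑ i, (innerSL ℂ (u i : Hilb M N)).smulRight (u i : Hilb M N)

theorem ensemble_apply {ι : Type*} [Fintype ι] (u : ι → formDomain M N) (φ : Hilb M N) :
    ensemble u φ = ∑ i, ⟪(u i : Hilb M N), φ⟫_ℂ • (u i : Hilb M N) := by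
  simp [ensemble]

section Gram

variable {ι : Type*} [Fintype ι] [DecidableEq ι]

/-- A unitary change of the vectors of an ensemble leaves all quadratic expressions invariant. -/
theorem sum_unitary_comb {E : Type*} [AddCommGroup E] [Module ℂ E] (u : ι → formDomain M N)
    {U : Matrix ι ι ℂ} (hU : U * Uᴴ = 1) (b : formDomain M N →ₗ⋆[ℂ] formDomain M N →ₗ[ℂ] E) :
    ∑ k, b (∑ i, U i k • u i) (∑ j, U j k • u j) = ∑ i, b (u i) (u i) := by
  have e (k : ι) : b (∑ i, U i k • u i) (∑ j, U j k • u j)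
      = ∑ i, ∑ j, (U j k * conj (U i k)) • b (u i) (u j) := by
    rw [map_sum b, LinearMap.sum_apply]
    refine Finset.sum_congr rfl fun i _ => ?_
    rw [map_smulₛₗ, LinearMap.smul_apply, map_sum (b (u i)), Finset.smul_sum]
    refine Finset.sum_congr rfl fun j _ => ?_
    rw [map_smul, smul_smul, mul_comm]
  simp_rw [e]
  rw [Finset.sum_comm]
  refine Finset.sum_congr rfl fun i _ => ?_
  rw [Finset.sum_comm]
  have e2 (j : ι) : ∑ k, (U j k * conj (U i k)) • b (u i) (u j)
      = (if j = i then (1 : ℂ) else 0) • b (u i) (u j) := by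
    rw [← Finset.sum_smul]
    congr 1
    have := congrFun (congrFun hU j) i
    rw [Matrix.mul_apply, Matrix.one_apply] at this
    simpa [Matrix.conjTranspose_apply] using this
  simp_rw [e2]
  simp

/-- The Gram matrix is Hermitian. Combining the vectors with its unitary of eigenvectors makes them
orthogonal, and the squared norms become the eigenvalues. -/
theorem exists_diagonalization (u : ι → formDomain M N) :
    ∃ (U : Matrix ι ι ℂ) (d : ι → ℝ), U * Uᴴ = 1 ∧
      ∀ k l, ⟪((∑ i, U i k • u i : formDomain M N) : Hilb M N),
        ((∑ i, U i l • u i : formDomain M N) : Hilb M N)⟫_ℂ = if k = l then (d k : ℂ) else 0 := by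
  set G : Matrix ι ι ℂ := Matrix.of fun i j => ⟪(u i : Hilb M N), u j⟫_ℂ with hG
  have hH : G.IsHermitian := by
    ext i j
    simp [hG, Matrix.conjTranspose_apply]
  set U : Matrix ι ι ℂ := (hH.eigenvectorUnitary : Matrix ι ι ℂ) with hU
  have hU1 : U * Uᴴ = 1 := Unitary.mul_star_self_of_mem hH.eigenvectorUnitary.2
  have hU2 : Uᴴ * U = 1 := Unitary.star_mul_self_of_mem hH.eigenvectorUnitary.2
  refine ⟨U, hH.eigenvalues, hU1, fun k l => ?_⟩
  have hs : G = U * Matrix.diagonal (RCLike.ofReal ∘ hH.eigenvalues) * Uᴴ := hH.spectral_theorem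
  have hs2 : Uᴴ * G * U = Matrix.diagonal (RCLike.ofReal ∘ hH.eigenvalues) := by
    calc Uᴴ * G * U = Uᴴ * (U * Matrix.diagonal (RCLike.ofReal ∘ hH.eigenvalues) * Uᴴ) * U :=
          congrArg (fun A => Uᴴ * A * U) hs
      _ = (Uᴴ * U) * Matrix.diagonal (RCLike.ofReal ∘ hH.eigenvalues) * (Uᴴ * U) := by
          simp only [Matrix.mul_assoc]
      _ = _ := by rw [hU2, Matrix.one_mul, Matrix.mul_one]
  have h1 := congrFun (congrFun hs2 k) l
  rw [Matrix.diagonal_apply] at h1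
  have h2 : (Uᴴ * G * U) k l = ⟪((∑ i, U i k • u i : formDomain M N) : Hilb M N),
        ((∑ i, U i l • u i : formDomain M N) : Hilb M N)⟫_ℂ := by
    simp only [Submodule.coe_sum, Submodule.coe_smul, sum_inner, inner_sum, inner_smul_left,
      inner_smul_right, Matrix.mul_apply, Finset.sum_mul, Finset.mul_sum,
      Matrix.conjTranspose_apply, hG, Matrix.of_apply]
    refine Finset.sum_congr rfl fun i _ => Finset.sum_congr rfl fun j _ => ?_
    simp only [RCLike.star_def]
    ring
  rw [← h2, h1]
  rfl

end Gram

/-- A finite family becomes a sequence by padding with zeros; an expression vanishing at zero data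
commutes with the padding. -/
theorem extend_comp {ι E F : Type*} [Zero E] [Zero F] {κ : ι → ℕ} (hκ : κ.Injective)
    (c : ι → ℝ) (χ : ι → E) (G : ℝ → E → F) (hG : G 0 0 = 0) :
    (fun j => G (Function.extend κ c 0 j) (Function.extend κ χ 0 j))
      = Function.extend κ (fun i => G (c i) (χ i)) 0 := by
  funext j
  by_cases hj : ∃ i, κ i = j
  · obtain ⟨i, rfl⟩ := hj
    rw [hκ.extend_apply, hκ.extend_apply, hκ.extend_apply]
  · rw [Function.extend_apply' _ _ _ hj, Function.extend_apply' _ _ _ hj,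
      Function.extend_apply' _ _ _ hj]
    exact hG

/-- A normalized finite ensemble is a density matrix with finite energy. -/
theorem ensemble_mem_and_trace {ι : Type*} [Fintype ι] (u : ι → formDomain M N)
    (hu : ∑ i, ‖(u i : Hilb M N)‖ ^ 2 = 1) :
    ensemble u ∈ densityMatrices M N ∧
      ∀ a : Form M N, a.IsBounded → trace a (ensemble u) = ∑ i, a (u i) (u i) := by
  classical
  obtain ⟨U, d, hU, hd⟩ := exists_diagonalization u
  set φ : ι → formDomain M N := fun k => ∑ i, U i k • u i with hφ
  have hnorm (k : ι) : ‖(φ k : Hilb M N)‖ ^ 2 = d k := by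
    have h1 := hd k k
    rw [if_pos rfl, inner_self_eq_ofReal] at h1
    exact_mod_cast h1
  have hd0 (k : ι) : 0 ≤ d k := by rw [← hnorm]; positivity
  have hzero (k : ι) (h : d k = 0) : φ k = 0 := by
    apply Subtype.ext
    have := hnorm k
    rw [h] at this
    simpa using this
  -- Normalized eigenvectors. Since `0⁻¹ = 0`, a null eigenvalue gives the zero vector with weight
  -- zero, which a decomposition permits.
  set χ : ι → formDomain M N := fun k => (((√(d k))⁻¹ : ℝ) : ℂ) • φ k with hχ
  -- The target `E` is left general: `ℂ` serves for traces and `L²` for the action of the operator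
  -- itself.
  have hquad {E : Type} [AddCommGroup E] [Module ℂ E]
      (b : formDomain M N →ₗ⋆[ℂ] formDomain M N →ₗ[ℂ] E) (k : ι) :
      (d k : ℂ) • b (χ k) (χ k) = b (φ k) (φ k) := by
    rcases eq_or_ne (d k) 0 with h | h
    · simp [h, hzero k h]
    · have e : b (χ k) (χ k) = (((√(d k))⁻¹ : ℝ) : ℂ) • (((√(d k))⁻¹ : ℝ) : ℂ)
          • b (φ k) (φ k) := by
        change b ((((√(d k))⁻¹ : ℝ) : ℂ) • φ k) ((((√(d k))⁻¹ : ℝ) : ℂ) • φ k) = _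
        rw [map_smulₛₗ b, LinearMap.smul_apply, map_smul (b (φ k)), Complex.conj_ofReal]
      rw [e, smul_smul, smul_smul, ← Complex.ofReal_mul, ← Complex.ofReal_mul]
      have : d k * (√(d k))⁻¹ * (√(d k))⁻¹ = 1 := by
        rw [mul_assoc, ← mul_inv, Real.mul_self_sqrt (hd0 k), mul_inv_cancel₀ h]
      rw [this, Complex.ofReal_one, one_smul]
  have hsum {E : Type} [AddCommGroup E] [Module ℂ E]
      (b : formDomain M N →ₗ⋆[ℂ] formDomain M N →ₗ[ℂ] E) :
      ∑ k, (d k : ℂ) • b (χ k) (χ k) = ∑ i, b (u i) (u i) := by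
    rw [Finset.sum_congr rfl fun k _ => hquad b k]
    exact sum_unitary_comb u hU b
  set κ : ι → ℕ := fun i => (Fintype.equivFin ι i : ℕ) with hκdef
  have hκ : κ.Injective := Fin.val_injective.comp (Fintype.equivFin ι).injective
  have horth (k l : ι) (hk : d k ≠ 0) (hl : d l ≠ 0) :
      ⟪(χ k : Hilb M N), χ l⟫_ℂ = if k = l then 1 else 0 := by
    have e : ⟪(χ k : Hilb M N), χ l⟫_ℂ
        = (((√(d k))⁻¹ * (√(d l))⁻¹ : ℝ) : ℂ) * if k = l then (d k : ℂ) else 0 := by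
      rw [← hd k l]
      change ⟪((((√(d k))⁻¹ : ℝ) : ℂ) • φ k : Hilb M N), (((√(d l))⁻¹ : ℝ) : ℂ) • φ l⟫_ℂ
        = _ * ⟪(φ k : Hilb M N), φ l⟫_ℂ
      rw [inner_smul_left, inner_smul_right, Complex.conj_ofReal]
      push_cast
      ring
    rw [e]
    split_ifs with h
    · subst h
      rw [← Complex.ofReal_mul, ← mul_inv, Real.mul_self_sqrt (hd0 k), inv_mul_cancel₀ hk,
        Complex.ofReal_one]
    · rw [mul_zero]
  have hdec : IsDecomposition (ensemble u) (Function.extend κ d 0) (Function.extend κ χ 0) := by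
    have hpos (j : {j // Function.extend κ d 0 j ≠ 0}) : ∃ i, κ i = j ∧ d i ≠ 0 := by
      by_cases hj : ∃ i, κ i = j
      · obtain ⟨i, hi⟩ := hj
        refine ⟨i, hi, ?_⟩
        have := j.2
        rwa [← hi, hκ.extend_apply] at this
      · exact absurd (Function.extend_apply' _ _ _ hj) j.2
    refine ⟨fun j => ?_, ?_, ⟨fun j => ?_, fun j l hjl => ?_⟩, ?_, fun x => ?_⟩
    · by_cases hj : ∃ i, κ i = j
      · obtain ⟨i, rfl⟩ := hj
        rw [hκ.extend_apply]
        exact hd0 i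
      · rw [Function.extend_apply' _ _ _ hj]
        rfl
    · rw [hasSum_extend_zero hκ]
      have h1 : ∑ k, d k = 1 := by
        have h2 := sum_unitary_comb u hU (boundedForm 1)
        simp_rw [boundedForm_one_apply] at h2
        have h3 : ∑ k, ‖(φ k : Hilb M N)‖ ^ 2 = ∑ i, ‖(u i : Hilb M N)‖ ^ 2 := by
          exact_mod_cast h2
        simp_rw [hnorm] at h3
        rw [h3, hu]
      rw [← h1]
      exact hasSum_fintype d
    · obtain ⟨i, hi, hi0⟩ := hpos j
      have h1 := horth i i hi0 hi0
      rw [if_pos rfl, inner_self_eq_ofReal] at h1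
      have h2 : ‖(χ i : Hilb M N)‖ ^ 2 = 1 := by exact_mod_cast h1
      change ‖((Function.extend κ χ 0 j : formDomain M N) : Hilb M N)‖ = 1
      rw [← hi, hκ.extend_apply]
      exact (pow_eq_one_iff_of_nonneg (norm_nonneg _) two_ne_zero).1 h2
    · obtain ⟨i, hi, hi0⟩ := hpos j
      obtain ⟨k, hk, hk0⟩ := hpos l
      have hik : i ≠ k := by
        rintro rfl
        exact hjl (Subtype.ext (hi.symm.trans hk))
      change ⟪((Function.extend κ χ 0 j : formDomain M N) : Hilb M N),
        (Function.extend κ χ 0 l : formDomain M N)⟫_ℂ = 0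
      rw [← hi, ← hk, hκ.extend_apply, hκ.extend_apply, horth i k hi0 hk0, if_neg hik]
    · rw [extend_comp hκ d χ (fun c ψ => c * gradPosSq ψ) (by simp)]
      exact ((hasSum_extend_zero hκ).2 (hasSum_fintype _)).summable
    · rw [extend_comp hκ d χ (fun c ψ => (c : ℂ) • ⟪(ψ : Hilb M N), x⟫_ℂ • (ψ : Hilb M N))
        (by simp), hasSum_extend_zero hκ, ensemble_apply]
      -- The rank-one operator `|q⟩⟨p|` applied to `x`, seen as a sesquilinear map, so that `hsum`
      -- also identifies the two operators.
      let b : formDomain M N →ₗ⋆[ℂ] formDomain M N →ₗ[ℂ] Hilb M N :=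
        LinearMap.mk₂'ₛₗ (starRingEnd ℂ) (RingHom.id ℂ)
          (fun p q => ⟪(p : Hilb M N), x⟫_ℂ • (q : Hilb M N))
          (fun p p' q => by rw [Submodule.coe_add, inner_add_left, add_smul])
          (fun a p q => by rw [Submodule.coe_smul, inner_smul_left, mul_smul])
          (fun p q q' => by rw [Submodule.coe_add, smul_add])
          (fun a p q => by rw [Submodule.coe_smul, smul_comm]; rfl)
      have h1 := hsum b
      have h2 : ∑ i, ⟪(u i : Hilb M N), x⟫_ℂ • (u i : Hilb M N) = ∑ i, b (u i) (u i) := rfl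
      rw [h2, ← h1]
      exact hasSum_fintype _
  refine ⟨⟨(_, _), hdec⟩, fun a ha => (hdec.hasSum_trace ha).unique ?_⟩
  rw [extend_comp hκ d χ (fun c ψ => (c : ℂ) * a ψ ψ) (by simp), hasSum_extend_zero hκ,
    ← hsum a]
  exact hasSum_fintype _

end

section

open Filter Topology

variable {M N : ℕ}

/-! ### Approximation by small ensembles -/

/-- Finitely many expectation values of a density matrix are approximated by those of an ensemble
whose size depends only on the number of observables (by Carathéodory's theorem). -/
theorem exists_ensemble_approx {ι : Type*} [Fintype ι] {A : ι → Form M N}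
    (hA : ∀ i, (A i).IsBounded) {Γ : Hilb M N →L[ℂ] Hilb M N} (hΓ : Γ ∈ densityMatrices M N)
    {ε : ℝ} (hε : 0 < ε) :
    ∃ u : Fin (Fintype.card ι + 1) → formDomain M N, ∑ k, ‖(u k : Hilb M N)‖ ^ 2 = 1 ∧
      ∀ i, |∑ k, (A i (u k) (u k)).re - (trace (A i) Γ).re| < ε := by
  obtain ⟨⟨c, ψ⟩, hp⟩ := hΓ
  simp only at hp
  set val : formDomain M N → ι → ℝ := fun φ i => (A i φ φ).re with hval
  set T : ι → ℝ := fun i => (trace (A i) Γ).re with hT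
  set S : Set (ι → ℝ) := {v | ∃ φ : formDomain M N, ‖(φ : Hilb M N)‖ = 1 ∧ val φ = v} with hS
  have hsum : HasSum (fun j => c j • val (ψ j)) T := by
    rw [Pi.hasSum]
    intro i
    refine (Complex.hasSum_re (hp.hasSum_trace (hA i))).congr_fun fun j => ?_
    rw [Complex.re_ofReal_mul]
    rfl
  obtain ⟨j₀, hj₀⟩ : ∃ j, c j ≠ 0 := by
    by_contra! h
    have h1 := hp.hasSum_one
    rw [show c = fun _ => 0 from funext h] at h1
    exact zero_ne_one (hasSum_zero.unique h1)
  -- Vectors of weight zero need not be normalized; replacing their values by that of a fixed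
  -- normalized one puts every `z j` in `S` without affecting the weighted sums.
  set z : ℕ → ι → ℝ := fun j => if c j = 0 then val (ψ j₀) else val (ψ j) with hz
  have hzS (j : ℕ) : z j ∈ S := by
    simp only [hz]
    split_ifs with h
    · exact ⟨_, hp.orthonormal.1 ⟨j₀, hj₀⟩, rfl⟩
    · exact ⟨_, hp.orthonormal.1 ⟨j, h⟩, rfl⟩
  have hcz (j : ℕ) : c j • z j = c j • val (ψ j) := by
    simp only [hz]
    split_ifs with h
    · rw [h, zero_smul, zero_smul]
    · rfl
  have hc1 := hp.hasSum_one.tendsto_sum_nat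
  have hlim : Tendsto (fun n => (Finset.range n).centerMass c z) atTop (𝓝 T) := by
    have h1 := (hc1.inv₀ one_ne_zero).smul hsum.tendsto_sum_nat
    rw [inv_one, one_smul] at h1
    refine h1.congr fun n => ?_
    rw [Finset.centerMass, Finset.sum_congr rfl fun j _ => hcz j]
  -- Renormalized partial sums are convex combinations of points of `S`. They reach `T` only in the
  -- limit, which is why the result is an approximation.
  have hmem : T ∈ closure (convexHull ℝ S) := by
    refine mem_closure_of_tendsto hlim ?_
    filter_upwards [hc1.eventually_const_lt zero_lt_one] with n hn
    exact Finset.centerMass_mem_convexHull _ (fun j _ => hp.nonneg j) hn fun j _ => hzS j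
  obtain ⟨w, hw, hdist⟩ := Metric.mem_closure_iff.1 hmem ε hε
  obtain ⟨κ, hκ, y, a, hy, hai, ha, ha1, hay⟩ := eq_pos_convex_span_of_mem_convexHull hw
  -- Carathéodory supplies affinely independent points, and `ℝ^ι` has room for at most `card ι + 1`
  -- of these.
  have hcard : Fintype.card κ ≤ Fintype.card (Fin (Fintype.card ι + 1)) := by
    rw [Fintype.card_fin]
    refine hai.card_le_finrank_succ.trans (Nat.succ_le_succ ?_)
    exact (Submodule.finrank_le _).trans_eq (Module.finrank_fintype_fun_eq_card ℝ)
  obtain ⟨e⟩ := Function.Embedding.nonempty_of_card_le hcard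
  choose φ hφ1 hφ using fun k => hy (Set.mem_range_self k)
  -- The square root moves the weight into the vector, since forms are quadratic. Zero vectors then
  -- pad the family to the fixed length.
  set χ : κ → formDomain M N := fun k => ((√(a k) : ℝ) : ℂ) • φ k with hχ
  have hext (G : formDomain M N → ℝ) (hG : G 0 = 0) :
      ∑ k, G (Function.extend e χ 0 k) = ∑ k, G (χ k) := by
    refine (Fintype.sum_of_injective e e.injective _ _ (fun i hi => ?_) fun i => ?_).symm
    · rw [Function.extend_apply' _ _ _ (by simpa using hi)]
      exact hG
    · rw [e.injective.extend_apply]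
  refine ⟨Function.extend e χ 0, ?_, fun i => ?_⟩
  · rw [hext (fun φ => ‖(φ : Hilb M N)‖ ^ 2) (by simp), ← ha1]
    refine Finset.sum_congr rfl fun k _ => ?_
    rw [hχ, Submodule.coe_smul, norm_smul, hφ1, mul_one, Complex.norm_real, Real.norm_eq_abs,
      sq_abs, Real.sq_sqrt (ha k).le]
  · rw [hext (fun φ => (A i φ φ).re) (by simp)]
    have h1 : ∑ k, (A i (χ k) (χ k)).re = w i := by
      rw [← hay, Finset.sum_apply]
      refine Finset.sum_congr rfl fun k _ => ?_
      have h2 : A i (χ k) (χ k) = (a k : ℂ) * A i (φ k) (φ k) := by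
        rw [hχ]
        change A i (((√(a k) : ℝ) : ℂ) • φ k) (((√(a k) : ℝ) : ℂ) • φ k) = _
        rw [map_smulₛₗ (A i), LinearMap.smul_apply, map_smul (A i (φ k)), Complex.conj_ofReal,
          smul_smul, ← Complex.ofReal_mul, Real.mul_self_sqrt (ha k).le, smul_eq_mul]
      rw [h2, Complex.re_ofReal_mul, ← hφ]
      rfl
    rw [h1, abs_sub_comm, ← Real.dist_eq]
    exact (dist_le_pi_dist T w i).trans_lt hdist

end

/-! ### Reality -/

section

variable {M N : ℕ}

/-! ### Complex conjugation -/

/-- Entrywise complex conjugation of spinors. -/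
def conjSpinor (N : ℕ) : Spinor N →ₗᵢ⋆[ℂ] Spinor N where
  toFun v := WithLp.toLp 2 fun α => conj (v α)
  map_add' v w := by ext α; simp
  map_smul' a v := by ext α; simp
  norm_map' v := by
    rw [EuclideanSpace.norm_eq, EuclideanSpace.norm_eq]
    simp

theorem conjSpinor_apply (v : Spinor N) (α : Spins N) : conjSpinor N v α = conj (v α) := rfl

/-- Complex conjugation of wave functions. -/
def conjHilb (M N : ℕ) : Hilb M N →SL[starRingEnd ℂ] Hilb M N :=
  (conjSpinor N).toContinuousLinearMap.compLpL 2 volume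

theorem coeFn_conjHilb (ψ : Hilb M N) : conjHilb M N ψ =ᵐ[volume] fun x => conjSpinor N (ψ x) :=
  ContinuousLinearMap.coeFn_compLpL _ _

theorem conjHilb_conjHilb (ψ : Hilb M N) : conjHilb M N (conjHilb M N ψ) = ψ := by
  apply Lp.ext
  filter_upwards [coeFn_conjHilb (conjHilb M N ψ), coeFn_conjHilb ψ] with x h1 h2
  rw [h1, h2]
  ext α
  simp [conjSpinor_apply]

theorem inner_conjHilb (ψ φ : Hilb M N) :
    ⟪conjHilb M N ψ, conjHilb M N φ⟫_ℂ = conj ⟪ψ, φ⟫_ℂ := by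
  rw [L2.inner_def, L2.inner_def, ← integral_conj]
  apply integral_congr_ae
  filter_upwards [coeFn_conjHilb ψ, coeFn_conjHilb φ] with x h1 h2
  rw [h1, h2]
  simp [PiLp.inner_apply, conjSpinor_apply]

theorem integral_spinor_apply {f : Modes M → Spinor N} (hf : Integrable f) (α : Spins N) :
    (∫ x, f x) α = ∫ x, f x α :=
  ((EuclideanSpace.proj (𝕜 := ℂ) α).integral_comp_comm hf).symm

theorem integral_smul_conjHilb {f : Modes M → ℂ} (hf : Continuous f) (hs : HasCompactSupport f)
    (ψ : Hilb M N) :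
    ∫ x, f x • conjHilb M N ψ x = conjSpinor N (∫ x, conj (f x) • ψ x) := by
  have hf' : Continuous fun x => conj (f x) := Complex.continuous_conj.comp hf
  have hs' : HasCompactSupport fun x => conj (f x) := hs.comp_left (map_zero _)
  ext α
  rw [conjSpinor_apply, integral_spinor_apply (integrable_test_smul hf hs _),
    integral_spinor_apply (integrable_test_smul hf' hs' _), ← integral_conj]
  apply integral_congr_ae
  filter_upwards [coeFn_conjHilb ψ] with x hx
  rw [hx]
  simp [conjSpinor_apply]

/-- Testing `conj ψ` with `f` is the conjugate of testing `ψ` with `conj f`, which is again a test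
function. -/
theorem HasWeakPartial.conj {m : Fin M} {ψ g : Hilb M N} (h : HasWeakPartial m ψ g) :
    HasWeakPartial m (conjHilb M N ψ) (conjHilb M N g) := by
  intro f hf hs
  have hf' : ContDiff ℝ ∞ fun x => conj (f x) := Complex.conjCLE.contDiff.comp hf
  have hs' : HasCompactSupport fun x => conj (f x) := hs.comp_left (map_zero _)
  have e (x : Modes M) : fderiv ℝ (fun x => conj (f x)) x (EuclideanSpace.single m 1)
      = conj (fderiv ℝ f x (EuclideanSpace.single m 1)) := by
    have h1 : HasFDerivAt f (fderiv ℝ f x) x := (hf.differentiable (by simp) x).hasFDerivAt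
    have h2 : HasFDerivAt (fun x => conj (f x))
        ((Complex.conjCLE : ℂ →L[ℝ] ℂ).comp (fderiv ℝ f x)) x :=
      (Complex.conjCLE : ℂ →L[ℝ] ℂ).hasFDerivAt.comp x h1
    rw [h2.fderiv]
    rfl
  rw [integral_smul_conjHilb (continuous_test_deriv hf _) (hs.fderiv_apply ℝ _),
    integral_smul_conjHilb hf.continuous hs, ← map_neg, ← h _ hf' hs']
  simp_rw [e]

theorem HasPosition.conj {m : Fin M} {ψ g : Hilb M N} (h : HasPosition m ψ g) :
    HasPosition m (conjHilb M N ψ) (conjHilb M N g) := by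
  filter_upwards [h, coeFn_conjHilb ψ, coeFn_conjHilb g] with x hx h1 h2
  rw [h1, h2, hx, map_smulₛₗ, Complex.conj_ofReal]

/-- Complex conjugation on the form domain. -/
def conjForm (ψ : formDomain M N) : formDomain M N :=
  ⟨conjHilb M N ψ, fun m => ⟨⟨_, (partialD_spec m ψ).conj⟩, _, (position_spec m ψ).conj⟩⟩

theorem coe_conjForm (ψ : formDomain M N) : (conjForm ψ : Hilb M N) = conjHilb M N ψ := rfl

theorem partialD_conjForm (m : Fin M) (ψ : formDomain M N) :
    partialD M N m (conjForm ψ) = conjHilb M N (partialD M N m ψ) :=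
  (partialD_spec m _).unique (partialD_spec m ψ).conj

theorem position_conjForm (m : Fin M) (ψ : formDomain M N) :
    position M N m (conjForm ψ) = conjHilb M N (position M N m ψ) :=
  (position_spec m _).unique (position_spec m ψ).conj

theorem coeFn_spinOp (B : Matrix (Spins N) (Spins N) ℂ) (ψ : Hilb M N) :
    spinOp M B ψ =ᵐ[volume] fun x => Matrix.toEuclideanCLM (n := Spins N) (𝕜 := ℂ) B (ψ x) :=
  ContinuousLinearMap.coeFn_compLpL _ _

theorem spinOp_conjHilb {B : Matrix (Spins N) (Spins N) ℂ} (hB : ∀ α β, conj (B α β) = B α β)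
    (ψ : Hilb M N) : spinOp M B (conjHilb M N ψ) = conjHilb M N (spinOp M B ψ) := by
  apply Lp.ext
  filter_upwards [coeFn_spinOp B (conjHilb M N ψ), coeFn_spinOp B ψ, coeFn_conjHilb ψ,
    coeFn_conjHilb (spinOp M B ψ)] with x h1 h2 h3 h4
  rw [h1, h3, h4, h2]
  ext α
  simp [conjSpinor_apply, Matrix.ofLp_toEuclideanCLM, Matrix.mulVec, dotProduct, hB]

theorem conj_liftMatrix {A : Matrix (Fin 2) (Fin 2) ℂ} (hA : ∀ i j, conj (A i j) = A i j)
    (n : Fin N) (α β : Spins N) : conj (liftMatrix A n α β) = liftMatrix A n α β := by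
  simp only [liftMatrix, Matrix.of_apply, map_mul, hA, map_prod]
  congr 1
  refine Finset.prod_congr rfl fun k _ => ?_
  split_ifs <;> simp

theorem sigmaX_conjHilb (n : Fin N) (ψ : Hilb M N) :
    sigmaX M n (conjHilb M N ψ) = conjHilb M N (sigmaX M n ψ) :=
  spinOp_conjHilb (conj_liftMatrix (fun i j => by fin_cases i <;> fin_cases j <;> simp [pauliX]) n) ψ

theorem sigmaZ_conjHilb (n : Fin N) (ψ : Hilb M N) :
    sigmaZ M n (conjHilb M N ψ) = conjHilb M N (sigmaZ M n ψ) :=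
  spinOp_conjHilb (conj_liftMatrix (fun i j => by fin_cases i <;> fin_cases j <;> simp [pauliZ]) n) ψ

/-- A form that commutes with complex conjugation. -/
def Form.IsReal (a : Form M N) : Prop :=
  ∀ ψ, a (conjForm ψ) (conjForm ψ) = conj (a ψ ψ)

theorem isReal_pairing {A B : formDomain M N →ₗ[ℂ] Hilb M N}
    (hA : ∀ ψ, A (conjForm ψ) = conjHilb M N (A ψ))
    (hB : ∀ ψ, B (conjForm ψ) = conjHilb M N (B ψ)) : (pairing A B).IsReal := fun ψ => by
  change ⟪A (conjForm ψ), B (conjForm ψ)⟫_ℂ = conj ⟪A ψ, B ψ⟫_ℂ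
  rw [hA, hB, inner_conjHilb]

theorem Form.IsReal.add {a b : Form M N} (ha : a.IsReal) (hb : b.IsReal) :
    Form.IsReal (a + b) := fun ψ => by
  simp only [LinearMap.add_apply, ha ψ, hb ψ, map_add]

theorem Form.IsReal.sub {a b : Form M N} (ha : a.IsReal) (hb : b.IsReal) :
    Form.IsReal (a - b) := fun ψ => by
  simp only [LinearMap.sub_apply, ha ψ, hb ψ, map_sub]

theorem Form.IsReal.smul {a : Form M N} (ha : a.IsReal) (r : ℝ) :
    Form.IsReal ((r : ℂ) • a) := fun ψ => by
  simp only [LinearMap.smul_apply, ha ψ, smul_eq_mul, map_mul, Complex.conj_ofReal]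

theorem isReal_sum {ι : Type*} (s : Finset ι) {a : ι → Form M N}
    (ha : ∀ i ∈ s, (a i).IsReal) : Form.IsReal (∑ i ∈ s, a i) := fun ψ => by
  simp only [LinearMap.sum_apply, map_sum]
  exact Finset.sum_congr rfl fun i hi => ha i hi ψ

theorem isReal_boundedForm {B : Hilb M N →L[ℂ] Hilb M N}
    (hB : ∀ ψ, B (conjHilb M N ψ) = conjHilb M N (B ψ)) : (boundedForm B).IsReal :=
  isReal_pairing (fun _ => rfl) fun ψ => hB ψ

theorem isReal_positionForm (m : Fin M) : (positionForm M N m).IsReal :=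
  isReal_pairing (fun _ => rfl) (position_conjForm m)

theorem isReal_couplingForm (Λ : Matrix (Fin M) (Fin N) ℝ) : (couplingForm Λ).IsReal :=
  isReal_sum _ fun m _ => isReal_sum _ fun n _ => Form.IsReal.smul
    (isReal_pairing (fun _ => rfl) fun ψ => by
      change sigmaZ M n (position M N m (conjForm ψ)) = _
      rw [position_conjForm, sigmaZ_conjHilb]
      rfl) _

theorem isReal_hamiltonianForm (Λ : Matrix (Fin M) (Fin N) ℝ) (t : Fin N → ℝ) :
    (hamiltonianForm Λ t).IsReal :=
  ((Form.IsReal.add (isReal_sum _ fun m _ => isReal_pairing (partialD_conjForm m)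
      (partialD_conjForm m))
    (isReal_sum _ fun m _ => isReal_pairing (position_conjForm m) (position_conjForm m))).add
    (isReal_couplingForm Λ)).sub
    (isReal_sum _ fun n _ => (isReal_boundedForm (sigmaX_conjHilb n)).smul _)

/-- The real part of a wave function. -/
def rePart (ψ : formDomain M N) : formDomain M N := (1 / 2 : ℂ) • (ψ + conjForm ψ)

/-- The imaginary part of a wave function. -/
def imPart (ψ : formDomain M N) : formDomain M N := (-Complex.I / 2) • (ψ - conjForm ψ)

theorem conjHilb_rePart (ψ : formDomain M N) : conjHilb M N (rePart ψ) = rePart ψ := by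
  simp only [rePart, Submodule.coe_smul, Submodule.coe_add, map_smulₛₗ, map_add, coe_conjForm,
    conjHilb_conjHilb]
  rw [add_comm]
  simp [Complex.conj_ofNat]

theorem conjHilb_imPart (ψ : formDomain M N) : conjHilb M N (imPart ψ) = imPart ψ := by
  simp only [imPart, Submodule.coe_smul, Submodule.coe_sub, map_smulₛₗ, map_sub, coe_conjForm,
    conjHilb_conjHilb]
  rw [← neg_sub, smul_neg, ← neg_smul]
  congr 1
  simp [Complex.conj_ofNat]
  ring

/-- The cross terms between `ψ` and its conjugate cancel, leaving the mean of `a ψ ψ` and its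
complex conjugate. Taking `a` to be the form of the identity shows that the normalization is kept
too. -/
theorem Form.IsReal.rePart_add_imPart {a : Form M N} (ha : a.IsReal) (ψ : formDomain M N) :
    a (rePart ψ) (rePart ψ) + a (imPart ψ) (imPart ψ) = ((a ψ ψ).re : ℂ) := by
  have h1 : a (rePart ψ) (rePart ψ) + a (imPart ψ) (imPart ψ)
      = 1 / 2 * (a ψ ψ + a (conjForm ψ) (conjForm ψ)) := by
    have hI := Complex.I_mul_I
    simp only [rePart, imPart, map_smulₛₗ, LinearMap.smul_apply, map_add, map_sub,
      LinearMap.add_apply, LinearMap.sub_apply, smul_eq_mul, RingHom.id_apply, map_div₀, map_neg,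
      Complex.conj_I, map_one, map_ofNat, neg_neg]
    linear_combination (-(1 / 4) * (a ψ ψ + a (conjForm ψ) (conjForm ψ) - a ψ (conjForm ψ)
      - a (conjForm ψ) ψ)) * hI
  rw [h1, ha ψ, Complex.add_conj]
  push_cast
  ring

/-! ### Real integral kernels -/

theorem coeFn_finset_sum {ι : Type*} (s : Finset ι) (f : ι → Hilb M N) :
    ((∑ i ∈ s, f i : Hilb M N) : Modes M → Spinor N) =ᵐ[volume] fun x => ∑ i ∈ s, f i x := by
  classical
  induction s using Finset.induction_on with
  | empty =>
    simp only [Finset.sum_empty]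
    exact Lp.coeFn_zero (Spinor N) 2 (volume : Measure (Modes M))
  | insert i s hi ih =>
    rw [Finset.sum_insert hi]
    filter_upwards [Lp.coeFn_add (f i) (∑ i ∈ s, f i), ih] with x h1 h2
    rw [h1, Pi.add_apply, h2, Finset.sum_insert hi]

theorem memLp_spinor_re (ψ : Hilb M N) (α : Spins N) : MemLp (fun x => (ψ x α).re) 2 volume :=
  ((Lp.memLp ψ).eval_piLp α).re

theorem exists_real_kernel {ι : Type*} [Fintype ι] (u : ι → formDomain M N)
    (hu : ∀ i, conjHilb M N (u i) = u i) :
    ∃ K, IsIntegralKernel (ensemble u) K ∧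
      ∀ x x' α β, (starRingEnd ℂ) (K x x' α β) = K x x' α β := by
  have hre (i : ι) : ∀ᵐ x, ∀ α, (u i : Hilb M N) x α = (((u i : Hilb M N) x α).re : ℂ) := by
    have h := coeFn_conjHilb (u i : Hilb M N)
    rw [hu i] at h
    filter_upwards [h] with x hx α
    have h1 : conj ((u i : Hilb M N) x α) = (u i : Hilb M N) x α := by
      conv_rhs => rw [hx]
      rfl
    exact (Complex.conj_eq_iff_re.1 h1).symm
  -- The components are real only almost everywhere; using their real parts makes the kernel real at
  -- every point without changing the operator.
  refine ⟨fun x x' => Matrix.of fun α β =>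
    ((∑ i, ((u i : Hilb M N) x α).re * ((u i : Hilb M N) x' β).re : ℝ) : ℂ),
    ⟨fun α β => ?_, fun φ => ?_⟩, fun x x' α β => Complex.conj_ofReal _⟩
  · simp only [Matrix.of_apply]
    refine MemLp.ofReal (K := ℂ) ?_
    refine memLp_finsetSum _ fun i _ => ?_
    have h1 := memLp_spinor_re (u i : Hilb M N) α
    have h2 := memLp_spinor_re (u i : Hilb M N) β
    have hm : AEStronglyMeasurable (fun p : Modes M × Modes M =>
        ((u i : Hilb M N) p.1 α).re * ((u i : Hilb M N) p.2 β).re)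
        (volume : Measure (Modes M × Modes M)) :=
      (h1.aestronglyMeasurable.comp_fst).mul (h2.aestronglyMeasurable.comp_snd)
    rw [memLp_two_iff_integrable_sq hm]
    have := ((memLp_two_iff_integrable_sq h1.aestronglyMeasurable).1 h1).mul_prod
      ((memLp_two_iff_integrable_sq h2.aestronglyMeasurable).1 h2)
    simp_rw [mul_pow]
    exact this
  · have hΓ : ensemble u φ = ∑ i, ⟪(u i : Hilb M N), φ⟫_ℂ • (u i : Hilb M N) := ensemble_apply u φ
    have hin (i : ι) : ⟪(u i : Hilb M N), φ⟫_ℂ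
        = ∫ x', ∑ β, (((u i : Hilb M N) x' β).re : ℂ) * φ x' β := by
      rw [L2.inner_def]
      apply integral_congr_ae
      filter_upwards [hre i] with x hx
      rw [PiLp.inner_apply]
      refine Finset.sum_congr rfl fun β _ => ?_
      rw [hx β, RCLike.inner_apply, Complex.ofReal_re]
      simp [mul_comm]
    have hint (i : ι) : Integrable fun x' => ∑ β, (((u i : Hilb M N) x' β).re : ℂ) * φ x' β := by
      refine (L2.integrable_inner (𝕜 := ℂ) (u i : Hilb M N) φ).congr ?_
      filter_upwards [hre i] with x hx
      rw [PiLp.inner_apply]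
      refine Finset.sum_congr rfl fun β _ => ?_
      rw [hx β, RCLike.inner_apply, Complex.ofReal_re]
      simp [mul_comm]
    have hsm := coeFn_finset_sum Finset.univ
      fun i => ⟪(u i : Hilb M N), φ⟫_ℂ • (u i : Hilb M N)
    rw [← hΓ] at hsm
    filter_upwards [hsm, Filter.eventually_all.2 hre, Filter.eventually_all.2 fun i =>
      Lp.coeFn_smul ⟪(u i : Hilb M N), φ⟫_ℂ (u i : Hilb M N)] with x h1 h2 h3 α
    have e1 : ensemble u φ x α
        = ∑ i, (((u i : Hilb M N) x α).re : ℂ) * ⟪(u i : Hilb M N), φ⟫_ℂ := by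
      rw [h1, WithLp.ofLp_sum, Finset.sum_apply]
      refine Finset.sum_congr rfl fun i _ => ?_
      rw [h3 i, Pi.smul_apply, PiLp.smul_apply, smul_eq_mul, mul_comm, ← h2 i α]
    rw [e1]
    simp_rw [hin, ← integral_const_mul]
    rw [← integral_finsetSum _ fun i _ => (hint i).const_mul _]
    refine integral_congr_ae (.of_forall fun x' => ?_)
    simp only [Matrix.of_apply, Finset.mul_sum]
    rw [Finset.sum_comm]
    refine Finset.sum_congr rfl fun β _ => ?_
    push_cast
    rw [Finset.sum_mul]
    exact Finset.sum_congr rfl fun i _ => by ring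

end

section

variable {M N : ℕ}

/-! ### Canonical transformations -/

/-- `U` commutes with spin operators and transforms momenta and positions affinely:
`-i∂_m ↦ α (-i∂_m) + b_m` and `x_m ↦ γ x_m + δ_m`. -/
structure IsCanonical (U : Hilb M N ≃ₗᵢ[ℂ] Hilb M N) (α γ : ℝ) (b δ : Fin M → ℝ) : Prop where
  weakPartial : ∀ {m : Fin M} {ψ g : Hilb M N}, HasWeakPartial m ψ g →
    HasWeakPartial m (U ψ) (U ((α : ℂ) • g + ((b m : ℂ) * Complex.I) • ψ))
  position : ∀ {m : Fin M} {ψ g : Hilb M N}, HasPosition m ψ g →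
    HasPosition m (U ψ) (U ((γ : ℂ) • g + (δ m : ℂ) • ψ))
  spinOp : ∀ (B : Matrix (Spins N) (Spins N) ℂ) (ψ : Hilb M N),
    spinOp M B (U ψ) = U (spinOp M B ψ)

/-- The conjugation `U Γ U⁻¹`. -/
def conjBy (U : Hilb M N ≃ₗᵢ[ℂ] Hilb M N) (Γ : Hilb M N →L[ℂ] Hilb M N) :
    Hilb M N →L[ℂ] Hilb M N :=
  (U : Hilb M N →L[ℂ] Hilb M N) ∘L Γ ∘L (U.symm : Hilb M N →L[ℂ] Hilb M N)

theorem kineticForm_apply (ψ : formDomain M N) :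
    kineticForm M N ψ ψ = ∑ m, ⟪partialD M N m ψ, partialD M N m ψ⟫_ℂ := by
  simp only [kineticForm, LinearMap.sum_apply]
  rfl

theorem squareForm_apply (ψ : formDomain M N) :
    squareForm M N ψ ψ = ∑ m, ⟪position M N m ψ, position M N m ψ⟫_ℂ := by
  simp only [squareForm, LinearMap.sum_apply]
  rfl

theorem positionForm_apply (m : Fin M) (ψ : formDomain M N) :
    positionForm M N m ψ ψ = ⟪(ψ : Hilb M N), position M N m ψ⟫_ℂ := rfl

theorem momentumForm_apply (m : Fin M) (ψ : formDomain M N) :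
    momentumForm M N m ψ ψ = -Complex.I * ⟪(ψ : Hilb M N), partialD M N m ψ⟫_ℂ := by
  change ⟪(ψ : Hilb M N), (-Complex.I) • partialD M N m ψ⟫_ℂ = _
  rw [inner_smul_right]

theorem boundedForm_apply (B : Hilb M N →L[ℂ] Hilb M N) (ψ : formDomain M N) :
    boundedForm B ψ ψ = ⟪(ψ : Hilb M N), B ψ⟫_ℂ := rfl

theorem couplingForm_apply (Λ : Matrix (Fin M) (Fin N) ℝ) (ψ : formDomain M N) :
    couplingForm Λ ψ ψ
      = ∑ m, ∑ n, (Λ m n : ℂ) * ⟪(ψ : Hilb M N), sigmaZ M n (position M N m ψ)⟫_ℂ := by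
  simp only [couplingForm, LinearMap.sum_apply, LinearMap.smul_apply, smul_eq_mul]
  rfl

theorem hamiltonianForm_apply (Λ : Matrix (Fin M) (Fin N) ℝ) (t : Fin N → ℝ)
    (ψ : formDomain M N) :
    hamiltonianForm Λ t ψ ψ = kineticForm M N ψ ψ + squareForm M N ψ ψ + couplingForm Λ ψ ψ
      - ∑ n, (t n : ℂ) * boundedForm (sigmaX M n) ψ ψ := by
  simp only [hamiltonianForm, LinearMap.sub_apply, LinearMap.add_apply, LinearMap.sum_apply,
    LinearMap.smul_apply, smul_eq_mul]

theorem inner_position_comm {m : Fin M} {ψ g : Hilb M N} (h : HasPosition m ψ g) :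
    ⟪g, ψ⟫_ℂ = ⟪ψ, g⟫_ℂ := by
  rw [L2.inner_def, L2.inner_def]
  apply integral_congr_ae
  filter_upwards [h] with x hx
  rw [hx, inner_smul_left, inner_smul_right, Complex.conj_ofReal]

/-- Integration by parts makes `⟪ψ, ∂ψ⟫` purely imaginary, so conjugation changes its sign. -/
theorem inner_partial_comm {m : Fin M} {ψ g : Hilb M N} (h : HasWeakPartial m ψ g) :
    ⟪g, ψ⟫_ℂ = - ⟪ψ, g⟫_ℂ := by
  rw [← inner_conj_symm g ψ]
  have := h.hasWeakDirDeriv.re_inner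
  exact Complex.ext (by rw [Complex.conj_re, Complex.neg_re, this, neg_zero])
    (by rw [Complex.conj_im, Complex.neg_im])

namespace IsCanonical

variable {U : Hilb M N ≃ₗᵢ[ℂ] Hilb M N} {α γ : ℝ} {b δ : Fin M → ℝ}

/-- The action of a canonical transformation on the form domain. -/
def onForm (h : IsCanonical U α γ b δ) (ψ : formDomain M N) : formDomain M N :=
  ⟨U ψ, fun m => ⟨⟨_, h.weakPartial (partialD_spec m ψ)⟩, _, h.position (position_spec m ψ)⟩⟩

theorem partialD_onForm (h : IsCanonical U α γ b δ) (m : Fin M) (ψ : formDomain M N) :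
    partialD M N m (h.onForm ψ)
      = U ((α : ℂ) • partialD M N m ψ + ((b m : ℂ) * Complex.I) • (ψ : Hilb M N)) :=
  (partialD_spec m _).unique (h.weakPartial (partialD_spec m ψ))

theorem position_onForm (h : IsCanonical U α γ b δ) (m : Fin M) (ψ : formDomain M N) :
    MultiModeDicke.position M N m (h.onForm ψ)
      = U ((γ : ℂ) • MultiModeDicke.position M N m ψ + (δ m : ℂ) • (ψ : Hilb M N)) :=
  (position_spec m _).unique (h.position (position_spec m ψ))

theorem norm_smul_add_sq_le (z w : ℂ) (φ χ : Hilb M N) :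
    ‖z • φ + w • χ‖ ^ 2 ≤ 2 * ‖z‖ ^ 2 * ‖φ‖ ^ 2 + 2 * ‖w‖ ^ 2 * ‖χ‖ ^ 2 := by
  have h1 := norm_add_le (z • φ) (w • χ)
  rw [norm_smul, norm_smul] at h1
  nlinarith [sq_nonneg (‖z‖ * ‖φ‖ - ‖w‖ * ‖χ‖), norm_nonneg (z • φ + w • χ)]

/-- The value of the constant is irrelevant: some bound by the form norm is needed so that the
conjugated state still has finite energy. -/
theorem gradPosSq_onForm_le (h : IsCanonical U α γ b δ) (ψ : formDomain M N) :
    gradPosSq (h.onForm ψ) ≤ (2 * (α ^ 2 + γ ^ 2) + ∑ m, 2 * (b m ^ 2 + δ m ^ 2))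
      * (‖(ψ : Hilb M N)‖ ^ 2 + gradPosSq ψ) := by
  have h1 : gradPosSq (h.onForm ψ) ≤ ∑ m, (2 * (α ^ 2 + γ ^ 2)
      * (‖partialD M N m ψ‖ ^ 2 + ‖MultiModeDicke.position M N m ψ‖ ^ 2)
      + 2 * (b m ^ 2 + δ m ^ 2) * ‖(ψ : Hilb M N)‖ ^ 2) := by
    refine Finset.sum_le_sum fun m _ => ?_
    rw [h.partialD_onForm, h.position_onForm, U.norm_map, U.norm_map]
    have h2 := norm_smul_add_sq_le (α : ℂ) ((b m : ℂ) * Complex.I) (partialD M N m ψ) ψ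
    have h3 := norm_smul_add_sq_le (γ : ℂ) (δ m : ℂ) (MultiModeDicke.position M N m ψ) ψ
    rw [norm_mul, Complex.norm_I, mul_one] at h2
    simp only [Complex.norm_real, Real.norm_eq_abs, sq_abs] at h2 h3
    nlinarith [mul_nonneg (sq_nonneg α) (sq_nonneg ‖MultiModeDicke.position M N m ψ‖),
      mul_nonneg (sq_nonneg γ) (sq_nonneg ‖partialD M N m ψ‖)]
  refine h1.trans ?_
  rw [Finset.sum_add_distrib, ← Finset.mul_sum, ← Finset.sum_mul]
  have h2 : 0 ≤ ∑ m, 2 * (b m ^ 2 + δ m ^ 2) := Finset.sum_nonneg fun _ _ => by positivity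
  have h3 := gradPosSq_nonneg ψ
  change 2 * (α ^ 2 + γ ^ 2) * gradPosSq ψ + _ ≤ _
  nlinarith [mul_nonneg h2 h3, mul_nonneg (add_nonneg (sq_nonneg α) (sq_nonneg γ))
    (sq_nonneg ‖(ψ : Hilb M N)‖)]

theorem conjBy_mem (h : IsCanonical U α γ b δ) {Γ : Hilb M N →L[ℂ] Hilb M N}
    (hΓ : Γ ∈ densityMatrices M N) : conjBy U Γ ∈ densityMatrices M N :=
  (trace_conj hΓ U (V := h.onForm) (fun _ => rfl) h.gradPosSq_onForm_le).1

theorem trace_conjBy (h : IsCanonical U α γ b δ) {Γ : Hilb M N →L[ℂ] Hilb M N}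
    (hΓ : Γ ∈ densityMatrices M N) {a a' : Form M N} (ha : a.IsBounded) (ha' : a'.IsBounded)
    (haa' : ∀ ψ, a (h.onForm ψ) (h.onForm ψ) = a' ψ ψ) : trace a (conjBy U Γ) = trace a' Γ :=
  (trace_conj hΓ U (V := h.onForm) (fun _ => rfl) h.gradPosSq_onForm_le).2 a a' ha ha' haa'

theorem spin_onForm (h : IsCanonical U α γ b δ) (B : Matrix (Spins N) (Spins N) ℂ)
    (ψ : formDomain M N) : boundedForm (MultiModeDicke.spinOp M B) (h.onForm ψ) (h.onForm ψ)
      = boundedForm (MultiModeDicke.spinOp M B) ψ ψ := by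
  rw [boundedForm_apply, boundedForm_apply]
  change ⟪U ψ, MultiModeDicke.spinOp M B (U ψ)⟫_ℂ = _
  rw [h.spinOp, U.inner_map_map]

theorem trace_spin (h : IsCanonical U α γ b δ) {Γ : Hilb M N →L[ℂ] Hilb M N}
    (hΓ : Γ ∈ densityMatrices M N) (B : Matrix (Spins N) (Spins N) ℂ) :
    trace (boundedForm (MultiModeDicke.spinOp M B)) (conjBy U Γ)
      = trace (boundedForm (MultiModeDicke.spinOp M B)) Γ :=
  h.trace_conjBy hΓ (isBounded_boundedForm _) (isBounded_boundedForm _) (h.spin_onForm B)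

theorem trace_positionForm (h : IsCanonical U α γ b δ) {Γ : Hilb M N →L[ℂ] Hilb M N}
    (hΓ : Γ ∈ densityMatrices M N) (m : Fin M) :
    trace (positionForm M N m) (conjBy U Γ) = γ * trace (positionForm M N m) Γ + δ m := by
  have hb := (isBounded_positionForm M N m).smul (γ : ℂ)
  have h1 := (isBounded_boundedForm (1 : Hilb M N →L[ℂ] Hilb M N)).smul (δ m : ℂ)
  rw [h.trace_conjBy hΓ (isBounded_positionForm M N m) (hb.add h1) fun ψ => ?_, trace_add hb h1 hΓ,
    trace_smul _ (isBounded_positionForm M N m) hΓ, trace_smul _ (isBounded_boundedForm _) hΓ,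
    trace_one hΓ, mul_one]
  rw [positionForm_apply, h.position_onForm]
  change ⟪U ψ, _⟫_ℂ = _
  rw [U.inner_map_map, inner_add_right, inner_smul_right, inner_smul_right]
  rfl

/-- After dropping the isometry `U`, the square `‖α ∂ψ + i b ψ‖²` is expanded; antisymmetry of `∂`
makes the two cross terms equal, and together they form the momentum term. -/
theorem kineticForm_onForm (h : IsCanonical U α γ b δ) (ψ : formDomain M N) :
    kineticForm M N (h.onForm ψ) (h.onForm ψ) = (α : ℂ) ^ 2 * kineticForm M N ψ ψ
      + ∑ m, (2 * α * b m : ℂ) * momentumForm M N m ψ ψ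
      + (∑ m, (b m : ℂ) ^ 2) * boundedForm 1 ψ ψ := by
  rw [kineticForm_apply, kineticForm_apply, Finset.mul_sum, Finset.sum_mul,
    ← Finset.sum_add_distrib, ← Finset.sum_add_distrib]
  refine Finset.sum_congr rfl fun m _ => ?_
  rw [h.partialD_onForm, U.inner_map_map, momentumForm_apply, boundedForm_apply]
  simp only [inner_add_left, inner_add_right, inner_smul_left, inner_smul_right, map_mul,
    Complex.conj_ofReal, Complex.conj_I, inner_partial_comm (partialD_spec m ψ),
    one_apply_eq_self]
  linear_combination (-(b m : ℂ) ^ 2 * ⟪(ψ : Hilb M N), ψ⟫_ℂ) * Complex.I_mul_I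

theorem squareForm_onForm (h : IsCanonical U α γ b δ) (ψ : formDomain M N) :
    squareForm M N (h.onForm ψ) (h.onForm ψ) = (γ : ℂ) ^ 2 * squareForm M N ψ ψ
      + ∑ m, (2 * γ * δ m : ℂ) * positionForm M N m ψ ψ
      + (∑ m, (δ m : ℂ) ^ 2) * boundedForm 1 ψ ψ := by
  rw [squareForm_apply, squareForm_apply, Finset.mul_sum, Finset.sum_mul,
    ← Finset.sum_add_distrib, ← Finset.sum_add_distrib]
  refine Finset.sum_congr rfl fun m _ => ?_
  rw [h.position_onForm, U.inner_map_map, positionForm_apply, boundedForm_apply]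
  simp only [inner_add_left, inner_add_right, inner_smul_left, inner_smul_right,
    Complex.conj_ofReal, inner_position_comm (position_spec m ψ), one_apply_eq_self]
  ring

theorem couplingForm_onForm (h : IsCanonical U α γ b δ) (Λ : Matrix (Fin M) (Fin N) ℝ)
    (ψ : formDomain M N) :
    couplingForm Λ (h.onForm ψ) (h.onForm ψ) = γ * couplingForm Λ ψ ψ
      + ∑ m, ∑ n, (Λ m n * δ m : ℂ) * boundedForm (sigmaZ M n) ψ ψ := by
  rw [couplingForm_apply, couplingForm_apply, Finset.mul_sum, ← Finset.sum_add_distrib]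
  refine Finset.sum_congr rfl fun m _ => ?_
  rw [Finset.mul_sum, ← Finset.sum_add_distrib]
  refine Finset.sum_congr rfl fun n _ => ?_
  rw [h.position_onForm, boundedForm_apply, sigmaZ, h.spinOp]
  change _ * ⟪U ψ, _⟫_ℂ = _
  rw [U.inner_map_map, map_add, map_smul, map_smul, inner_add_right, inner_smul_right,
    inner_smul_right]
  ring

end IsCanonical

theorem trace_hamiltonianForm (Λ : Matrix (Fin M) (Fin N) ℝ) (t : Fin N → ℝ)
    {Γ : Hilb M N →L[ℂ] Hilb M N} (hΓ : Γ ∈ densityMatrices M N) :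
    trace (hamiltonianForm Λ t) Γ = trace (kineticForm M N) Γ + trace (squareForm M N) Γ
      + trace (couplingForm Λ) Γ - ∑ n, (t n : ℂ) * trace (boundedForm (sigmaX M n)) Γ := by
  have h1 := isBounded_kineticForm M N
  have h2 := isBounded_squareForm M N
  have h3 := isBounded_couplingForm Λ
  have h4 (n : Fin N) := isBounded_boundedForm (sigmaX M n)
  rw [hamiltonianForm, trace_sub ((h1.add h2).add h3) (isBounded_sum _ fun n _ => (h4 n).smul _) hΓ,
    trace_add (h1.add h2) h3 hΓ, trace_add h1 h2 hΓ, trace_sum _ (fun n _ => (h4 n).smul _) hΓ]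
  simp_rw [trace_smul _ (h4 _) hΓ]

/-- The transformation of the energy under a canonical transformation. -/
theorem IsCanonical.trace_hamiltonianForm {U : Hilb M N ≃ₗᵢ[ℂ] Hilb M N} {α γ : ℝ}
    {b δ : Fin M → ℝ} (h : IsCanonical U α γ b δ)
    (Λ : Matrix (Fin M) (Fin N) ℝ) (t : Fin N → ℝ) {Γ : Hilb M N →L[ℂ] Hilb M N}
    (hΓ : Γ ∈ densityMatrices M N) :
    trace (hamiltonianForm Λ t) (conjBy U Γ)
      = (α : ℂ) ^ 2 * trace (kineticForm M N) Γ
        + ∑ m, (2 * α * b m : ℂ) * trace (momentumForm M N m) Γ + ∑ m, (b m : ℂ) ^ 2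
        + ((γ : ℂ) ^ 2 * trace (squareForm M N) Γ
        + ∑ m, (2 * γ * δ m : ℂ) * trace (positionForm M N m) Γ + ∑ m, (δ m : ℂ) ^ 2)
        + (γ * trace (couplingForm Λ) Γ
        + ∑ m, ∑ n, (Λ m n * δ m : ℂ) * trace (boundedForm (sigmaZ M n)) Γ)
        - ∑ n, (t n : ℂ) * trace (boundedForm (sigmaX M n)) Γ := by
  have hk := isBounded_kineticForm M N
  have hs := isBounded_squareForm M N
  have hc := isBounded_couplingForm Λ
  have hp (m : Fin M) := isBounded_momentumForm M N m
  have hx (m : Fin M) := isBounded_positionForm M N m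
  have hz (n : Fin N) := isBounded_boundedForm (sigmaZ M n)
  have h1 := isBounded_boundedForm (1 : Hilb M N →L[ℂ] Hilb M N)
  have hps := isBounded_sum Finset.univ fun m _ => (hp m).smul (2 * α * b m : ℂ)
  have hxs := isBounded_sum Finset.univ fun m _ => (hx m).smul (2 * γ * δ m : ℂ)
  have hzs (m : Fin M) := isBounded_sum Finset.univ fun n _ => (hz n).smul (Λ m n * δ m : ℂ)
  have hzss := isBounded_sum Finset.univ fun m _ => hzs m
  have hkin : trace (kineticForm M N) (conjBy U Γ) = (α : ℂ) ^ 2 * trace (kineticForm M N) Γ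
        + ∑ m, (2 * α * b m : ℂ) * trace (momentumForm M N m) Γ + ∑ m, (b m : ℂ) ^ 2 := by
    rw [h.trace_conjBy hΓ hk (((hk.smul ((α : ℂ) ^ 2)).add hps).add (h1.smul (∑ m, (b m : ℂ) ^ 2)))
      fun ψ => by
        rw [h.kineticForm_onForm]
        simp only [LinearMap.add_apply, LinearMap.smul_apply, LinearMap.sum_apply, smul_eq_mul],
      trace_add ((hk.smul _).add hps) (h1.smul _) hΓ, trace_add (hk.smul _) hps hΓ,
      trace_smul _ hk hΓ, trace_smul _ h1 hΓ, trace_one hΓ, mul_one,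
      trace_sum _ (fun m _ => (hp m).smul _) hΓ]
    simp_rw [trace_smul _ (hp _) hΓ]
  have hsq : trace (squareForm M N) (conjBy U Γ) = (γ : ℂ) ^ 2 * trace (squareForm M N) Γ
        + ∑ m, (2 * γ * δ m : ℂ) * trace (positionForm M N m) Γ + ∑ m, (δ m : ℂ) ^ 2 := by
    rw [h.trace_conjBy hΓ hs (((hs.smul ((γ : ℂ) ^ 2)).add hxs).add (h1.smul (∑ m, (δ m : ℂ) ^ 2)))
      fun ψ => by
        rw [h.squareForm_onForm]
        simp only [LinearMap.add_apply, LinearMap.smul_apply, LinearMap.sum_apply, smul_eq_mul],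
      trace_add ((hs.smul _).add hxs) (h1.smul _) hΓ, trace_add (hs.smul _) hxs hΓ,
      trace_smul _ hs hΓ, trace_smul _ h1 hΓ, trace_one hΓ, mul_one,
      trace_sum _ (fun m _ => (hx m).smul _) hΓ]
    simp_rw [trace_smul _ (hx _) hΓ]
  have hcp : trace (couplingForm Λ) (conjBy U Γ) = γ * trace (couplingForm Λ) Γ
        + ∑ m, ∑ n, (Λ m n * δ m : ℂ) * trace (boundedForm (sigmaZ M n)) Γ := by
    rw [h.trace_conjBy hΓ hc ((hc.smul (γ : ℂ)).add hzss)
      fun ψ => by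
        rw [h.couplingForm_onForm]
        simp only [LinearMap.add_apply, LinearMap.smul_apply, LinearMap.sum_apply, smul_eq_mul],
      trace_add (hc.smul _) hzss hΓ, trace_smul _ hc hΓ, trace_sum _ (fun m _ => hzs m) hΓ]
    simp_rw [trace_sum Finset.univ (fun n _ => (hz n).smul (Λ _ n * δ _ : ℂ)) hΓ,
      trace_smul _ (hz _) hΓ]
  rw [MultiModeDicke.trace_hamiltonianForm Λ t (h.conjBy_mem hΓ), hkin, hsq, hcp]
  congr 1
  exact Finset.sum_congr rfl fun n _ => by rw [sigmaX, h.trace_spin hΓ]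

end

section

variable {M N : ℕ}

/-! ### Translations, dilations and boosts -/

/-- The translation `shift v` as a unitary. -/
def shiftEquiv (v : Modes M) : Hilb M N ≃ₗᵢ[ℂ] Hilb M N :=
  LinearIsometryEquiv.ofSurjective (shift v) fun ψ =>
    ⟨shift (-v) ψ, by rw [shift_add, add_neg_cancel, shift_zero]⟩

theorem shiftEquiv_apply (v : Modes M) (ψ : Hilb M N) : shiftEquiv v ψ = shift v ψ := rfl

/-- The sign: since `U ψ` is `ψ(· + v)`, one has `x_m ψ(x + v) = ((x_m - v_m) ψ)(x + v)`, so the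
centre moves by `-v`. -/
theorem isCanonical_shiftEquiv (v : Modes M) :
    IsCanonical (shiftEquiv v : Hilb M N ≃ₗᵢ[ℂ] Hilb M N) 1 1 0 (fun m => -v m) where
  weakPartial := by
    intro m ψ g h f hf hs
    have hf' : ContDiff ℝ ∞ fun x => f (x - v) := hf.comp (contDiff_id.sub contDiff_const)
    have h1 := h _ hf' (hasCompactSupport_shift hs v)
    have e : ((1 : ℝ) : ℂ) • g + (((0 : Fin M → ℝ) m : ℂ) * Complex.I) • ψ = g := by simp
    rw [e, shiftEquiv_apply, shiftEquiv_apply, integral_smul_shift f v g, ← h1,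
      integral_smul_shift (fun x => fderiv ℝ f x (EuclideanSpace.single m 1))]
    simp_rw [fderiv_comp_sub]
  position := by
    intro m ψ g h
    rw [shiftEquiv_apply, shiftEquiv_apply]
    filter_upwards [coeFn_shift v ψ, coeFn_shift v (((1 : ℝ) : ℂ) • g + ((-v m : ℝ) : ℂ) • ψ),
      (measurePreserving_shift v).quasiMeasurePreserving.ae
        (Lp.coeFn_add (((1 : ℝ) : ℂ) • g) (((-v m : ℝ) : ℂ) • ψ)),
      (measurePreserving_shift v).quasiMeasurePreserving.ae (Lp.coeFn_smul ((1 : ℝ) : ℂ) g),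
      (measurePreserving_shift v).quasiMeasurePreserving.ae (Lp.coeFn_smul ((-v m : ℝ) : ℂ) ψ),
      (measurePreserving_shift v).quasiMeasurePreserving.ae h] with x h1 h2 h3 h4 h5 h6
    rw [h2, h3, Pi.add_apply, h4, h5, Pi.smul_apply, Pi.smul_apply, h6, h1, Complex.ofReal_one,
      one_smul, ← add_smul, PiLp.add_apply]
    congr 1
    push_cast
    ring
  spinOp := by
    intro B ψ
    rw [shiftEquiv_apply, shiftEquiv_apply]
    apply Lp.ext
    filter_upwards [coeFn_spinOp B (shift v ψ), coeFn_shift v ψ, coeFn_shift v (spinOp M B ψ),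
      (measurePreserving_shift v).quasiMeasurePreserving.ae (coeFn_spinOp B ψ)] with x h1 h2 h3 h4
    rw [h1, h2, h3, h4]

/-- Admissible data of the unitary `ψ ↦ e(x) ψ(s x)`. -/
structure IsScaling (e : Modes M → ℂ) (s : ℝ) : Prop where
  pos : 0 < s
  continuous : Continuous e
  norm_sq : ∀ x, ‖e x‖ ^ 2 = s ^ M

theorem quasiMeasurePreserving_smul {s : ℝ} (hs : 0 < s) :
    Measure.QuasiMeasurePreserving (fun x : Modes M => s • x) volume volume :=
  Measure.quasiMeasurePreserving_smul volume hs.ne'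

theorem integral_comp_smul_modes {F : Type*} [NormedAddCommGroup F] [NormedSpace ℝ F] {s : ℝ}
    (hs : 0 < s) (f : Modes M → F) : ∫ x, f (s • x) = (s ^ M)⁻¹ • ∫ x, f x := by
  have := Measure.integral_comp_smul_of_nonneg (volume : Measure (Modes M)) f s (hR := hs.le)
  simpa using this

theorem memLp_comp_smul {s : ℝ} (hs : 0 < s) (ψ : Hilb M N) :
    MemLp (fun x => ψ (s • x)) 2 volume := by
  have h1 : Measure.map (fun x : Modes M => s • x) volume
      = ENNReal.ofReal (abs (s ^ Module.finrank ℝ (Modes M))⁻¹) • volume :=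
    Measure.map_addHaar_smul volume hs.ne'
  have h2 : MemLp ψ 2 (Measure.map (fun x : Modes M => s • x) volume) := by
    rw [h1]
    exact (Lp.memLp ψ).smul_measure (by simp)
  exact (memLp_map_measure_iff h2.1 (by fun_prop)).1 h2

namespace IsScaling

variable {e : Modes M → ℂ} {s : ℝ}

theorem norm_eq (h : IsScaling e s) (x : Modes M) : ‖e x‖ = √(s ^ M) := by
  rw [← h.norm_sq x, Real.sqrt_sq (norm_nonneg _)]

theorem memLp (h : IsScaling e s) (ψ : Hilb M N) :
    MemLp (fun x => e x • ψ (s • x)) 2 volume := by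
  refine (memLp_comp_smul h.pos ψ).of_le_mul (c := √(s ^ M))
    (h.continuous.aestronglyMeasurable.smul (memLp_comp_smul h.pos ψ).1) (.of_forall fun x => ?_)
  rw [norm_smul, h.norm_eq]

/-- The map `ψ ↦ e(x) ψ(s x)`. -/
def toFun (h : IsScaling e s) (ψ : Hilb M N) : Hilb M N := (h.memLp ψ).toLp

theorem coeFn_toFun (h : IsScaling e s) (ψ : Hilb M N) :
    h.toFun ψ =ᵐ[volume] fun x => e x • ψ (s • x) := (h.memLp ψ).coeFn_toLp

/-- The inverse has the same shape, with factor `1 / e(x/s)` and scale `1/s`. This supplies the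
inverse map of the unitary. -/
theorem inv (h : IsScaling e s) : IsScaling (fun x => (e (s⁻¹ • x))⁻¹) s⁻¹ where
  pos := inv_pos.2 h.pos
  continuous := by
    refine Continuous.inv₀ (h.continuous.comp (by fun_prop)) fun x h0 => ?_
    have h1 := h.norm_sq (s⁻¹ • x)
    rw [h0] at h1
    simp only [norm_zero, ne_eq, OfNat.ofNat_ne_zero, not_false_eq_true, zero_pow] at h1
    exact (pow_pos h.pos M).ne h1
  norm_sq x := by rw [norm_inv, inv_pow, h.norm_sq, inv_pow]

theorem ne_zero (h : IsScaling e s) (x : Modes M) : e x ≠ 0 := by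
  rw [← norm_pos_iff, h.norm_eq]
  exact Real.sqrt_pos.2 (pow_pos h.pos M)

/-- `|e|² = s^M` is precisely the Jacobian of `x ↦ s x`. -/
theorem norm_toFun (h : IsScaling e s) (ψ : Hilb M N) : ‖h.toFun ψ‖ = ‖ψ‖ := by
  have key (φ : Hilb M N) : ‖φ‖ ^ 2 = ∫ x, ‖φ x‖ ^ 2 := by
    have h1 := L2.inner_def (𝕜 := ℂ) φ φ
    simp_rw [inner_self_eq_norm_sq_to_K (𝕜 := ℂ)] at h1
    have h2 : (((‖φ‖ ^ 2 : ℝ)) : ℂ) = ((∫ x, ‖φ x‖ ^ 2 : ℝ) : ℂ) := by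
      rw [← integral_complex_ofReal]
      simpa using h1
    exact_mod_cast h2
  have h1 : ‖h.toFun ψ‖ ^ 2 = ‖ψ‖ ^ 2 := by
    rw [key, key]
    have e1 : ∫ x, ‖h.toFun ψ x‖ ^ 2 = ∫ x, s ^ M * ‖ψ (s • x)‖ ^ 2 := by
      apply integral_congr_ae
      filter_upwards [h.coeFn_toFun ψ] with x hx
      rw [hx, norm_smul, mul_pow, h.norm_sq]
    rw [e1, integral_const_mul, integral_comp_smul_modes h.pos (fun x => ‖ψ x‖ ^ 2), smul_eq_mul,
      mul_inv_cancel_left₀ (pow_pos h.pos M).ne']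
  exact (sq_eq_sq₀ (norm_nonneg _) (norm_nonneg _)).1 h1

theorem toFun_inv_toFun (h : IsScaling e s) (ψ : Hilb M N) : h.inv.toFun (h.toFun ψ) = ψ := by
  apply Lp.ext
  filter_upwards [h.inv.coeFn_toFun (h.toFun ψ),
    (quasiMeasurePreserving_smul h.inv.pos).ae (h.coeFn_toFun ψ)] with x h1 h2
  rw [h1, h2, smul_smul, inv_mul_cancel₀ (h.ne_zero _), one_smul, smul_smul,
    mul_inv_cancel₀ h.pos.ne', one_smul]

theorem toFun_toFun_inv (h : IsScaling e s) (ψ : Hilb M N) : h.toFun (h.inv.toFun ψ) = ψ := by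
  apply Lp.ext
  filter_upwards [h.coeFn_toFun (h.inv.toFun ψ),
    (quasiMeasurePreserving_smul h.pos).ae (h.inv.coeFn_toFun ψ)] with x h1 h2
  have e1 : s⁻¹ • s • x = x := by rw [smul_smul, inv_mul_cancel₀ h.pos.ne', one_smul]
  rw [h1, h2, e1, smul_smul, mul_inv_cancel₀ (h.ne_zero _), one_smul]

/-- The unitary `ψ ↦ e(x) ψ(s x)`. -/
def equiv (h : IsScaling e s) : Hilb M N ≃ₗᵢ[ℂ] Hilb M N where
  toFun := h.toFun
  invFun := h.inv.toFun
  left_inv := h.toFun_inv_toFun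
  right_inv := h.toFun_toFun_inv
  map_add' ψ φ := by
    apply Lp.ext
    filter_upwards [h.coeFn_toFun (ψ + φ), h.coeFn_toFun ψ, h.coeFn_toFun φ,
      Lp.coeFn_add (h.toFun ψ) (h.toFun φ),
      (quasiMeasurePreserving_smul h.pos).ae (Lp.coeFn_add ψ φ)] with x h1 h2 h3 h4 h5
    rw [h1, h4, Pi.add_apply, h2, h3, h5, Pi.add_apply, smul_add]
  map_smul' a ψ := by
    apply Lp.ext
    filter_upwards [h.coeFn_toFun (a • ψ), h.coeFn_toFun ψ, Lp.coeFn_smul a (h.toFun ψ),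
      (quasiMeasurePreserving_smul h.pos).ae (Lp.coeFn_smul a ψ)] with x h1 h2 h3 h4
    rw [h1, RingHom.id_apply, h3, Pi.smul_apply, h2, h4, Pi.smul_apply, smul_comm]
  norm_map' := h.norm_toFun

theorem coeFn_equiv (h : IsScaling e s) (ψ : Hilb M N) :
    h.equiv ψ =ᵐ[volume] fun x => e x • ψ (s • x) := h.coeFn_toFun ψ

theorem spinOp_equiv (h : IsScaling e s) (B : Matrix (Spins N) (Spins N) ℂ) (ψ : Hilb M N) :
    spinOp M B (h.equiv ψ) = h.equiv (spinOp M B ψ) := by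
  apply Lp.ext
  filter_upwards [coeFn_spinOp B (h.equiv ψ), h.coeFn_equiv ψ, h.coeFn_equiv (spinOp M B ψ),
    (quasiMeasurePreserving_smul h.pos).ae (coeFn_spinOp B ψ)] with x h1 h2 h3 h4
  rw [h1, h2, h3, h4, map_smul]

theorem position_equiv (h : IsScaling e s) {m : Fin M} {ψ g : Hilb M N} (hg : HasPosition m ψ g) :
    HasPosition m (h.equiv ψ) (h.equiv (((s⁻¹ : ℝ) : ℂ) • g)) := by
  filter_upwards [h.coeFn_equiv ψ, h.coeFn_equiv (((s⁻¹ : ℝ) : ℂ) • g),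
    (quasiMeasurePreserving_smul h.pos).ae hg,
    (quasiMeasurePreserving_smul h.pos).ae (Lp.coeFn_smul ((s⁻¹ : ℝ) : ℂ) g)] with x h1 h2 h3 h4
  rw [h1, h2, h4, Pi.smul_apply, h3, smul_smul, smul_smul, smul_smul, PiLp.smul_apply, smul_eq_mul]
  congr 1
  have hs0 : (s : ℂ) ≠ 0 := by exact_mod_cast h.pos.ne'
  push_cast
  field_simp

theorem integral_smul_equiv (h : IsScaling e s) (f : Modes M → ℂ) (ψ : Hilb M N) :
    ∫ x, f x • h.equiv ψ x
      = (s ^ M)⁻¹ • ∫ x, (f (s⁻¹ • x) * e (s⁻¹ • x)) • ψ x := by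
  rw [← integral_comp_smul_modes h.pos]
  apply integral_congr_ae
  filter_upwards [h.coeFn_equiv ψ] with x hx
  rw [hx, smul_smul, smul_smul, inv_mul_cancel₀ h.pos.ne', one_smul]

/-- The factor has constant logarithmic derivative `i p`: `p = 0` covers dilations and plane waves
cover boosts. Changing variables and absorbing `e` into the test function, the product rule for `F`
produces the extra term `i p ψ`. -/
theorem weakPartial_equiv (h : IsScaling e s) (he : ContDiff ℝ ∞ e) {p : ℝ} {m : Fin M}
    (hd : ∀ x, fderiv ℝ e x (EuclideanSpace.single m 1) = (p : ℂ) * Complex.I * e x)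
    {ψ g : Hilb M N} (hg : HasWeakPartial m ψ g) :
    HasWeakPartial m (h.equiv ψ) (h.equiv ((s : ℂ) • g + ((p : ℂ) * Complex.I) • ψ)) := by
  intro f hf hs
  have hsc : ContDiff ℝ ∞ fun x : Modes M => s⁻¹ • x := contDiff_const_smul _
  set F : Modes M → ℂ := fun x => f (s⁻¹ • x) * e (s⁻¹ • x) with hF
  have hFc : ContDiff ℝ ∞ F := (hf.comp hsc).mul (he.comp hsc)
  have hFs : HasCompactSupport F :=
    HasCompactSupport.mul_right (hs.comp_homeomorph
      (Homeomorph.smulOfNeZero s⁻¹ (inv_pos.2 h.pos).ne'))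
  -- Multiplication by `s` cancels the factor `s⁻¹` from the chain rule.
  have hDF (x : Modes M) : (s : ℂ) * fderiv ℝ F x (EuclideanSpace.single m 1)
      = fderiv ℝ f (s⁻¹ • x) (EuclideanSpace.single m 1) * e (s⁻¹ • x)
        + (p : ℂ) * Complex.I * F x := by
    have hd1 : HasFDerivAt (fun x : Modes M => s⁻¹ • x)
        (s⁻¹ • ContinuousLinearMap.id ℝ (Modes M)) x := (hasFDerivAt_id x).const_smul s⁻¹
    have hd2 := ((hf.differentiable (by simp) (s⁻¹ • x)).hasFDerivAt).comp x hd1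
    have hd3 := ((he.differentiable (by simp) (s⁻¹ • x)).hasFDerivAt).comp x hd1
    have hd4 : HasFDerivAt F _ x := hd2.mul hd3
    rw [hd4.fderiv]
    have hs0 : (s : ℂ) ≠ 0 := by exact_mod_cast h.pos.ne'
    simp only [Function.comp_apply, add_apply, smul_apply,
      ContinuousLinearMap.comp_apply, ContinuousLinearMap.id_apply, map_smul, hd, smul_eq_mul,
      Complex.real_smul, hF]
    push_cast
    field_simp
    ring
  rw [h.integral_smul_equiv (fun x => fderiv ℝ f x (EuclideanSpace.single m 1)),
    h.integral_smul_equiv, ← smul_neg]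
  congr 1
  have i1 := integrable_test_smul hFc.continuous hFs ψ
  have i2 := integrable_test_smul (continuous_test_deriv hFc (EuclideanSpace.single m 1))
    (hFs.fderiv_apply ℝ _) ψ
  have i3 := integrable_test_smul hFc.continuous hFs g
  have j1 : Integrable fun x => ((p : ℂ) * Complex.I) • F x • ψ x :=
    i1.smul ((p : ℂ) * Complex.I)
  have j2 : Integrable fun x => (s : ℂ) • fderiv ℝ F x (EuclideanSpace.single m 1) • ψ x :=
    i2.smul (s : ℂ)
  have j3 : Integrable fun x => (s : ℂ) • F x • g x := i3.smul (s : ℂ)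
  have e1 : ∫ x, (fderiv ℝ f (s⁻¹ • x) (EuclideanSpace.single m 1) * e (s⁻¹ • x)) • ψ x
      = (s : ℂ) • (∫ x, fderiv ℝ F x (EuclideanSpace.single m 1) • ψ x)
        - ((p : ℂ) * Complex.I) • ∫ x, F x • ψ x := by
    rw [← integral_smul, ← integral_smul, ← integral_sub j2 j1]
    refine integral_congr_ae (.of_forall fun x => ?_)
    simp only
    rw [smul_smul, smul_smul, ← sub_smul, hDF x, add_sub_cancel_right]
  have e2 : ∫ x, F x • ((s : ℂ) • g + ((p : ℂ) * Complex.I) • ψ : Hilb M N) x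
      = (s : ℂ) • (∫ x, F x • g x) + ((p : ℂ) * Complex.I) • ∫ x, F x • ψ x := by
    rw [← integral_smul, ← integral_smul, ← integral_add j3 j1]
    apply integral_congr_ae
    filter_upwards [Lp.coeFn_add ((s : ℂ) • g) (((p : ℂ) * Complex.I) • ψ),
      Lp.coeFn_smul (s : ℂ) g, Lp.coeFn_smul ((p : ℂ) * Complex.I) ψ] with x h1 h2 h3
    rw [h1, Pi.add_apply, h2, h3, Pi.smul_apply, Pi.smul_apply, smul_add, smul_comm (F x) (s : ℂ),
      smul_comm (F x) ((p : ℂ) * Complex.I)]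
  rw [e1, hg F hFc hFs, e2, smul_neg, neg_add, sub_eq_add_neg]

end IsScaling

theorem isScaling_dilation {s : ℝ} (hs : 0 < s) :
    IsScaling (fun _ : Modes M => ((√(s ^ M) : ℝ) : ℂ)) s where
  pos := hs
  continuous := continuous_const
  norm_sq x := by
    rw [Complex.norm_real, Real.norm_eq_abs, sq_abs, Real.sq_sqrt (pow_pos hs M).le]

/-- Dilations `ψ ↦ s^(M/2) ψ(s x)`. -/
theorem isCanonical_dilation {s : ℝ} (hs : 0 < s) :
    IsCanonical ((isScaling_dilation hs).equiv : Hilb M N ≃ₗᵢ[ℂ] Hilb M N) s s⁻¹ 0 0 where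
  weakPartial := by
    intro m ψ g h
    exact (isScaling_dilation hs).weakPartial_equiv contDiff_const (fun x => by simp) h
  position := by
    intro m ψ g h
    have := (isScaling_dilation hs).position_equiv h
    simpa using this
  spinOp := (isScaling_dilation hs).spinOp_equiv

/-- The phase `exp(i p x_m)`. -/
def phase (m : Fin M) (p : ℝ) (x : Modes M) : ℂ := Complex.exp ((p : ℂ) * Complex.I * (x m : ℝ))

theorem contDiff_phase (m : Fin M) (p : ℝ) : ContDiff ℝ ∞ (phase m p) :=
  (contDiff_const.mul (contDiff_coord m)).cexp

theorem fderiv_phase (m k : Fin M) (p : ℝ) (x : Modes M) :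
    fderiv ℝ (phase m p) x (EuclideanSpace.single k 1)
      = (((Pi.single m p : Fin M → ℝ) k : ℝ) : ℂ) * Complex.I * phase m p x := by
  have h1 : HasFDerivAt (fun x : Modes M => ((x m : ℝ) : ℂ))
      (Complex.ofRealCLM.comp (EuclideanSpace.proj (𝕜 := ℝ) m : Modes M →L[ℝ] ℝ)) x :=
    (Complex.ofRealCLM.comp (EuclideanSpace.proj (𝕜 := ℝ) m : Modes M →L[ℝ] ℝ)).hasFDerivAt
  have h2 := (h1.const_mul ((p : ℂ) * Complex.I)).cexp
  have h3 : HasFDerivAt (phase m p) _ x := h2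
  rw [h3.fderiv]
  rcases eq_or_ne k m with rfl | hk
  · simp [phase]
    ring
  · simp [phase, hk.symm]

theorem isScaling_phase (m : Fin M) (p : ℝ) : IsScaling (phase m p) 1 where
  pos := one_pos
  continuous := (contDiff_phase m p).continuous
  norm_sq x := by
    have : (p : ℂ) * Complex.I * (x m : ℝ) = ((p * x m : ℝ) : ℂ) * Complex.I := by
      push_cast
      ring
    rw [phase, this, Complex.norm_exp_ofReal_mul_I, one_pow, one_pow]

/-- Boosts `ψ ↦ exp(i p x_m) ψ`. -/
theorem isCanonical_boost (m : Fin M) (p : ℝ) :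
    IsCanonical ((isScaling_phase m p).equiv : Hilb M N ≃ₗᵢ[ℂ] Hilb M N) 1 1 (Pi.single m p) 0 where
  weakPartial := by
    intro k ψ g h
    exact (isScaling_phase m p).weakPartial_equiv (contDiff_phase m p) (fderiv_phase m k p) h
  position := by
    intro k ψ g h
    have := (isScaling_phase m p).position_equiv h
    simpa using this
  spinOp := (isScaling_phase m p).spinOp_equiv

end

/-! ### Admissible states and the displacement rule -/

section

open Filter Topology

variable {M N : ℕ}

/-! ### Product states -/

theorem memLp_tensor {f : Modes M → ℂ} (hf : Continuous f) (hs : HasCompactSupport f)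
    (v : Spinor N) : MemLp (fun x => f x • v) 2 volume := by
  refine Continuous.memLp_of_hasCompactSupport (by fun_prop) (hs.mono fun x hx => ?_)
  contrapose! hx
  simp only [Function.mem_support, not_not] at hx ⊢
  simp [hx]

/-- The product state `f ⊗ v`. -/
def tensor (f : Modes M → ℂ) (hf : Continuous f) (hs : HasCompactSupport f) (v : Spinor N) :
    Hilb M N := (memLp_tensor hf hs v).toLp

theorem coeFn_tensor {f : Modes M → ℂ} (hf : Continuous f) (hs : HasCompactSupport f)
    (v : Spinor N) : tensor f hf hs v =ᵐ[volume] fun x => f x • v :=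
  (memLp_tensor hf hs v).coeFn_toLp

theorem spinOp_tensor {f : Modes M → ℂ} (hf : Continuous f) (hs : HasCompactSupport f)
    (B : Matrix (Spins N) (Spins N) ℂ) (v : Spinor N) : spinOp M B (tensor f hf hs v)
      = tensor f hf hs (Matrix.toEuclideanCLM (n := Spins N) (𝕜 := ℂ) B v) := by
  apply Lp.ext
  filter_upwards [coeFn_spinOp B (tensor f hf hs v), coeFn_tensor hf hs v,
    coeFn_tensor hf hs (Matrix.toEuclideanCLM (n := Spins N) (𝕜 := ℂ) B v)] with x h1 h2 h3
  rw [h1, h2, h3, map_smul]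

theorem inner_tensor {f : Modes M → ℂ} (hf : Continuous f) (hs : HasCompactSupport f)
    (v w : Spinor N) : ⟪tensor f hf hs v, tensor f hf hs w⟫_ℂ
      = (∫ x, conj (f x) * f x) * ⟪v, w⟫_ℂ := by
  rw [L2.inner_def, ← integral_mul_const]
  apply integral_congr_ae
  filter_upwards [coeFn_tensor hf hs v, coeFn_tensor hf hs w] with x h1 h2
  rw [h1, h2, inner_smul_left, inner_smul_right, mul_assoc]

theorem hasPosition_tensor {f : Modes M → ℂ} (hf : Continuous f) (hs : HasCompactSupport f)
    (v : Spinor N) (m : Fin M) : HasPosition m (tensor f hf hs v)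
      (tensor (fun x => ((x m : ℝ) : ℂ) * f x) ((contDiff_coord m).continuous.mul hf)
        hs.mul_left v) := by
  filter_upwards [coeFn_tensor hf hs v, coeFn_tensor ((contDiff_coord m).continuous.mul hf)
    hs.mul_left v] with x h1 h2
  rw [h1]
  exact h2.trans (by rw [smul_smul]; rfl)

theorem hasWeakPartial_tensor {f : Modes M → ℂ} (hf : ContDiff ℝ ∞ f) (hs : HasCompactSupport f)
    (v : Spinor N) (m : Fin M) : HasWeakPartial m (tensor f hf.continuous hs v)
      (tensor (fun x => fderiv ℝ f x (EuclideanSpace.single m 1)) (continuous_test_deriv hf _)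
        (hs.fderiv_apply ℝ _) v) := by
  intro h hh hhs
  have e1 : ∫ x, fderiv ℝ h x (EuclideanSpace.single m 1) • tensor f hf.continuous hs v x
      = (∫ x, fderiv ℝ h x (EuclideanSpace.single m 1) * f x) • v := by
    rw [← integral_smul_const]
    apply integral_congr_ae
    filter_upwards [coeFn_tensor hf.continuous hs v] with x hx
    rw [hx, smul_smul]
  have e2 : ∫ x, h x • tensor (fun x => fderiv ℝ f x (EuclideanSpace.single m 1))
        (continuous_test_deriv hf _) (hs.fderiv_apply ℝ _) v x
      = (∫ x, h x * fderiv ℝ f x (EuclideanSpace.single m 1)) • v := by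
    rw [← integral_smul_const]
    apply integral_congr_ae
    filter_upwards [coeFn_tensor (continuous_test_deriv hf (EuclideanSpace.single m (1 : ℝ)))
      (hs.fderiv_apply ℝ _) v] with x hx
    rw [hx, smul_smul]
  have hch := continuous_test_deriv hh (EuclideanSpace.single m (1 : ℝ))
  have hcf := continuous_test_deriv hf (EuclideanSpace.single m (1 : ℝ))
  rw [e1, e2, integral_mul_fderiv_eq_neg_fderiv_mul_of_integrable (𝕜 := ℂ) (μ := volume)
    (f := h) (g := f) (v := EuclideanSpace.single m 1)
    ((hch.mul hf.continuous).integrable_of_hasCompactSupport hs.mul_left)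
    ((hh.continuous.mul hcf).integrable_of_hasCompactSupport hhs.mul_right)
    ((hh.continuous.mul hf.continuous).integrable_of_hasCompactSupport hs.mul_left)
    (fun x _ => hh.differentiable (by simp) x) (fun x _ => hf.differentiable (by simp) x), neg_smul,
    neg_neg]

/-- The sign of `σ_z` on the two spin states. -/
def zSign (i : Fin 2) : ℝ := if i = 0 then 1 else -1

theorem liftMatrix_pauliZ (n : Fin N) :
    liftMatrix pauliZ n = Matrix.diagonal fun α : Spins N => (zSign (α n) : ℂ) := by
  ext α β
  rw [Matrix.diagonal_apply]
  simp only [liftMatrix, Matrix.of_apply]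
  split_ifs with h
  · subst h
    have : pauliZ (α n) (α n) = (zSign (α n) : ℂ) := by
      generalize α n = i
      fin_cases i <;> simp [pauliZ, zSign]
    simp [this]
  · obtain ⟨k, hk⟩ := Function.ne_iff.1 h
    rcases eq_or_ne k n with rfl | hkn
    · have : pauliZ (α k) (β k) = 0 := by
        revert hk
        generalize α k = i
        generalize β k = j
        fin_cases i <;> fin_cases j <;> simp [pauliZ]
      rw [this, zero_mul]
    · rw [Finset.prod_eq_zero (Finset.mem_erase.2 ⟨hkn, Finset.mem_univ k⟩) (by simp [hk]),
        mul_zero]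

/-- The probabilities of the two spin states with magnetization `s`. -/
def spinProb (s : ℝ) (i : Fin 2) : ℝ := if i = 0 then (1 + s) / 2 else (1 - s) / 2

/-- The sum is the expansion of `∏ k ((1 + σ k)/2 + (1 - σ k)/2)`, a product of ones. -/
theorem sum_spinProb (σ : Fin N → ℝ) : ∑ α : Spins N, ∏ k, spinProb (σ k) (α k) = 1 := by
  have := Finset.prod_univ_sum (fun _ : Fin N => (Finset.univ : Finset (Fin 2)))
    (fun k i => spinProb (σ k) i)
  rw [Fintype.piFinset_univ] at this
  rw [← this]
  refine Finset.prod_eq_one fun k _ => ?_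
  simp [spinProb]
  ring

/-- The same expansion with the sign inserted in factor `n`, which becomes `(1 + σ n)/2 - (1 - σ
n)/2 = σ n`. -/
theorem sum_zSign_mul_spinProb (σ : Fin N → ℝ) (n : Fin N) :
    ∑ α : Spins N, zSign (α n) * ∏ k, spinProb (σ k) (α k) = σ n := by
  have := Finset.prod_univ_sum (fun _ : Fin N => (Finset.univ : Finset (Fin 2)))
    (fun k i => (if k = n then zSign i else 1) * spinProb (σ k) i)
  rw [Fintype.piFinset_univ] at this
  have e (α : Spins N) : zSign (α n) * ∏ k, spinProb (σ k) (α k)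
      = ∏ k, (if k = n then zSign (α k) else 1) * spinProb (σ k) (α k) := by
    rw [Finset.prod_mul_distrib]
    simp
  simp_rw [e]
  rw [← this, Finset.prod_eq_single n]
  · simp [spinProb, zSign]
    ring
  · intro k _ hk
    simp [hk, spinProb]
    ring
  · simp

/-- The product spin vector with magnetization `σ`. -/
def spinVec (σ : Fin N → ℝ) : Spinor N :=
  WithLp.toLp 2 fun α => ((√(∏ k, spinProb (σ k) (α k)) : ℝ) : ℂ)

theorem spinProb_nonneg {s : ℝ} (hs : s ∈ Set.Icc (-1 : ℝ) 1) (i : Fin 2) : 0 ≤ spinProb s i := by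
  rw [spinProb]
  split_ifs <;> linarith [hs.1, hs.2]

theorem inner_spinVec_diagonal {σ : Fin N → ℝ} (hσ : ∀ n, σ n ∈ Set.Icc (-1 : ℝ) 1)
    (d : Spins N → ℝ) : ⟪spinVec σ, Matrix.toEuclideanCLM (n := Spins N) (𝕜 := ℂ)
      (Matrix.diagonal fun α => (d α : ℂ)) (spinVec σ)⟫_ℂ
      = ((∑ α, d α * ∏ k, spinProb (σ k) (α k) : ℝ) : ℂ) := by
  rw [PiLp.inner_apply, Complex.ofReal_sum]
  refine Finset.sum_congr rfl fun α _ => ?_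
  rw [Matrix.ofLp_toEuclideanCLM, Matrix.mulVec_diagonal, RCLike.inner_apply]
  simp only [spinVec, Complex.conj_ofReal]
  rw [mul_assoc, ← Complex.ofReal_mul, Real.mul_self_sqrt
    (Finset.prod_nonneg fun k _ => spinProb_nonneg (hσ k) _), ← Complex.ofReal_mul]

theorem positionForm_im (m : Fin M) (ψ : formDomain M N) : (positionForm M N m ψ ψ).im = 0 := by
  rw [positionForm_apply]
  have h1 := inner_conj_symm (𝕜 := ℂ) (position M N m ψ) (ψ : Hilb M N)
  rw [inner_position_comm (position_spec m ψ)] at h1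
  exact Complex.conj_eq_iff_im.1 h1

/-- A normalized bump function times the product spinor `spinVec σ`. Its mean position is left
unspecified because translations adjust it afterwards. -/
theorem exists_mem_constraintSet {σ : Fin N → ℝ} (hσ : ∀ n, σ n ∈ Set.Icc (-1 : ℝ) 1) :
    ∃ (ξ : Fin M → ℝ) (Γ : Hilb M N →L[ℂ] Hilb M N), Γ ∈ constraintSet σ ξ := by
  let f₀ : ContDiffBump (0 : Modes M) := ⟨1, 2, by norm_num, by norm_num⟩
  set f : Modes M → ℂ := fun x => (f₀ x : ℂ) with hfdef
  have hf : ContDiff ℝ ∞ f := Complex.ofRealCLM.contDiff.comp f₀.contDiff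
  have hs : HasCompactSupport f := f₀.hasCompactSupport.comp_left Complex.ofReal_zero
  set I : ℝ := ∫ x, f₀ x ^ 2 with hI
  have hIf : ∫ x, conj (f x) * f x = (I : ℂ) := by
    rw [hI, ← integral_complex_ofReal]
    refine integral_congr_ae (.of_forall fun x => ?_)
    simp only [hfdef, Complex.conj_ofReal]
    push_cast
    ring
  have hIpos : 0 < I := by
    refine (f₀.continuous.pow 2).integral_pos_of_hasCompactSupport_nonneg_nonzero (x := 0)
      (f₀.hasCompactSupport.comp_left (g := fun r : ℝ => r ^ 2) (by norm_num))
      (fun x => sq_nonneg _) ?_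
    have : f₀ 0 = 1 := f₀.one_of_mem_closedBall (by simp [f₀])
    simp [this]
  set v := spinVec σ with hv
  have hinner (n : Fin N) : ⟪tensor f hf.continuous hs v,
      sigmaZ M n (tensor f hf.continuous hs v)⟫_ℂ = ((I * σ n : ℝ) : ℂ) := by
    rw [sigmaZ, spinOp_tensor, inner_tensor, hIf, liftMatrix_pauliZ,
      inner_spinVec_diagonal hσ fun α => zSign (α n), sum_zSign_mul_spinProb, Complex.ofReal_mul]
  have hnorm : ‖tensor f hf.continuous hs v‖ ^ 2 = I := by
    have h1 : ⟪v, v⟫_ℂ = 1 := by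
      have h2 := inner_spinVec_diagonal hσ fun _ => 1
      simp only [one_mul, sum_spinProb, Complex.ofReal_one, Matrix.diagonal_one, map_one] at h2
      exact h2
    have h3 := inner_tensor hf.continuous hs v v
    rw [h1, mul_one, hIf, inner_self_eq_ofReal] at h3
    exact_mod_cast h3
  let Ψ : formDomain M N := ⟨tensor f hf.continuous hs v, fun m =>
    ⟨⟨_, hasWeakPartial_tensor hf hs v m⟩, _, hasPosition_tensor hf.continuous hs v m⟩⟩
  let u : Unit → formDomain M N := fun _ => (((√I)⁻¹ : ℝ) : ℂ) • Ψ
  have hu : ∑ i, ‖(u i : Hilb M N)‖ ^ 2 = 1 := by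
    have : ‖(((√I)⁻¹ : ℝ) : ℂ) • tensor f hf.continuous hs v‖ ^ 2 = 1 := by
      rw [norm_smul, mul_pow, hnorm, Complex.norm_real, Real.norm_eq_abs, sq_abs, inv_pow,
        Real.sq_sqrt hIpos.le, inv_mul_cancel₀ hIpos.ne']
    simpa [u, Ψ] using this
  obtain ⟨hmem, htr⟩ := ensemble_mem_and_trace u hu
  refine ⟨fun m => (positionForm M N m (u ()) (u ())).re, ensemble u, hmem, fun n => ?_,
    fun m => ?_⟩
  · rw [htr _ (isBounded_boundedForm _), Finset.univ_unique, Finset.sum_singleton]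
    change ⟪(((√I)⁻¹ : ℝ) : ℂ) • tensor f hf.continuous hs v,
      sigmaZ M n ((((√I)⁻¹ : ℝ) : ℂ) • tensor f hf.continuous hs v)⟫_ℂ = _
    rw [map_smul, inner_smul_left, inner_smul_right, hinner, Complex.conj_ofReal,
      ← Complex.ofReal_mul, ← Complex.ofReal_mul]
    congr 1
    have h1 : (√I)⁻¹ * (√I)⁻¹ * I = 1 := by
      rw [← mul_inv, Real.mul_self_sqrt hIpos.le, inv_mul_cancel₀ hIpos.ne']
    linear_combination σ n * h1
  · rw [htr _ (isBounded_positionForm M N m), Finset.univ_unique, Finset.sum_singleton]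
    exact Complex.ext rfl (positionForm_im m _)

/-! ### The displacement rule -/

theorem constraintSet_shift {σ : Fin N → ℝ} {ξ : Fin M → ℝ} (ζ : Fin M → ℝ)
    {Γ : Hilb M N →L[ℂ] Hilb M N} (hΓ : Γ ∈ constraintSet σ ξ) :
    conjBy (shiftEquiv (WithLp.toLp 2 (-ζ))) Γ ∈ constraintSet σ (ξ + ζ) := by
  obtain ⟨hD, hz, hx⟩ := hΓ
  have h := isCanonical_shiftEquiv (N := N) (WithLp.toLp 2 (-ζ) : Modes M)
  refine ⟨h.conjBy_mem hD, fun n => ?_, fun m => ?_⟩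
  · rw [sigmaZ, h.trace_spin hD, ← sigmaZ, hz]
  · rw [h.trace_positionForm hD, hx]
    simp

theorem energy_shift (Λ : Matrix (Fin M) (Fin N) ℝ) (t : Fin N → ℝ) {σ : Fin N → ℝ}
    {ξ : Fin M → ℝ} (ζ : Fin M → ℝ) {Γ : Hilb M N →L[ℂ] Hilb M N} (hΓ : Γ ∈ constraintSet σ ξ) :
    energy Λ t (conjBy (shiftEquiv (WithLp.toLp 2 (-ζ))) Γ)
      = energy Λ t Γ + (2 * (ζ ⬝ᵥ ξ) + ζ ⬝ᵥ (Λ *ᵥ σ) + ζ ⬝ᵥ ζ) := by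
  obtain ⟨hD, hz, hx⟩ := hΓ
  have h := isCanonical_shiftEquiv (N := N) (WithLp.toLp 2 (-ζ) : Modes M)
  have key : trace (hamiltonianForm Λ t) (conjBy (shiftEquiv (WithLp.toLp 2 (-ζ))) Γ)
      = trace (hamiltonianForm Λ t) Γ
        + ((2 * (ζ ⬝ᵥ ξ) + ζ ⬝ᵥ (Λ *ᵥ σ) + ζ ⬝ᵥ ζ : ℝ) : ℂ) := by
    rw [h.trace_hamiltonianForm Λ t hD, trace_hamiltonianForm Λ t hD]
    simp only [hz, hx, Pi.zero_apply, Pi.neg_apply, neg_neg, dotProduct, Matrix.mulVec,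
      Complex.ofReal_one, Complex.ofReal_zero, mul_zero, zero_mul, Finset.sum_const_zero,
      Complex.ofReal_add, Complex.ofReal_mul, Complex.ofReal_sum, Complex.ofReal_ofNat, one_pow,
      one_mul, mul_one, ne_eq, OfNat.ofNat_ne_zero, not_false_eq_true, zero_pow, add_zero,
      Finset.mul_sum]
    have e1 : ∑ m, ∑ n, (Λ m n : ℂ) * ζ m * σ n = ∑ m, ∑ n, (ζ m : ℂ) * (Λ m n * σ n) :=
      Finset.sum_congr rfl fun m _ => Finset.sum_congr rfl fun n _ => by ring
    have e2 : ∑ m, (ζ m : ℂ) ^ 2 = ∑ m, (ζ m : ℂ) * ζ m :=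
      Finset.sum_congr rfl fun m _ => by ring
    have e3 : ∑ m, 2 * (ζ m : ℂ) * ξ m = ∑ m, 2 * ((ζ m : ℂ) * ξ m) :=
      Finset.sum_congr rfl fun m _ => by ring
    rw [e1, e2, e3]
    ring
  rw [energy, energy, key, Complex.add_re, Complex.ofReal_re]

theorem liebFunctional_shift_le (Λ : Matrix (Fin M) (Fin N) ℝ) (t : Fin N → ℝ) (σ : Fin N → ℝ)
    (ξ ζ : Fin M → ℝ) : liebFunctional Λ t σ (ξ + ζ) ≤ liebFunctional Λ t σ ξ +
      ((2 * (ζ ⬝ᵥ ξ) + ζ ⬝ᵥ (Λ *ᵥ σ) + ζ ⬝ᵥ ζ : ℝ) : EReal) := by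
  set r : ℝ := 2 * (ζ ⬝ᵥ ξ) + ζ ⬝ᵥ (Λ *ᵥ σ) + ζ ⬝ᵥ ζ
  -- The finite constant is moved to the left so that the bound can be checked for each admissible
  -- `Γ`, then moved back.
  rw [← EReal.sub_le_iff_le_add (.inl (EReal.coe_ne_bot r)) (.inl (EReal.coe_ne_top r))]
  refine le_iInf₂ fun Γ hΓ => ?_
  rw [EReal.sub_le_iff_le_add (.inl (EReal.coe_ne_bot r)) (.inl (EReal.coe_ne_top r)),
    ← EReal.coe_add, ← energy_shift Λ t ζ hΓ]
  exact iInf₂_le _ (constraintSet_shift ζ hΓ)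

/-- The displacement rule. -/
theorem liebFunctional_shift (Λ : Matrix (Fin M) (Fin N) ℝ) (t : Fin N → ℝ) (σ : Fin N → ℝ)
    (ξ ζ : Fin M → ℝ) : liebFunctional Λ t σ (ξ + ζ) = liebFunctional Λ t σ ξ +
      ((2 * (ζ ⬝ᵥ ξ) + ζ ⬝ᵥ (Λ *ᵥ σ) + ζ ⬝ᵥ ζ : ℝ) : EReal) := by
  refine le_antisymm (liebFunctional_shift_le Λ t σ ξ ζ) ?_
  -- The reverse inequality comes from translating back from `ξ + ζ` by `-ζ`; the two corrections
  -- cancel.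
  have h := liebFunctional_shift_le Λ t σ (ξ + ζ) (-ζ)
  rw [add_neg_cancel_right] at h
  refine (add_le_add_left h _).trans ?_
  rw [add_assoc, ← EReal.coe_add]
  have e : 2 * (-ζ ⬝ᵥ (ξ + ζ)) + -ζ ⬝ᵥ (Λ *ᵥ σ) + -ζ ⬝ᵥ -ζ
      + (2 * (ζ ⬝ᵥ ξ) + ζ ⬝ᵥ (Λ *ᵥ σ) + ζ ⬝ᵥ ζ) = 0 := by
    simp only [neg_dotProduct, dotProduct_add, dotProduct_neg]
    ring
  rw [e, EReal.coe_zero, add_zero]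

theorem constraintSet_nonempty {σ : Fin N → ℝ} (hσ : ∀ n, σ n ∈ Set.Icc (-1 : ℝ) 1)
    (ξ : Fin M → ℝ) : (constraintSet (M := M) σ ξ).Nonempty := by
  obtain ⟨ξ₀, Γ, hΓ⟩ := exists_mem_constraintSet (M := M) hσ
  have := constraintSet_shift (ξ - ξ₀) hΓ
  rw [add_sub_cancel] at this
  exact ⟨_, this⟩

end

/-! ### Existence and properties of optimizers -/

section

open Filter Topology

variable {M N : ℕ}

/-! ### The lower bound for the Hamiltonian -/

theorem kineticForm_add_squareForm_apply (ψ : formDomain M N) :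
    kineticForm M N ψ ψ + squareForm M N ψ ψ = (gradPosSq ψ : ℂ) := by
  rw [kineticForm_apply, squareForm_apply, ← Finset.sum_add_distrib, gradPosSq,
    Complex.ofReal_sum]
  refine Finset.sum_congr rfl fun m _ => ?_
  rw [inner_self_eq_ofReal, inner_self_eq_ofReal, ← Complex.ofReal_add]

theorem re_hamiltonianForm (Λ : Matrix (Fin M) (Fin N) ℝ) (t : Fin N → ℝ) (ψ : formDomain M N) :
    (hamiltonianForm Λ t ψ ψ).re = gradPosSq ψ + (couplingForm Λ ψ ψ).re
      - (∑ n, (t n : ℂ) * boundedForm (sigmaX M n) ψ ψ).re := by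
  rw [hamiltonianForm_apply, kineticForm_add_squareForm_apply, Complex.sub_re, Complex.add_re,
    Complex.ofReal_re]

theorem exists_gradPosSq_le (Λ : Matrix (Fin M) (Fin N) ℝ) (t : Fin N → ℝ) :
    ∃ C : ℝ, 0 ≤ C ∧ ∀ ψ : formDomain M N,
      gradPosSq ψ ≤ 2 * (hamiltonianForm Λ t ψ ψ).re + C * ‖(ψ : Hilb M N)‖ ^ 2 := by
  set L : ℝ := ∑ m, ∑ n, |Λ m n| * ‖sigmaZ M n‖ with hL
  set τ : ℝ := ∑ n, |t n| * ‖sigmaX M n‖ with hτ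
  have hτ0 : 0 ≤ τ := Finset.sum_nonneg fun _ _ => by positivity
  -- With `r² = ‖∇ψ‖² + ‖xψ‖²` the coupling is at most `L ‖ψ‖ r`, and `2 L ‖ψ‖ r ≤ L² ‖ψ‖² + r²`.
  -- Twice the energy therefore still contains one full `r²`.
  refine ⟨L ^ 2 + 2 * τ, by positivity, fun ψ => ?_⟩
  have hG := gradPosSq_nonneg ψ
  set r := √(gradPosSq ψ) with hr
  have hr2 : r ^ 2 = gradPosSq ψ := Real.sq_sqrt hG
  have hpos (m : Fin M) : ‖position M N m ψ‖ ≤ r :=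
    Real.le_sqrt_of_sq_le (by nlinarith [sq_le_gradPosSq m ψ, sq_nonneg ‖partialD M N m ψ‖])
  have h1 : ‖couplingForm Λ ψ ψ‖ ≤ L * (‖(ψ : Hilb M N)‖ * r) := by
    rw [couplingForm_apply, hL, Finset.sum_mul]
    refine norm_sum_le_of_le _ fun m _ => ?_
    rw [Finset.sum_mul]
    refine norm_sum_le_of_le _ fun n _ => ?_
    rw [norm_mul, Complex.norm_real, Real.norm_eq_abs, mul_assoc]
    refine mul_le_mul_of_nonneg_left ?_ (abs_nonneg _)
    calc ‖⟪(ψ : Hilb M N), sigmaZ M n (position M N m ψ)⟫_ℂ‖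
        ≤ ‖(ψ : Hilb M N)‖ * (‖sigmaZ M n‖ * ‖position M N m ψ‖) :=
          (norm_inner_le_norm _ _).trans (by gcongr; exact (sigmaZ M n).le_opNorm _)
      _ ≤ ‖(ψ : Hilb M N)‖ * (‖sigmaZ M n‖ * r) := by gcongr; exact hpos m
      _ = _ := by ring
  have h2 : ‖∑ n, (t n : ℂ) * boundedForm (sigmaX M n) ψ ψ‖ ≤ τ * ‖(ψ : Hilb M N)‖ ^ 2 := by
    rw [hτ, Finset.sum_mul]
    refine norm_sum_le_of_le _ fun n _ => ?_
    rw [norm_mul, Complex.norm_real, Real.norm_eq_abs, mul_assoc]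
    refine mul_le_mul_of_nonneg_left ?_ (abs_nonneg _)
    calc ‖⟪(ψ : Hilb M N), sigmaX M n ψ⟫_ℂ‖
        ≤ ‖(ψ : Hilb M N)‖ * (‖sigmaX M n‖ * ‖(ψ : Hilb M N)‖) :=
          (norm_inner_le_norm _ _).trans (by gcongr; exact (sigmaX M n).le_opNorm _)
      _ = _ := by ring
  have h3 := neg_le_of_abs_le ((Complex.abs_re_le_norm _).trans h1)
  have h4 := (le_abs_self _).trans ((Complex.abs_re_le_norm _).trans h2)
  rw [re_hamiltonianForm]
  nlinarith [sq_nonneg (L * ‖(ψ : Hilb M N)‖ - r)]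

/-! ### Continuity and lower semicontinuity -/

/-- Strong convergence on one side and bounded weak convergence on the other suffice. This makes the
position and coupling terms continuous, although `x_m ψ` converges only weakly. -/
theorem tendsto_inner_of_weakTendsto {E : Type*} [NormedAddCommGroup E] [InnerProductSpace ℂ E]
    {u v : ℕ → E} {a b : E} {C : ℝ} (hu : Tendsto u atTop (𝓝 a)) (hv : WeakTendsto v b)
    (hC : ∀ n, ‖v n‖ ≤ C) : Tendsto (fun n => ⟪u n, v n⟫_ℂ) atTop (𝓝 ⟪a, b⟫_ℂ) := by
  have h1 : Tendsto (fun n => ⟪u n - a, v n⟫_ℂ) atTop (𝓝 0) := by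
    refine squeeze_zero_norm (a := fun n => ‖u n - a‖ * C) (fun n => ?_) ?_
    · exact (norm_inner_le_norm _ _).trans (mul_le_mul_of_nonneg_left (hC n) (norm_nonneg _))
    · simpa using (tendsto_iff_norm_sub_tendsto_zero.1 hu).mul_const C
  have h2 := h1.add (hv a)
  rw [zero_add] at h2
  refine h2.congr fun n => ?_
  rw [inner_sub_left, sub_add_cancel]

theorem WeakTendsto.map {E : Type*} [NormedAddCommGroup E] [InnerProductSpace ℂ E]
    [CompleteSpace E] {v : ℕ → E} {b : E} (hv : WeakTendsto v b) (T : E →L[ℂ] E) :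
    WeakTendsto (fun n => T (v n)) (T b) := fun φ => by
  simp_rw [← ContinuousLinearMap.adjoint_inner_left]
  exact hv _

namespace FormTendsto

variable {u : ℕ → formDomain M N} {a : formDomain M N} {C : ℝ}

theorem tendsto_boundedForm (h : FormTendsto u a) (B : Hilb M N →L[ℂ] Hilb M N) :
    Tendsto (fun n => boundedForm B (u n) (u n)) atTop (𝓝 (boundedForm B a a)) :=
  h.strong.inner ((B.continuous.tendsto _).comp h.strong)

theorem tendsto_norm_sq (h : FormTendsto u a) :
    Tendsto (fun n => ‖(u n : Hilb M N)‖ ^ 2) atTop (𝓝 (‖(a : Hilb M N)‖ ^ 2)) :=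
  h.strong.norm.pow 2

theorem tendsto_inner_map_position (h : FormTendsto u a)
    (hC : ∀ n, ‖(u n : Hilb M N)‖ ^ 2 + gradPosSq (u n) ≤ C) (T : Hilb M N →L[ℂ] Hilb M N)
    (m : Fin M) : Tendsto (fun n => ⟪(u n : Hilb M N), T (MultiModeDicke.position M N m (u n))⟫_ℂ)
      atTop (𝓝 ⟪(a : Hilb M N), T (MultiModeDicke.position M N m a)⟫_ℂ) := by
  refine tendsto_inner_of_weakTendsto (C := ‖T‖ * √C) h.strong ((h.position m).map T) fun n => ?_
  refine (T.le_opNorm _).trans (mul_le_mul_of_nonneg_left ?_ (norm_nonneg _))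
  exact Real.le_sqrt_of_sq_le (by linarith [hC n, bound_position m (u n)])

theorem tendsto_positionForm (h : FormTendsto u a)
    (hC : ∀ n, ‖(u n : Hilb M N)‖ ^ 2 + gradPosSq (u n) ≤ C) (m : Fin M) :
    Tendsto (fun n => positionForm M N m (u n) (u n)) atTop (𝓝 (positionForm M N m a a)) :=
  h.tendsto_inner_map_position hC (.id ℂ _) m

theorem tendsto_couplingForm (h : FormTendsto u a)
    (hC : ∀ n, ‖(u n : Hilb M N)‖ ^ 2 + gradPosSq (u n) ≤ C) (Λ : Matrix (Fin M) (Fin N) ℝ) :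
    Tendsto (fun n => couplingForm Λ (u n) (u n)) atTop (𝓝 (couplingForm Λ a a)) := by
  simp_rw [couplingForm_apply]
  exact tendsto_finsetSum _ fun m _ => tendsto_finsetSum _ fun n _ =>
    (h.tendsto_inner_map_position hC (sigmaZ M n) m).const_mul _

/-- The supporting affine function of the convex function `‖·‖²` at `φ`; as a function of `χ` it is
weakly continuous. -/
theorem _root_.MultiModeDicke.two_mul_re_inner_sub_le (φ χ : Hilb M N) :
    2 * (⟪φ, χ⟫_ℂ).re - ‖φ‖ ^ 2 ≤ ‖χ‖ ^ 2 := by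
  have h1 := norm_sub_sq (𝕜 := ℂ) φ χ
  rw [RCLike.re_eq_complex_re] at h1
  nlinarith [sq_nonneg ‖φ - χ‖]

theorem _root_.MultiModeDicke.WeakTendsto.tendsto_two_mul_re_sub {v : ℕ → Hilb M N}
    {b : Hilb M N} (hv : WeakTendsto v b) :
    Tendsto (fun n => 2 * (⟪b, v n⟫_ℂ).re - ‖b‖ ^ 2) atTop (𝓝 (‖b‖ ^ 2)) := by
  have h1 := (((Complex.continuous_re.tendsto _).comp (hv b)).const_mul 2).sub_const (‖b‖ ^ 2)
  rw [inner_self_eq_ofReal, Complex.ofReal_re] at h1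
  rwa [show 2 * ‖b‖ ^ 2 - ‖b‖ ^ 2 = ‖b‖ ^ 2 by ring] at h1

/-- The energy is lower semicontinuous: it is bounded below by a sequence that converges to the
energy of the limit. -/
theorem exists_tendsto_le (h : FormTendsto u a)
    (hC : ∀ n, ‖(u n : Hilb M N)‖ ^ 2 + gradPosSq (u n) ≤ C) (Λ : Matrix (Fin M) (Fin N) ℝ)
    (t : Fin N → ℝ) : ∃ l : ℕ → ℝ, Tendsto l atTop (𝓝 (hamiltonianForm Λ t a a).re) ∧
      ∀ n, l n ≤ (hamiltonianForm Λ t (u n) (u n)).re := by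
  -- The kinetic and quadratic terms are replaced by their supporting affine functions at the limit
  -- `a`; the remaining terms are kept, being continuous.
  refine ⟨fun n => ∑ m, ((2 * (⟪MultiModeDicke.partialD M N m a,
      MultiModeDicke.partialD M N m (u n)⟫_ℂ).re - ‖MultiModeDicke.partialD M N m a‖ ^ 2)
    + (2 * (⟪MultiModeDicke.position M N m a, MultiModeDicke.position M N m (u n)⟫_ℂ).re
      - ‖MultiModeDicke.position M N m a‖ ^ 2))
    + (couplingForm Λ (u n) (u n)).re
    - (∑ k, (t k : ℂ) * boundedForm (sigmaX M k) (u n) (u n)).re, ?_, fun n => ?_⟩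
  · rw [re_hamiltonianForm]
    refine ((tendsto_finsetSum _ fun m _ => ((h.partialD m).tendsto_two_mul_re_sub).add
      (h.position m).tendsto_two_mul_re_sub).add
      ((Complex.continuous_re.tendsto _).comp (h.tendsto_couplingForm hC Λ))).sub
      ((Complex.continuous_re.tendsto _).comp (tendsto_finsetSum _ fun k _ =>
        (h.tendsto_boundedForm (sigmaX M k)).const_mul _))
  · rw [re_hamiltonianForm]
    refine sub_le_sub_right (add_le_add_left (Finset.sum_le_sum fun m _ => add_le_add ?_ ?_) _) _
    · exact two_mul_re_inner_sub_le _ _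
    · exact two_mul_re_inner_sub_le _ _

end FormTendsto

/-! ### Existence of real optimizers -/

/-- The vectors need not be orthogonal, and competitors range over all admissible density matrices.
A fixed number of vectors is what lets compactness be applied vector by vector. -/
theorem exists_finite_minimizer (Λ : Matrix (Fin M) (Fin N) ℝ) (t : Fin N → ℝ) {σ : Fin N → ℝ}
    {ξ : Fin M → ℝ} (hne : (constraintSet (M := M) σ ξ).Nonempty) :
    ∃ (k : ℕ) (a : Fin k → formDomain M N), ∑ i, ‖(a i : Hilb M N)‖ ^ 2 = 1 ∧
      (∀ n, ∑ i, (boundedForm (sigmaZ M n) (a i) (a i)).re = σ n) ∧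
      (∀ m, ∑ i, (positionForm M N m (a i) (a i)).re = ξ m) ∧
      ∀ Γ ∈ constraintSet σ ξ, ∑ i, (hamiltonianForm Λ t (a i) (a i)).re ≤ energy Λ t Γ := by
  let A : Fin N ⊕ Fin M ⊕ Unit → Form M N := Sum.elim (fun n => boundedForm (sigmaZ M n))
    (Sum.elim (fun m => positionForm M N m) fun _ => hamiltonianForm Λ t)
  have hA : ∀ i, (A i).IsBounded := by
    rintro (n | m | _)
    exacts [isBounded_boundedForm _, isBounded_positionForm M N m, isBounded_hamiltonianForm Λ t]
  obtain ⟨C, hC0, hC⟩ := exists_gradPosSq_le Λ t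
  have hC' {k : ℕ} (u : Fin k → formDomain M N) (hu : ∑ i, ‖(u i : Hilb M N)‖ ^ 2 = 1) :
      ∑ i, gradPosSq (u i) ≤ 2 * ∑ i, (hamiltonianForm Λ t (u i) (u i)).re + C := by
    have := Finset.sum_le_sum fun i (_ : i ∈ Finset.univ) => hC (u i)
    rwa [Finset.sum_add_distrib, ← Finset.mul_sum, ← Finset.mul_sum, hu, mul_one] at this
  have hbdd : BddBelow (energy Λ t '' constraintSet (M := M) σ ξ) := by
    -- An ensemble whose energy is within `1` of that of `Γ` satisfies `0 ≤ ∑ gradPosSq ≤ 2 (energy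
    -- + 1) + C`.
    refine ⟨-C / 2 - 1, ?_⟩
    rintro _ ⟨Γ, hΓ, rfl⟩
    obtain ⟨u, hu, hu'⟩ := exists_ensemble_approx hA hΓ.1 zero_lt_one
    have h1 := (abs_lt.1 (hu' (.inr (.inr ())))).2
    change ∑ k, (hamiltonianForm Λ t (u k) (u k)).re - energy Λ t Γ < 1 at h1
    have h2 := hC' u hu
    have h3 : 0 ≤ ∑ i, gradPosSq (u i) := Finset.sum_nonneg fun i _ => gradPosSq_nonneg _
    linarith
  obtain ⟨e, -, he, hmem⟩ := exists_seq_tendsto_sInf (hne.image (energy Λ t)) hbdd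
  choose Γ hΓ hΓe using hmem
  -- The ensembles meet the constraints only up to `1/(n+1)`; the constraints become exact in the
  -- limit.
  choose u hu hu' using fun n : ℕ => exists_ensemble_approx hA (hΓ n).1
    (Nat.one_div_pos_of_nat (α := ℝ) (n := n))
  obtain ⟨E, hE⟩ := he.bddAbove_range
  have hlim (i : Fin N ⊕ Fin M ⊕ Unit) {l : ℝ}
      (hl : Tendsto (fun n => (trace (A i) (Γ n)).re) atTop (𝓝 l)) :
      Tendsto (fun n => ∑ k, (A i (u n k) (u n k)).re) atTop (𝓝 l) := by
    have h1 : Tendsto (fun n => ∑ k, (A i (u n k) (u n k)).re - (trace (A i) (Γ n)).re) atTop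
        (𝓝 0) := squeeze_zero_norm (fun n => (hu' n i).le) tendsto_one_div_add_atTop_nhds_zero_nat
    simpa using h1.add hl
  -- The energies of the states are at most `E`, those of the ensembles at most `E + 1`; positivity
  -- lets each vector inherit the bound of the sum.
  have hbound (k : Fin (Fintype.card (Fin N ⊕ Fin M ⊕ Unit) + 1)) (n : ℕ) :
      ‖(u n k : Hilb M N)‖ ^ 2 + gradPosSq (u n k) ≤ 1 + (2 * (E + 1) + C) := by
    have h1 := Finset.single_le_sum (f := fun k => ‖(u n k : Hilb M N)‖ ^ 2)
      (fun _ _ => by positivity) (Finset.mem_univ k)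
    have h2 := Finset.single_le_sum (f := fun k => gradPosSq (u n k))
      (fun _ _ => gradPosSq_nonneg _) (Finset.mem_univ k)
    have h3 := (abs_lt.1 (hu' n (.inr (.inr ())))).2
    change ∑ k, (hamiltonianForm Λ t (u n k) (u n k)).re - energy Λ t (Γ n) < _ at h3
    have h4 : e n ≤ E := hE ⟨n, rfl⟩
    have h5 : 1 / ((n : ℝ) + 1) ≤ 1 := by
      rw [div_le_one (by positivity)]
      linarith [(Nat.cast_nonneg n : (0 : ℝ) ≤ n)]
    have h6 := hC' (u n) (hu n)
    have h7 := hu n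
    have h8 := hΓe n
    linarith
  obtain ⟨a, θ, hθ, ha⟩ := exists_formTendsto_subseq (u := fun k n => u n k) hbound
  refine ⟨_, a, ?_, fun n => ?_, fun m => ?_, fun Γ' hΓ' => ?_⟩
  -- No mass is lost in the limit because the convergence in `L²` is strong.
  · refine tendsto_nhds_unique (tendsto_finsetSum _ fun k _ => (ha k).tendsto_norm_sq) ?_
    simp [hu]
  · refine tendsto_nhds_unique (tendsto_finsetSum _ fun k _ =>
      (Complex.continuous_re.tendsto _).comp ((ha k).tendsto_boundedForm (sigmaZ M n))) ?_
    refine (hlim (.inl n) (l := σ n) ?_).comp hθ.tendsto_atTop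
    refine tendsto_const_nhds.congr fun j => ?_
    exact (congrArg Complex.re ((hΓ j).2.1 n)).symm
  · refine tendsto_nhds_unique (tendsto_finsetSum _ fun k _ =>
      (Complex.continuous_re.tendsto _).comp
        ((ha k).tendsto_positionForm (fun j => hbound k (θ j)) m)) ?_
    refine (hlim (.inr (.inl m)) (l := ξ m) ?_).comp hθ.tendsto_atTop
    refine tendsto_const_nhds.congr fun j => ?_
    exact (congrArg Complex.re ((hΓ j).2.2 m)).symm
  · choose l hl hl' using fun k => (ha k).exists_tendsto_le (fun j => hbound k (θ j)) Λ t
    have h1 := (hlim (.inr (.inr ())) (he.congr fun n => (hΓe n).symm)).comp hθ.tendsto_atTop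
    refine (le_of_tendsto_of_tendsto' (tendsto_finsetSum _ fun k _ => hl k) h1 fun j =>
      Finset.sum_le_sum fun k _ => hl' k j).trans ?_
    exact csInf_le hbdd ⟨Γ', hΓ', rfl⟩

/-- Each vector of the finite minimizer is split into its real and imaginary parts. For a real form
the split ensemble yields the real part of the original expectation, so constraints, normalization
and energy are all retained, now as identities in `ℂ`. -/
theorem exists_real_optimizer (Λ : Matrix (Fin M) (Fin N) ℝ) (t : Fin N → ℝ) {σ : Fin N → ℝ}
    {ξ : Fin M → ℝ} (hne : (constraintSet (M := M) σ ξ).Nonempty) :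
    ∃ Γ, IsOptimizer Λ t σ ξ Γ ∧ ∃ K, IsIntegralKernel Γ K ∧
      ∀ x x' α β, (starRingEnd ℂ) (K x x' α β) = K x x' α β := by
  obtain ⟨k, a, ha, hz, hx, hmin⟩ := exists_finite_minimizer Λ t hne
  let v : Fin k ⊕ Fin k → formDomain M N := Sum.elim (fun i => rePart (a i)) fun i => imPart (a i)
  have hsum {A : Form M N} (hA : A.IsReal) :
      ∑ i, A (v i) (v i) = ((∑ i, (A (a i) (a i)).re : ℝ) : ℂ) := by
    rw [Fintype.sum_sum_type, ← Finset.sum_add_distrib, Complex.ofReal_sum]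
    exact Finset.sum_congr rfl fun i _ => hA.rePart_add_imPart (a i)
  have hv : ∑ i, ‖(v i : Hilb M N)‖ ^ 2 = 1 := by
    have h1 := hsum (isReal_boundedForm (B := (1 : Hilb M N →L[ℂ] Hilb M N)) fun _ => rfl)
    simp_rw [boundedForm_one_apply, Complex.ofReal_re, ha, ← Complex.ofReal_sum] at h1
    exact_mod_cast h1
  obtain ⟨hmem, htr⟩ := ensemble_mem_and_trace v hv
  have hcon : ensemble v ∈ constraintSet σ ξ := by
    refine ⟨hmem, fun n => ?_, fun m => ?_⟩
    · rw [htr _ (isBounded_boundedForm _), hsum (isReal_boundedForm (sigmaZ_conjHilb n)), hz]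
    · rw [htr _ (isBounded_positionForm M N m), hsum (isReal_positionForm m), hx]
  have hen : energy Λ t (ensemble v) = ∑ i, (hamiltonianForm Λ t (a i) (a i)).re := by
    rw [energy, htr _ (isBounded_hamiltonianForm Λ t), hsum (isReal_hamiltonianForm Λ t),
      Complex.ofReal_re]
  refine ⟨ensemble v, ⟨hcon, le_antisymm (iInf₂_le _ hcon) (le_iInf₂ fun Γ hΓ => ?_)⟩,
    exists_real_kernel v ?_⟩
  · rw [hen]
    exact EReal.coe_le_coe_iff.2 (hmin Γ hΓ)
  · rintro (i | i)
    exacts [conjHilb_rePart (a i), conjHilb_imPart (a i)]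

/-! ### Virial relation and zero momentum -/

theorem IsOptimizer.energy_le {Λ : Matrix (Fin M) (Fin N) ℝ} {t σ : Fin N → ℝ} {ξ : Fin M → ℝ}
    {Γ Γ' : Hilb M N →L[ℂ] Hilb M N} (h : IsOptimizer Λ t σ ξ Γ) (h' : Γ' ∈ constraintSet σ ξ) :
    energy Λ t Γ ≤ energy Λ t Γ' := by
  rw [← EReal.coe_le_coe_iff, ← h.2]
  exact iInf₂_le _ h'

theorem inner_sigmaZ_comm (n : Fin N) (ψ φ : Hilb M N) :
    ⟪sigmaZ M n ψ, φ⟫_ℂ = ⟪ψ, sigmaZ M n φ⟫_ℂ := by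
  rw [L2.inner_def, L2.inner_def]
  apply integral_congr_ae
  filter_upwards [coeFn_spinOp (liftMatrix pauliZ n) ψ, coeFn_spinOp (liftMatrix pauliZ n) φ]
    with x h1 h2
  rw [sigmaZ, h1, h2, liftMatrix_pauliZ, PiLp.inner_apply, PiLp.inner_apply]
  refine Finset.sum_congr rfl fun α _ => ?_
  simp only [Matrix.ofLp_toEuclideanCLM, Matrix.mulVec_diagonal, RCLike.inner_apply, map_mul,
    Complex.conj_ofReal]
  ring

theorem hasPosition_sigmaZ {m : Fin M} {ψ g : Hilb M N} (h : HasPosition m ψ g) (n : Fin N) :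
    HasPosition m (sigmaZ M n ψ) (sigmaZ M n g) := by
  filter_upwards [h, coeFn_spinOp (liftMatrix pauliZ n) ψ, coeFn_spinOp (liftMatrix pauliZ n) g]
    with x hx h1 h2
  rw [sigmaZ, h1, h2, hx, map_smul]

theorem inner_position_symm {m : Fin M} {ψ φ g k : Hilb M N} (h : HasPosition m ψ g)
    (h' : HasPosition m φ k) : ⟪g, φ⟫_ℂ = ⟪ψ, k⟫_ℂ := by
  rw [L2.inner_def, L2.inner_def]
  apply integral_congr_ae
  filter_upwards [h, h'] with x hx hx'
  rw [hx, hx', inner_smul_left, inner_smul_right, Complex.conj_ofReal]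

/-- `σ_z^n` and `x_m` are symmetric and commute, so their product is symmetric. The virial relation
equates complex traces, so its imaginary part must be checked as well. -/
theorem couplingForm_im (Λ : Matrix (Fin M) (Fin N) ℝ) (ψ : formDomain M N) :
    (couplingForm Λ ψ ψ).im = 0 := by
  rw [couplingForm_apply, Complex.im_sum]
  refine Finset.sum_eq_zero fun m _ => ?_
  rw [Complex.im_sum]
  refine Finset.sum_eq_zero fun n _ => ?_
  rw [Complex.im_ofReal_mul]
  have h1 := inner_conj_symm (𝕜 := ℂ) (sigmaZ M n (position M N m ψ)) (ψ : Hilb M N)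
  rw [inner_sigmaZ_comm, inner_position_symm (position_spec m ψ)
    (hasPosition_sigmaZ (position_spec m ψ) n)] at h1
  rw [Complex.conj_eq_iff_im.1 h1, mul_zero]

/-- The right-hand side, as a function of `s > 0`, is minimal at `s = 1`, and `2T - 2V - C` is its
derivative there. -/
theorem eq_zero_of_forall_scaling {T V C : ℝ}
    (h : ∀ s : ℝ, 0 < s → T + V + C ≤ s ^ 2 * T + s⁻¹ ^ 2 * V + s⁻¹ * C) :
    2 * T - 2 * V - C = 0 := by
  have hd : HasDerivAt (fun s : ℝ => s ^ 2 * T + s⁻¹ ^ 2 * V + s⁻¹ * C)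
      (2 * T - 2 * V - C) 1 := by
    have hi := hasDerivAt_inv (one_ne_zero (α := ℝ))
    have := ((((hasDerivAt_id (1 : ℝ)).pow 2).mul_const T).add ((hi.pow 2).mul_const V)).add
      (hi.mul_const C)
    exact this.congr_deriv (by simp; ring)
  refine IsLocalMin.hasDerivAt_eq_zero ?_ hd
  filter_upwards [lt_mem_nhds (zero_lt_one (α := ℝ))] with s hs
  simpa using h s hs

/-- The virial relation. -/
theorem IsOptimizer.virial {Λ : Matrix (Fin M) (Fin N) ℝ} {t σ : Fin N → ℝ}
    {Γ : Hilb M N →L[ℂ] Hilb M N} (h : IsOptimizer Λ t σ 0 Γ) :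
    trace (kineticForm M N - squareForm M N) Γ = 1 / 2 * trace (couplingForm Λ) Γ := by
  obtain ⟨hD, hz, hx⟩ := h.1
  have hk := isBounded_kineticForm M N
  have hs := isBounded_squareForm M N
  have key := eq_zero_of_forall_scaling (T := (trace (kineticForm M N) Γ).re)
    (V := (trace (squareForm M N) Γ).re) (C := (trace (couplingForm Λ) Γ).re) fun s hs0 => by
      have hc := isCanonical_dilation (M := M) (N := N) hs0
      -- A dilation multiplies the mean position by `s⁻¹`, so it respects the constraint precisely
      -- because the prescribed value is `0`.
      have hmem : conjBy (isScaling_dilation hs0).equiv Γ ∈ constraintSet σ 0 :=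
        ⟨hc.conjBy_mem hD, fun n => by rw [sigmaZ, hc.trace_spin hD, ← sigmaZ, hz],
          fun m => by rw [hc.trace_positionForm hD, hx]; simp⟩
      have h1 := h.energy_le hmem
      rw [energy, energy, hc.trace_hamiltonianForm Λ t hD, trace_hamiltonianForm Λ t hD] at h1
      simp only [Pi.zero_apply, Complex.ofReal_zero, mul_zero, zero_mul, Finset.sum_const_zero,
        ne_eq, OfNat.ofNat_ne_zero, not_false_eq_true, zero_pow, add_zero, Complex.sub_re,
        Complex.add_re, Complex.re_ofReal_mul, ← Complex.ofReal_pow] at h1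
      linarith
  rw [trace_sub hk hs hD]
  have hreal (φ : Hilb M N) : (⟪φ, φ⟫_ℂ).im = 0 := by
    rw [inner_self_eq_ofReal, Complex.ofReal_im]
  have i1 := trace_im hk hD fun ψ => by
    simp only [kineticForm_apply, Complex.im_sum, hreal, Finset.sum_const_zero]
  have i2 := trace_im hs hD fun ψ => by
    simp only [squareForm_apply, Complex.im_sum, hreal, Finset.sum_const_zero]
  have i3 := trace_im (isBounded_couplingForm Λ) hD (couplingForm_im Λ)
  have e : (1 / 2 : ℂ) = ((1 / 2 : ℝ) : ℂ) := by norm_num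
  rw [e]
  refine Complex.ext ?_ ?_
  · rw [Complex.sub_re, Complex.re_ofReal_mul]
    linarith
  · rw [Complex.sub_im, Complex.im_ofReal_mul, i1, i2, i3]
    simp

theorem momentumForm_im (m : Fin M) (ψ : formDomain M N) : (momentumForm M N m ψ ψ).im = 0 := by
  rw [momentumForm_apply]
  simpa using (partialD_spec m ψ).hasWeakDirDeriv.re_inner

/-- Optimizers have zero momentum. -/
theorem IsOptimizer.trace_momentumForm {Λ : Matrix (Fin M) (Fin N) ℝ} {t σ : Fin N → ℝ}
    {ξ : Fin M → ℝ} {Γ : Hilb M N →L[ℂ] Hilb M N} (h : IsOptimizer Λ t σ ξ Γ) (m : Fin M) :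
    trace (momentumForm M N m) Γ = 0 := by
  obtain ⟨hD, hz, hx⟩ := h.1
  -- The boost leaves spins and positions alone and changes only the kinetic energy, by `2 p P +
  -- p²`.
  have key (p : ℝ) : 0 ≤ 2 * p * (trace (momentumForm M N m) Γ).re + p ^ 2 := by
    have hc := isCanonical_boost (M := M) (N := N) m p
    have hmem : conjBy (isScaling_phase m p).equiv Γ ∈ constraintSet σ ξ :=
      ⟨hc.conjBy_mem hD, fun n => by rw [sigmaZ, hc.trace_spin hD, ← sigmaZ, hz],
        fun k => by rw [hc.trace_positionForm hD, hx]; simp⟩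
    have h1 := h.energy_le hmem
    have e1 : ∑ k, (2 * ((1 : ℝ) : ℂ) * ((Pi.single m p : Fin M → ℝ) k : ℂ))
        * trace (momentumForm M N k) Γ = ((2 * p : ℝ) : ℂ) * trace (momentumForm M N m) Γ := by
      rw [Finset.sum_eq_single m]
      · simp
      · intro k _ hk
        simp [Pi.single_eq_of_ne hk]
      · simp
    have e2 : ∑ k, (((Pi.single m p : Fin M → ℝ) k : ℝ) : ℂ) ^ 2 = ((p ^ 2 : ℝ) : ℂ) := by
      rw [Finset.sum_eq_single m]
      · simp
      · intro k _ hk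
        simp [Pi.single_eq_of_ne hk]
      · simp
    rw [energy, energy, hc.trace_hamiltonianForm Λ t hD, trace_hamiltonianForm Λ t hD, e1, e2] at h1
    simp only [Pi.zero_apply, Complex.ofReal_zero, mul_zero, zero_mul, Finset.sum_const_zero,
      ne_eq, OfNat.ofNat_ne_zero, not_false_eq_true, zero_pow, add_zero, Complex.sub_re,
      Complex.add_re, Complex.re_ofReal_mul, Complex.ofReal_one, one_pow, one_mul,
      Complex.ofReal_re] at h1
    linarith
  refine Complex.ext ?_ (trace_im (isBounded_momentumForm M N m) hD (momentumForm_im m))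
  -- The choice `p = -P` minimizes the quadratic and gives `0 ≤ -P²`.
  have h1 := key (-(trace (momentumForm M N m) Γ).re)
  rw [Complex.zero_re]
  nlinarith [sq_nonneg (trace (momentumForm M N m) Γ).re]

end

end MultiModeDicke

end

open MultiModeDicke in
theorem theorem3p14 (M N : ℕ) (Λ : Matrix (Fin M) (Fin N) ℝ) (t : Fin N → ℝ) (ht : t ≠ 0)
    (σ : Fin N → ℝ) (hσ : ∀ n, σ n ∈ Set.Icc (-1 : ℝ) 1) (ξ : Fin M → ℝ) :
    (∀ ζ : Fin M → ℝ, liebFunctional Λ t σ (ξ + ζ) = liebFunctional Λ t σ ξ +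
        ((2 * (ζ ⬝ᵥ ξ) + ζ ⬝ᵥ (Λ *ᵥ σ) + ζ ⬝ᵥ ζ : ℝ) : EReal)) ∧
    liebFunctional Λ t σ ξ = liebFunctional Λ t σ 0 + ((ξ ⬝ᵥ (Λ *ᵥ σ) + ξ ⬝ᵥ ξ : ℝ) : EReal) ∧
    (∃ Γ, IsOptimizer Λ t σ ξ Γ ∧ ∃ K, IsIntegralKernel Γ K ∧
      ∀ x x' α β, (starRingEnd ℂ) (K x x' α β) = K x x' α β) ∧
    (∀ Γ, IsOptimizer Λ t σ 0 Γ →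
      trace (kineticForm M N - squareForm M N) Γ = 1 / 2 * trace (couplingForm Λ) Γ) ∧
    ∀ Γ, IsOptimizer Λ t σ ξ Γ → ∀ m, trace (momentumForm M N m) Γ = 0 := by
  refine ⟨fun ζ => liebFunctional_shift Λ t σ ξ ζ, ?_,
    exists_real_optimizer Λ t (constraintSet_nonempty hσ ξ), fun Γ h => h.virial,
    fun Γ h m => h.trace_momentumForm m⟩
  have h := liebFunctional_shift Λ t σ 0 ξ
  rwa [zero_add, dotProduct_zero, mul_zero, zero_add] at h
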